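/- Let $M$ be a (smooth, second countable, Hausdorff, finite dimensional) Riemannian manifold, possibly with boundary and corners, and let $m$ be its Lebesgue (Riemannian volume) measure on the Borel sets. Let $f:M\to M$ be a (Borel measurable) piecewise $C^{1+\eta}$ map, $0<\eta\le 1$: there are at most countably many pairwise disjoint open sets $M_1,M_2,\dots$ with $\bigcup_i\overline{M_i}=M$ such that $f|_{\bigcup_i M_i}$ is $C^1$ with locally $\eta$-Hölder derivative, and the singular set $S=M\setminus\bigcup_i M_i$ satisfies $m(S)=0$. Let $\Delta_0\subset M\setminus S$ be a Borel set with $m(\Delta_0)>0$, let $\mathcal P$ be a countable $m$ mod $0$ partition of $\Delta_0$ into sets that are open in $\Delta_0$, and let $R:\Delta_0\to\{1,2,\dots\}$ be constant on each $\omega\in\mathcal P$, with $f^j(\omega)\cap S=\emptyset$ for $1\le j\le R(\omega)$ and $f^{R(\omega)}(\omega)\subset\Delta_0$. Let $F=f^R:\Delta_0\to\Delta_0$ be the induced map, $F|_\omega=f^{R(\omega)}|_\omega$ for $\omega\in\mathcal P$. Assume that $F$ is Gibbs–Markov, that is: 1. $F$ maps each $\omega\in\mathcal P$ bijectively to $\Delta_0$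 mod $0$; 2. there is a measurable $J_F:\Delta_0\to(0,\infty)$ with $m(F(A))=\int_A J_F\,dm$ for every measurable $A\subset\omega\in\mathcal P$; 3. the partitions $\mathcal P_n=\bigvee_{i=0}^{n-1}F^{-i}\mathcal P$, $n\ge 1$, generate the Borel $\sigma$-algebra of $\Delta_0$ mod $0$; 4. $\bigvee_{i=0}^{\infty}F^{-i}\mathcal P$ is the partition of $\Delta_0$ into single points mod $0$; 5. there are $C>0$ and $0<\beta<1$ with $\log\frac{J_F(x)}{J_F(y)}\le C\beta^{s(F(x),F(y))}$ for all $x,y\in\omega\in\mathcal P$, where $s(x,y)$ is the least $n\ge 0$ such that $F^n(x)$ and $F^n(y)$ lie in distinct elements of $\mathcal P$ (and $s(x,y)=0$ if there is no such $n$). Assume moreover that $\int_{\Delta_0}R\,dm<\infty$, and let $\mu$ be an ergodic SRB measure for $f$ (an ergodic $f$-invariant probability measure with $\mu\ll m$) given by $f^R$, that is, $$\mu=\frac{1}{\sum_{j\ge 0}\nu_0(\{R>j\})}\sum_{j\ge 0}f^j_*\bigl(\nu_0|_{\{R>j\}}\bigr)$$ for an ergodic $F$-invariant probability measure $\nu_0\ll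 m$ on $\Delta_0$. If $|\det Df|$ is bounded on $M\setminus S$ and $\int_{\Delta_0}R^2\,dm<\infty$, then $|\det Df|>0$ holds $\mu$-almost everywhere, $\log|\det Df|$ is $\mu$-integrable, and the measure-theoretic (Kolmogorov–Sinai) entropy of $f$ with respect to $\mu$ is $$h_\mu(f)=\int_M\log|\det Df|\,d\mu<\infty .$$ -/

import Mathlib

open MeasureTheory Set Filter Topology Manifold Bundle
open scoped ENNReal NNReal ContDiff

noncomputable section

/-! ### Measure-theoretic (Kolmogorov–Sinai) entropy

A finite measurable partition of `X` is encoded by a measurable labelling `ξ : X → Fin k`, whose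
fibres are the atoms. -/

section Entropy

variable {X : Type*} [MeasurableSpace X]

/-- `H_μ(ξ) = - ∑ μ(A) log μ(A)`, the sum being over the atoms `A` of the finite partition into the
fibres of `ξ`. -/
def partitionEntropy {ι : Type*} [Fintype ι] (μ : Measure X) (ξ : X → ι) : ℝ :=
  ∑ a, Real.negMulLog (μ.real (ξ ⁻¹' {a}))

/-- The labelling of the refined partition `⋁_{i < n} f^{-i} ξ`. -/
def itinerary {ι : Type*} (f : X → X) (ξ : X → ι) (n : ℕ) : X → (Fin n → ι) :=
  fun x i => ξ (f^[i] x)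

/-- `h_μ(f, ξ) = inf_{n ≥ 1} (1/n) H_μ(⋁_{i < n} f^{-i} ξ)`. -/
def entropyOfPartition {k : ℕ} (f : X → X) (μ : Measure X) (ξ : X → Fin k) : ℝ :=
  ⨅ n : ℕ, partitionEntropy μ (itinerary f ξ (n + 1)) / ((n : ℝ) + 1)

/-- `h_μ(f)`: the supremum of `h_μ(f, ξ)` over all finite measurable partitions `ξ`. -/
def measureEntropy (f : X → X) (μ : Measure X) : EReal :=
  ⨆ (k : ℕ) (ξ : X → Fin k) (_ : Measurable ξ), (entropyOfPartition f μ ξ : EReal)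

/-- An SRB measure (relative to the reference measure `m`): an invariant probability measure that
is absolutely continuous with respect to `m`. -/
structure IsSRBMeasure (m : Measure X) (f : X → X) (μ : Measure X) : Prop where
  isProbabilityMeasure : IsProbabilityMeasure μ
  measurePreserving : MeasurePreserving f μ μ
  absolutelyContinuous : μ ≪ m

end Entropy

/-! ### Riemannian volume, Jacobian, piecewise `C^{1+η}` maps

The manifold may have boundary and corners; its dimension is `d`. -/

section Riemannian

variable {d : ℕ} {H : Type*} [TopologicalSpace H]
  (I : ModelWithCorners ℝ (EuclideanSpace ℝ (Fin d)) H)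
  {M : Type*} [TopologicalSpace M] [ChartedSpace H M]

/-- `|det Df(x)|`: the absolute value of the determinant of `Df(x) : T_x M → T_{f x} M` with respect
to orthonormal bases for the Riemannian metric. -/
def absDetDeriv [RiemannianBundle (fun x : M => TangentSpace I x)] (f : M → M) (x : M) : ℝ :=
  haveI : FiniteDimensional ℝ (TangentSpace I x) :=
    inferInstanceAs (FiniteDimensional ℝ (EuclideanSpace ℝ (Fin d)))
  LinearMap.normDet (mfderiv I I f x).toLinearMap

/-- The density `√det(g_ij)` of the Riemannian volume in the chart at `c`, at the point `z` of the
model space: the volume factor of the derivative at `z` of the inverse chart. -/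
def chartVolumeDensity [RiemannianBundle (fun x : M => TangentSpace I x)] (c : M)
    (z : EuclideanSpace ℝ (Fin d)) : ℝ :=
  LinearMap.normDet (U := EuclideanSpace ℝ (Fin d)) (V := TangentSpace I ((extChartAt I c).symm z))
    (mfderivWithin 𝓘(ℝ, EuclideanSpace ℝ (Fin d)) I (extChartAt I c).symm (range I) z).toLinearMap

/-- The Riemannian volume restricted to the domain of the chart at `c`: the measure
`√det(g_ij) dz` on the range of the chart, carried over to `M`. -/
def chartVolume [RiemannianBundle (fun x : M => TangentSpace I x)] [MeasurableSpace M]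
    (c : M) : Measure M :=
  ((volume.restrict (extChartAt I c).target).withDensity
    (fun z => ENNReal.ofReal (chartVolumeDensity I c z))).map (extChartAt I c).symm

variable (M) in
/-- The Lebesgue (Riemannian volume) measure of `M`: the least measure dominating the chart volumes.
These agree on overlaps of chart domains, so on each chart domain it is the chart volume. -/
def riemannianVolume [RiemannianBundle (fun x : M => TangentSpace I x)] [MeasurableSpace M] :
    Measure M :=
  ⨆ c : M, chartVolume I c

/-- `f` is of class `C^{1+η}` on the open set `U`: it is `C¹` there and, near every point of `U`, its
derivative read in charts is Hölder continuous with exponent `η`. -/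
def IsC1HolderOn (η : ℝ≥0) (f : M → M) (U : Set M) : Prop :=
  ContMDiffOn I I 1 f U ∧
    ∀ x ∈ U, ∃ V ∈ 𝓝[range I] (extChartAt I x x), ∃ C : ℝ≥0,
      HolderOnWith C η (fderivWithin ℝ (writtenInExtChartAt I I x f) (range I)) V

/-- The singular set: the complement of the union of the smoothness regions. -/
def singularSet {M : Type*} (N : ℕ → Set M) : Set M := (⋃ i, N i)ᶜ

/-- `f` is a piecewise `C^{1+η}` map with smoothness regions `N 0, N 1, …` (some of them may be
empty, so that finitely many regions are allowed) and Lebesgue-null singular set. -/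
structure IsPiecewiseC1Holder [RiemannianBundle (fun x : M => TangentSpace I x)]
    [MeasurableSpace M] (η : ℝ≥0) (f : M → M) (N : ℕ → Set M) : Prop where
  isOpen : ∀ i, IsOpen (N i)
  disjoint : Pairwise (fun i j => Disjoint (N i) (N j))
  iUnion_closure : ⋃ i, closure (N i) = univ
  isC1HolderOn : IsC1HolderOn I η f (⋃ i, N i)
  singularSet_null : riemannianVolume I M (singularSet N) = 0

end Riemannian

/-! ### Gibbs–Markov induced maps -/

section Induced

variable {M : Type*}

open Classical in
/-- The induced map `F = f^R`, equal to `f^{R(ω)}` on each `ω ∈ P`. On the negligible set of points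
of the base in no element of `P` (and off the base) it is the identity, so that it is defined
everywhere. -/
def inducedMap (f : M → M) (P : Set (Set M)) (R : M → ℕ) (x : M) : M :=
  if x ∈ ⋃₀ P then f^[R x] x else x

/-- The partition `P_n = ⋁_{i < n} F^{-i} P`. -/
def dynPartition (F : M → M) (P : Set (Set M)) (n : ℕ) : Set (Set M) :=
  {A | ∃ w : ℕ → Set M, (∀ i, w i ∈ P) ∧ A = {x | ∀ i < n, F^[i] x ∈ w i}}

/-- The partition `P_∞ = ⋁_{i ≥ 0} F^{-i} P`. -/
def dynPartitionInfty (F : M → M) (P : Set (Set M)) : Set (Set M) :=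
  {A | ∃ w : ℕ → Set M, (∀ i, w i ∈ P) ∧ A = {x | ∀ i, F^[i] x ∈ w i}}

/-- The separation time: the least `n ≥ 0` such that `F^n x` and `F^n y` lie in distinct elements of
`P`, and zero if there is none. -/
def separationTime (F : M → M) (P : Set (Set M)) (x y : M) : ℕ :=
  sInf {n | ∃ w ∈ P, ∃ w' ∈ P, w ≠ w' ∧ F^[n] x ∈ w ∧ F^[n] y ∈ w'}

/-- The data of an induced map for `f` with base `Δ₀`, countable `m` mod 0 partition `P` of `Δ₀` and
recurrence time `R` (only the values of `R` on `Δ₀` matter); `S` is the singular set of `f`. -/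
structure IsInducingScheme [TopologicalSpace M] [MeasurableSpace M] (m : Measure M) (f : M → M)
    (S Δ₀ : Set M) (P : Set (Set M)) (R : M → ℕ) : Prop where
  measurableSet_base : MeasurableSet Δ₀
  base_subset : Δ₀ ⊆ Sᶜ
  base_pos : 0 < m Δ₀
  countable : P.Countable
  relOpen : ∀ w ∈ P, ∃ U, IsOpen U ∧ w = Δ₀ ∩ U
  disjoint : P.PairwiseDisjoint id
  cover : m (Δ₀ \ ⋃₀ P) = 0
  time_pos : ∀ x ∈ Δ₀, 1 ≤ R x
  time_const : ∀ w ∈ P, ∀ x ∈ w, ∀ y ∈ w, R x = R y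
  avoids : ∀ w ∈ P, ∀ x ∈ w, ∀ j, 1 ≤ j → j ≤ R x → f^[j] x ∉ S
  returns : ∀ w ∈ P, ∀ x ∈ w, f^[R x] x ∈ Δ₀

/-- The map `F : Δ₀ → Δ₀` is Gibbs–Markov with respect to the measure `m` and the partition `P`. -/
structure IsGibbsMarkov [MeasurableSpace M] (m : Measure M) (F : M → M) (Δ₀ : Set M)
    (P : Set (Set M)) : Prop where
  /-- `F` maps each `ω ∈ P` bijectively to `Δ₀`, mod 0. -/
  markov : ∀ w ∈ P, ∃ A ⊆ w, MeasurableSet A ∧ m (w \ A) = 0 ∧ InjOn F A ∧ m (Δ₀ \ F '' A) = 0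
  /-- `P_1, P_2, …` generate the Borel `σ`-algebra of `Δ₀`, mod 0. -/
  generating :
    (∀ B ⊆ Δ₀, MeasurableSet B →
      ∃ B', MeasurableSet[MeasurableSpace.generateFrom (⋃ n ≥ 1, dynPartition F P n)] B' ∧
        B =ᵐ[m.restrict Δ₀] B') ∧
    (∀ B', MeasurableSet[MeasurableSpace.generateFrom (⋃ n ≥ 1, dynPartition F P n)] B' →
      ∃ B ⊆ Δ₀, MeasurableSet B ∧ B =ᵐ[m.restrict Δ₀] B')
  /-- `P_∞` is the partition into single points of `Δ₀`, mod 0. -/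
  separating : ∃ Z, m (Δ₀ \ Z) = 0 ∧ ∀ A ∈ dynPartitionInfty F P, (A ∩ Z).Subsingleton
  /-- `F` has a positive measurable Jacobian `J`, and `J` satisfies the Gibbs property. -/
  exists_jacobian : ∃ J : M → ℝ, Measurable J ∧ (∀ x ∈ Δ₀, 0 < J x) ∧
    (∀ w ∈ P, ∀ A ⊆ w, MeasurableSet A → m (F '' A) = ∫⁻ x in A, ENNReal.ofReal (J x) ∂m) ∧
    ∃ C > 0, ∃ β : ℝ, 0 < β ∧ β < 1 ∧ ∀ w ∈ P, ∀ x ∈ w, ∀ y ∈ w,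
      Real.log (J x / J y) ≤ C * β ^ separationTime F P (F x) (F y)

/-- The measure `(∑_j ν₀{R > j})⁻¹ ∑_j f^j_*(ν₀|{R > j})`. -/
def spreadMeasure [MeasurableSpace M] (f : M → M) (Δ₀ : Set M) (R : M → ℕ) (ν₀ : Measure M) :
    Measure M :=
  (∑' j : ℕ, ν₀ {x ∈ Δ₀ | j < R x})⁻¹ •
    Measure.sum (fun j : ℕ => (ν₀.restrict {x ∈ Δ₀ | j < R x}).map f^[j])

/-- The measure `μ` is an ergodic SRB measure for `f` given by the Gibbs–Markov induced map `f^R`: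
`f^R` is a Gibbs–Markov induced map with integrable recurrence times and `μ` is obtained by
spreading out an ergodic SRB measure `ν₀` of `f^R`. -/
structure IsErgodicSRBGivenBy [TopologicalSpace M] [MeasurableSpace M] (m : Measure M) (f : M → M)
    (S Δ₀ : Set M) (P : Set (Set M)) (R : M → ℕ) (μ : Measure M) : Prop where
  scheme : IsInducingScheme m f S Δ₀ P R
  gibbsMarkov : IsGibbsMarkov m (inducedMap f P R) Δ₀ P
  integrable_time : ∫⁻ x in Δ₀, (R x : ℝ≥0∞) ∂m < ⊤
  isSRB : IsSRBMeasure m f μ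
  ergodic : Ergodic f μ
  exists_base : ∃ ν₀ : Measure M, IsSRBMeasure (m.restrict Δ₀) (inducedMap f P R) ν₀ ∧
    Ergodic (inducedMap f P R) ν₀ ∧ μ = spreadMeasure f Δ₀ R ν₀

end Induced

end

/-! Write `D` for `|det Df|`, `h` for the density of `μ` with respect to the volume `m`, `J` for the
Jacobian of the induced map `F`, and `c` for the normalizing constant in `μ = c ∑ f^l_*(ν₀|{R >
l})`. The entropy is bounded from below by `∫ log D dμ` and from above by `c ∫ log J dν₀`; these
numbers agree.

Agreement and integrability. By change of variables, `J` is almost everywhere the product of `D`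
along the `f`-orbit up to the return (`IsInducingScheme.jacobian_eq_prod`). As `J > 0`, no factor
vanishes, so `D > 0` holds `μ`-almost everywhere. Full branches and bounded distortion give every
cylinder of length `n` around a typical `x` measure at least `m(Δ₀) exp(-K - ∑_{i<n} log J(F^i x))`
(`IsMarkovJacobian.exists_le_measure_cylinder`). For `n = 1` this bounds `log J` from below. Since
`log D` is bounded above and the tower has finite mass, both logarithms are integrable, and summing
up the columns of the tower identifies the integrals (`integral_log_of_tower`).

Lower bound (`integral_log_jacobian_le_measureEntropy`). Cut `{D > 0}` into countably many sets `E
n` on which `f` is injective. The density `g` of `f_*(μ|E n)` with respect to `μ` satisfies `D · (g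
h)∘f = h` on `E n`, so `-log g∘f = log D + log h∘f - log h`. Jensen's inequality shows that each
further step of the dynamics adds at least `∑ ∫ -g log g dμ` to the entropy, the integral of `-log
g∘f` over the atoms. The coboundary `log h∘f - log h` is bounded below by an integrable function,
hence is integrable with integral zero.

Upper bound (`measureEntropy_le_of_tower`). `(f, μ)` is a factor of the tower over `F`. A point of
the tower is labelled by its partition element on the base and by zero above it. The cylinder
estimate yields, for each `N`, a probability measure on label sequences giving almost every realised
word of length `N` weight at least `exp(-log(N+1) - K - S)`, with `S` the sum of `log J` over the
visits to the base. Any finite partition of the tower is approximated, after an iterate, by a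
function of finitely many labels. Gibbs' inequality with this reference measure, blurred by a small
noise to absorb the approximation error, bounds the entropy per step by the mean of `S/N`, which is
`c ∫ log J dν₀`. The argument uses only entropies of finite partitions, although the label alphabet
may be infinite. -/

set_option linter.unusedSectionVars false

/-! ### The Riemannian volume and the change of variables formula -/

section RiemannianVolume

variable {d : ℕ} {H : Type*} [TopologicalSpace H]
  (I : ModelWithCorners ℝ (EuclideanSpace ℝ (Fin d)) H)
  {M : Type*} [TopologicalSpace M] [ChartedSpace H M]
  [RiemannianBundle (fun x : M => TangentSpace I x)]

/-- The volume factor of a linear map from the model space to the tangent space at `y`. -/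
noncomputable def fiberNormDet (y : M)
    (L : EuclideanSpace ℝ (Fin d) →L[ℝ] EuclideanSpace ℝ (Fin d)) : ℝ :=
  LinearMap.normDet (U := EuclideanSpace ℝ (Fin d)) (V := TangentSpace I y) L.toLinearMap

lemma finrank_tangentSpace (y : M) :
    Module.finrank ℝ (TangentSpace I y) = Module.finrank ℝ (EuclideanSpace ℝ (Fin d)) := rfl

lemma absDetDeriv_mul_fiberNormDet (f : M → M) (x : M)
    (L : EuclideanSpace ℝ (Fin d) →L[ℝ] EuclideanSpace ℝ (Fin d)) :
    absDetDeriv I f x * fiberNormDet I x L = fiberNormDet I (f x) ((mfderiv I I f x).comp L) := by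
  have : FiniteDimensional ℝ (TangentSpace I x) :=
    inferInstanceAs (FiniteDimensional ℝ (EuclideanSpace ℝ (Fin d)))
  exact (LinearMap.normDet_comp_of_finrank_eq (U := EuclideanSpace ℝ (Fin d))
    (V := TangentSpace I x) (W := TangentSpace I (f x)) L.toLinearMap
    (mfderiv I I f x).toLinearMap (finrank_tangentSpace I x).symm).symm

lemma fiberNormDet_comp (y : M)
    (L A : EuclideanSpace ℝ (Fin d) →L[ℝ] EuclideanSpace ℝ (Fin d)) :
    fiberNormDet I y (L.comp A) = fiberNormDet I y L * |A.det| := by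
  have := LinearMap.normDet_comp_of_finrank_eq (U := EuclideanSpace ℝ (Fin d))
    (V := EuclideanSpace ℝ (Fin d)) (W := TangentSpace I y) A.toLinearMap
    L.toLinearMap rfl
  rw [LinearMap.normDet_eq_abs_det] at this
  exact this

/-! ### Chart expressions and the volume density. -/

variable [IsManifold I ∞ M]

/-- The chart expression of `f` in the charts at `c` and `c'`. -/
noncomputable def chartRep (f : M → M) (c c' : M) :
    EuclideanSpace ℝ (Fin d) → EuclideanSpace ℝ (Fin d) :=
  fun z => extChartAt I c' (f ((extChartAt I c).symm z))

lemma hasFDerivWithinAt_chartRep {f : M → M} {c c' : M} {z : EuclideanSpace ℝ (Fin d)}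
    (hz : z ∈ (extChartAt I c).target) (hfz : f ((extChartAt I c).symm z) ∈ (extChartAt I c').source)
    (hf : MDifferentiableAt I I f ((extChartAt I c).symm z)) :
    HasFDerivWithinAt (chartRep I f c c') (fderivWithin ℝ (chartRep I f c c') (range I) z)
      (range I) z := by
  have : IsManifold I 1 M := IsManifold.of_le (n := ∞) (by simp)
  have h1 : MDifferentiableWithinAt 𝓘(ℝ, EuclideanSpace ℝ (Fin d)) I (extChartAt I c).symm
    (range I) z := mdifferentiableWithinAt_extChartAt_symm hz
  have h2 : MDifferentiableAt I 𝓘(ℝ, EuclideanSpace ℝ (Fin d)) (extChartAt I c')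
      (f ((extChartAt I c).symm z)) :=
    mdifferentiableAt_extChartAt (by rwa [extChartAt_source] at hfz)
  have h3 := (h2.comp _ hf).comp_mdifferentiableWithinAt z h1
  exact (mdifferentiableWithinAt_iff_differentiableWithinAt.1 h3).hasFDerivWithinAt

/-- Within `range I` near `z`, the maps `f ∘ (extChartAt I c).symm` and `(extChartAt I c').symm ∘
chartRep I f c c'` coincide. The two sides are the volume factor of their common derivative, split
by the chain rule in two ways. -/
lemma chartVolumeDensity_chartRep {f : M → M} {c c' : M} {z : EuclideanSpace ℝ (Fin d)}
    (hz : z ∈ (extChartAt I c).target) (hfz : f ((extChartAt I c).symm z) ∈ (extChartAt I c').source)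
    (hf : MDifferentiableAt I I f ((extChartAt I c).symm z)) :
    chartVolumeDensity I c' (chartRep I f c c' z) *
        |(fderivWithin ℝ (chartRep I f c c') (range I) z).det| =
      absDetDeriv I f ((extChartAt I c).symm z) * chartVolumeDensity I c z := by
  have : IsManifold I 1 M := IsManifold.of_le (n := ∞) (by simp)
  have h1 : MDifferentiableWithinAt 𝓘(ℝ, EuclideanSpace ℝ (Fin d)) I (extChartAt I c).symm
    (range I) z := mdifferentiableWithinAt_extChartAt_symm hz
  have hzr : z ∈ range I := extChartAt_target_subset_range c hz
  have hu : UniqueMDiffWithinAt 𝓘(ℝ, EuclideanSpace ℝ (Fin d)) (range I) z :=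
    (I.uniqueDiffOn z hzr).uniqueMDiffWithinAt
  have hG := hasFDerivWithinAt_chartRep I hz hfz hf
  have hGz : chartRep I f c c' z ∈ (extChartAt I c').target := (extChartAt I c').map_source hfz
  have h4 : MDifferentiableWithinAt 𝓘(ℝ, EuclideanSpace ℝ (Fin d)) I (extChartAt I c').symm
    (range I) (chartRep I f c c' z) := mdifferentiableWithinAt_extChartAt_symm hGz
  have hmaps : MapsTo (chartRep I f c c') ((range I) ∩ univ) (range I) := by
    intro w _
    simp [chartRep, extChartAt]
  have e1 : mfderivWithin 𝓘(ℝ, EuclideanSpace ℝ (Fin d)) I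
      ((extChartAt I c').symm ∘ chartRep I f c c') (range I) z =
      (mfderivWithin 𝓘(ℝ, EuclideanSpace ℝ (Fin d)) I (extChartAt I c').symm (range I)
        (chartRep I f c c' z)).comp
      (mfderivWithin 𝓘(ℝ, EuclideanSpace ℝ (Fin d)) 𝓘(ℝ, EuclideanSpace ℝ (Fin d))
        (chartRep I f c c') (range I) z) :=
    mfderivWithin_comp z h4 hG.differentiableWithinAt.mdifferentiableWithinAt
      (fun w hw => hmaps ⟨hw, trivial⟩) hu
  have e2 : mfderivWithin 𝓘(ℝ, EuclideanSpace ℝ (Fin d)) I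
      (f ∘ (extChartAt I c).symm) (range I) z =
      (mfderiv I I f ((extChartAt I c).symm z)).comp
      (mfderivWithin 𝓘(ℝ, EuclideanSpace ℝ (Fin d)) I (extChartAt I c).symm (range I) z) :=
    mfderiv_comp_mfderivWithin z hf h1 hu
  have hev : ((extChartAt I c').symm ∘ chartRep I f c c') =ᶠ[𝓝[range I] z]
      (f ∘ (extChartAt I c).symm) := by
    have hcont : ContinuousWithinAt (f ∘ (extChartAt I c).symm) (range I) z :=
      hf.continuousAt.comp_continuousWithinAt h1.continuousWithinAt
    have := hcont.preimage_mem_nhdsWithin ((isOpen_extChartAt_source (I := I) c').mem_nhds hfz)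
    filter_upwards [this] with w hw
    exact (extChartAt I c').left_inv hw
  have e3 := hev.mfderivWithin_eq (I := 𝓘(ℝ, EuclideanSpace ℝ (Fin d))) (I' := I)
    (hev.eq_of_nhdsWithin hzr)
  have hpt : (extChartAt I c').symm (chartRep I f c c' z) = f ((extChartAt I c).symm z) :=
    (extChartAt I c').left_inv hfz
  have a1 := absDetDeriv_mul_fiberNormDet I f ((extChartAt I c).symm z)
    (mfderivWithin 𝓘(ℝ, EuclideanSpace ℝ (Fin d)) I (extChartAt I c).symm (range I) z)
  have a2 := fiberNormDet_comp I ((extChartAt I c').symm (chartRep I f c c' z))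
    (mfderivWithin 𝓘(ℝ, EuclideanSpace ℝ (Fin d)) I (extChartAt I c').symm (range I)
        (chartRep I f c c' z)) (fderivWithin ℝ (chartRep I f c c') (range I) z)
  refine a2.symm.trans (Eq.trans ?_ a1.symm)
  rw [hpt]
  congr 1
  rw [← mfderivWithin_eq_fderivWithin]
  exact e1.symm.trans (e3.trans e2)

lemma chartVolumeDensity_pos {c : M} {z : EuclideanSpace ℝ (Fin d)}
    (hz : z ∈ (extChartAt I c).target) : 0 < chartVolumeDensity I c z := by
  have : IsManifold I 1 M := IsManifold.of_le (n := ∞) (by simp)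
  have hinv := isInvertible_mfderivWithin_extChartAt_symm (I := I) hz
  refine lt_of_le_of_ne (LinearMap.normDet_nonneg _) fun h0 => ?_
  refine (LinearMap.normDet_eq_zero_iff_ker_ne_bot (U := EuclideanSpace ℝ (Fin d))
    (V := TangentSpace I ((extChartAt I c).symm z))).1 h0.symm ?_
  obtain ⟨e, he⟩ := hinv
  refine LinearMap.ker_eq_bot.2 fun a b hab => e.injective ?_
  rw [← he] at hab
  exact hab

/-- The square of the density is the Gram determinant of the coordinate frame, which is the frame of
the tangent trivialization at `c`; its entries are continuous because the metric is. -/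
lemma continuousOn_chartVolumeDensity
    [IsContMDiffRiemannianBundle I ∞ (EuclideanSpace ℝ (Fin d)) (fun x : M => TangentSpace I x)]
    (c : M) : ContinuousOn (chartVolumeDensity I c) (extChartAt I c).target := by
  have : IsManifold I 1 M := IsManifold.of_le (n := ∞) (by simp)
  have : IsContinuousRiemannianBundle (EuclideanSpace ℝ (Fin d))
      (fun x : M => TangentSpace I x) := by
    obtain ⟨g, hg, hg'⟩ := IsContMDiffRiemannianBundle.exists_contMDiff (IB := I) (n := ∞)
      (F := EuclideanSpace ℝ (Fin d)) (E := fun x : M => TangentSpace I x)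
    exact ⟨g, hg.continuous, hg'⟩
  let b := EuclideanSpace.basisFun (Fin d) ℝ
  let e := trivializationAt (EuclideanSpace ℝ (Fin d)) (TangentSpace I) c
  let v : Fin d → ∀ z : EuclideanSpace ℝ (Fin d), TangentSpace I ((extChartAt I c).symm z) :=
    fun i z => e.symm ((extChartAt I c).symm z) (b i)
  have hv : ∀ i, ContinuousOn (fun z => (TotalSpace.mk' (EuclideanSpace ℝ (Fin d))
      ((extChartAt I c).symm z) (v i z) : TotalSpace _ (TangentSpace I)))
      (extChartAt I c).target := by
    intro i
    have h1 := e.continuousOn_symm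
    have h2 : ContinuousOn (fun z => ((extChartAt I c).symm z, b i)) (extChartAt I c).target :=
      (continuousOn_extChartAt_symm c).prodMk continuousOn_const
    refine h1.comp h2 ?_
    intro z hz
    refine ⟨?_, trivial⟩
    have := (extChartAt I c).map_target hz
    rw [extChartAt_source] at this
    simpa [e] using this
  have hin : ∀ i j, ContinuousOn (fun z => inner ℝ (v i z) (v j z)) (extChartAt I c).target :=
    fun i j => (hv i).inner_bundle (hv j)
  have hdet : ContinuousOn (fun z => (Matrix.of fun i j => inner ℝ (v i z) (v j z)).det)
      (extChartAt I c).target := by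
    simp only [Matrix.det_apply]
    refine continuousOn_finsetSum _ fun σ _ => ContinuousOn.const_smul ?_ _
    exact continuousOn_finsetProd _ fun i _ => hin _ _
  refine (hdet.sqrt).congr ?_
  intro z hz
  have hsq := LinearMap.normDet_sq_eq_det_gram (U := EuclideanSpace ℝ (Fin d))
    (V := TangentSpace I ((extChartAt I c).symm z))
    (mfderivWithin 𝓘(ℝ, EuclideanSpace ℝ (Fin d)) I (extChartAt I c).symm (range I) z).toLinearMap b
  have hsrc : (extChartAt I c).symm z ∈ (chartAt H c).source := by
    have := (extChartAt I c).map_target hz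
    rwa [extChartAt_source] at this
  have hs := TangentBundle.symmL_trivializationAt (I := I) (𝕜 := ℝ) hsrc
  rw [(extChartAt I c).right_inv hz] at hs
  have hvv : ∀ i, v i z =
      (mfderivWithin 𝓘(ℝ, EuclideanSpace ℝ (Fin d)) I (extChartAt I c).symm (range I) z) (b i) := by
    intro i
    rw [← hs]
    exact (e.symmL_apply (R := ℝ) (by simpa [e] using hsrc) (b i)).symm
  have : chartVolumeDensity I c z ^ 2 = (Matrix.of fun i j => inner ℝ (v i z) (v j z)).det := by
    refine hsq.trans ?_
    congr 1
    ext i j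
    simp only [Matrix.of_apply, hvv]
    rfl
  simp only
  rw [← this, Real.sqrt_sq (chartVolumeDensity_pos I hz).le]

/-! ### The chart volumes as measures. -/

variable
  [IsContMDiffRiemannianBundle I ∞ (EuclideanSpace ℝ (Fin d)) (fun x : M => TangentSpace I x)]
  [MeasurableSpace M] [BorelSpace M]

lemma measurableSet_extChartAt_target (c : M) : MeasurableSet (extChartAt I c).target := by
  rw [extChartAt_target]
  exact (((chartAt H c).open_target.preimage I.continuous_symm).measurableSet).inter
    I.isClosed_range.measurableSet

lemma measurableSet_extChartAt_source (c : M) : MeasurableSet (extChartAt I c).source :=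
  (isOpen_extChartAt_source c).measurableSet

/-- The inverse chart is controlled only on its target. Restricted to that subtype it is a
homeomorphism onto the open chart domain, which permits integration against `chartVolume` of
functions that are not assumed measurable. -/
lemma measurableEmbedding_extChartAt_symm (c : M) :
    MeasurableEmbedding (fun z : (extChartAt I c).target => (extChartAt I c).symm z) := by
  refine Topology.IsEmbedding.measurableEmbedding ?_ ?_
  · have hcont : Continuous (fun z : (extChartAt I c).target => (extChartAt I c).symm z) :=
      (continuousOn_extChartAt_symm c).comp_continuous continuous_subtype_val fun z => z.2
    refine ⟨⟨le_antisymm (continuous_iff_le_induced.1 hcont) ?_⟩, ?_⟩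
    · rintro U hU
      obtain ⟨V, hV, rfl⟩ := isOpen_induced_iff.1 hU
      refine isOpen_induced_iff.2 ⟨(extChartAt I c).source ∩ (extChartAt I c) ⁻¹' V,
        (continuousOn_extChartAt c).isOpen_inter_preimage (isOpen_extChartAt_source c) hV, ?_⟩
      ext z
      have h1 := (extChartAt I c).map_target z.2
      have h2 := (extChartAt I c).right_inv z.2
      simp only [mem_preimage, mem_inter_iff, h1, h2, true_and]
    · intro z w hzw
      exact Subtype.ext ((extChartAt I c).symm.injOn z.2 w.2 hzw)
  · convert measurableSet_extChartAt_source I c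
    rw [← (extChartAt I c).symm_image_target_eq_source]
    ext x
    simp

lemma aemeasurable_chartVolumeDensity (c : M) :
    AEMeasurable (fun z => ENNReal.ofReal (chartVolumeDensity I c z))
      (volume.restrict (extChartAt I c).target) :=
  ((continuousOn_chartVolumeDensity I c).aemeasurable
    (measurableSet_extChartAt_target I c)).ennreal_ofReal

lemma chartVolume_eq_map (c : M) :
    chartVolume I c = (Measure.comap Subtype.val
      (volume.withDensity fun z => ENNReal.ofReal (chartVolumeDensity I c z))).map
        (fun z : (extChartAt I c).target => (extChartAt I c).symm z) := by
  have ht := measurableSet_extChartAt_target I c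
  ext A hA
  have hm : AEMeasurable (extChartAt I c).symm
      ((volume.restrict (extChartAt I c).target).withDensity
        (fun z => ENNReal.ofReal (chartVolumeDensity I c z))) :=
    ((continuousOn_extChartAt_symm c).aemeasurable ht).mono_ac
      (withDensity_absolutelyContinuous _ _)
  rw [chartVolume, ← restrict_withDensity ht, Measure.map_apply_of_aemeasurable _ hA,
    (measurableEmbedding_extChartAt_symm I c).map_apply, ← map_comap_subtype_coe ht,
    (MeasurableEmbedding.subtype_coe ht).map_apply]
  · rfl
  · rwa [restrict_withDensity ht]

lemma measurableSet_chart_preimage {c : M} {A : Set M} (hA : MeasurableSet A) :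
    MeasurableSet ((extChartAt I c).target ∩ (extChartAt I c).symm ⁻¹' A) := by
  have h1 := (measurableEmbedding_extChartAt_symm I c).measurable hA
  convert (MeasurableEmbedding.subtype_coe
    (measurableSet_extChartAt_target I c)).measurableSet_image' h1 using 1
  ext z
  simp [-extChartAt, and_comm]

lemma setLIntegral_chartVolume (c : M) {A : Set M} (hA : MeasurableSet A) (g : M → ℝ≥0∞) :
    ∫⁻ x in A, g x ∂chartVolume I c =
      ∫⁻ z in (extChartAt I c).target ∩ (extChartAt I c).symm ⁻¹' A,
        ENNReal.ofReal (chartVolumeDensity I c z) * g ((extChartAt I c).symm z) := by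
  have ht := measurableSet_extChartAt_target I c
  have hs := measurableSet_chart_preimage I (c := c) hA
  rw [chartVolume_eq_map, ← lintegral_indicator hA,
    (measurableEmbedding_extChartAt_symm I c).lintegral_map,
    lintegral_subtype_comap ht (fun z => A.indicator g ((extChartAt I c).symm z)),
    setLIntegral_withDensity_eq_setLIntegral_mul_non_measurable₀ _
      (aemeasurable_chartVolumeDensity I c) _ ht (by simp), ← lintegral_indicator ht,
    ← lintegral_indicator hs]
  congr 1
  ext z
  by_cases h1 : z ∈ (extChartAt I c).target <;> by_cases h2 : (extChartAt I c).symm z ∈ A <;>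
    simp [-extChartAt, indicator, h1, h2]

lemma chartVolume_apply (c : M) {A : Set M} (hA : MeasurableSet A) :
    chartVolume I c A = ∫⁻ z in (extChartAt I c).target ∩ (extChartAt I c).symm ⁻¹' A,
        ENNReal.ofReal (chartVolumeDensity I c z) := by
  have := setLIntegral_chartVolume I c hA 1
  simpa using this

lemma aemeasurable_chartVolume {β : Type*} [MeasurableSpace β] (c : M) {A : Set M} {g : M → β}
    (hA : MeasurableSet A)
    (hg : AEMeasurable (fun z => g ((extChartAt I c).symm z))
      (volume.restrict ((extChartAt I c).target ∩ (extChartAt I c).symm ⁻¹' A))) :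
    AEMeasurable g ((chartVolume I c).restrict A) := by
  have ht := measurableSet_extChartAt_target I c
  have he := measurableEmbedding_extChartAt_symm I c
  rw [chartVolume_eq_map, he.restrict_map, he.aemeasurable_map_iff]
  have h1 : AEMeasurable (fun z => g ((extChartAt I c).symm z))
      ((volume.withDensity fun z => ENNReal.ofReal (chartVolumeDensity I c z)).restrict
      ((extChartAt I c).target ∩ (extChartAt I c).symm ⁻¹' A)) := by
    rw [restrict_withDensity (measurableSet_chart_preimage I hA)]
    exact hg.mono_ac (withDensity_absolutelyContinuous _ _)
  have hv := MeasurableEmbedding.subtype_coe ht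
  have h2 : (volume.withDensity fun z => ENNReal.ofReal (chartVolumeDensity I c z)).restrict
      ((extChartAt I c).target ∩ (extChartAt I c).symm ⁻¹' A) =
      ((Measure.comap Subtype.val (volume.withDensity fun z => ENNReal.ofReal
        (chartVolumeDensity I c z))).restrict ((fun z : (extChartAt I c).target =>
          (extChartAt I c).symm z) ⁻¹' A)).map Subtype.val := by
    have := hv.restrict_map (Measure.comap Subtype.val (volume.withDensity fun z => ENNReal.ofReal
        (chartVolumeDensity I c z))) ((extChartAt I c).target ∩ (extChartAt I c).symm ⁻¹' A)
    rw [map_comap_subtype_coe ht, Measure.restrict_restrict (measurableSet_chart_preimage I hA),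
      inter_eq_left.2 inter_subset_left] at this
    rw [this]
    congr 2
    ext z
    simp [-extChartAt]
  rw [h2, hv.aemeasurable_map_iff] at h1
  exact h1

lemma chartVolume_compl_source (c : M) : chartVolume I c (extChartAt I c).sourceᶜ = 0 := by
  rw [chartVolume_apply I c (measurableSet_extChartAt_source I c).compl]
  convert setLIntegral_empty _
  ext z
  simp only [mem_inter_iff, mem_preimage, mem_compl_iff, mem_empty_iff_false, iff_false, not_and,
    not_not]
  exact fun hz => (extChartAt I c).map_target hz

/-- The image under a chart expression of the chart domain of `A` is the chart domain of `f '' A`. -/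
lemma chartRep_image {f : M → M} {c c' : M} {A : Set M} (hAc : A ⊆ (extChartAt I c).source)
    (hfA : ∀ x ∈ A, f x ∈ (extChartAt I c').source) :
    chartRep I f c c' '' ((extChartAt I c).target ∩ (extChartAt I c).symm ⁻¹' A) =
      (extChartAt I c').target ∩ (extChartAt I c').symm ⁻¹' (f '' A) := by
  ext w
  constructor
  · rintro ⟨z, ⟨hz, hzA⟩, rfl⟩
    have := hfA _ hzA
    exact ⟨(extChartAt I c').map_source this, ⟨_, hzA, ((extChartAt I c').left_inv this).symm⟩⟩
  · rintro ⟨hw, x, hx, hxw⟩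
    refine ⟨extChartAt I c x, ⟨(extChartAt I c).map_source (hAc hx), ?_⟩, ?_⟩
    · rwa [mem_preimage, (extChartAt I c).left_inv (hAc hx)]
    · rw [chartRep, (extChartAt I c).left_inv (hAc hx), hxw, (extChartAt I c').right_inv hw]

/-! ### Change of variables between two charts. -/

section ChangeOfVariables

variable {f : M → M} {c c' : M} {A : Set M}

lemma hasFDerivWithinAt_chartRep_of_mem
    (hfA : ∀ x ∈ A, f x ∈ (extChartAt I c').source) (hd : ∀ x ∈ A, MDifferentiableAt I I f x) :
    ∀ z ∈ (extChartAt I c).target ∩ (extChartAt I c).symm ⁻¹' A,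
      HasFDerivWithinAt (chartRep I f c c') (fderivWithin ℝ (chartRep I f c c') (range I) z)
        ((extChartAt I c).target ∩ (extChartAt I c).symm ⁻¹' A) z := fun _ hz =>
  (hasFDerivWithinAt_chartRep I hz.1 (hfA _ hz.2) (hd _ hz.2)).mono
    (inter_subset_left.trans (extChartAt_target_subset_range c))

lemma injOn_chartRep
    (hfA : ∀ x ∈ A, f x ∈ (extChartAt I c').source) (hinj : InjOn f A) :
    InjOn (chartRep I f c c') ((extChartAt I c).target ∩ (extChartAt I c).symm ⁻¹' A) := by
  intro z hz w hw hzw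
  have h1 := (extChartAt I c').injOn (hfA _ hz.2) (hfA _ hw.2) hzw
  exact (extChartAt I c).symm.injOn hz.1 hw.1 (hinj hz.2 hw.2 h1)

lemma measurableSet_image_of_chart
    (hA : MeasurableSet A) (hAc : A ⊆ (extChartAt I c).source)
    (hfA : ∀ x ∈ A, f x ∈ (extChartAt I c').source) (hd : ∀ x ∈ A, MDifferentiableAt I I f x) (hinj : InjOn f A) : MeasurableSet (f '' A) := by
  have h := measurable_image_of_fderivWithin (measurableSet_chart_preimage I (c := c) hA)
    (hasFDerivWithinAt_chartRep_of_mem I hfA hd) (injOn_chartRep I hfA hinj)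
  rw [chartRep_image I hAc hfA] at h
  have h2 := (measurableEmbedding_extChartAt_symm I c').measurableSet_image' (measurable_subtype_coe h)
  convert h2 using 1
  ext y
  constructor
  · rintro ⟨x, hx, rfl⟩
    have h3 := hfA x hx
    have h4 := (extChartAt I c').left_inv h3
    exact ⟨⟨_, (extChartAt I c').map_source h3⟩, ⟨(extChartAt I c').map_source h3,
      ⟨x, hx, h4.symm⟩⟩, h4⟩
  · rintro ⟨z, ⟨_, h3⟩, rfl⟩
    exact h3

lemma chartVolume_image
    (hA : MeasurableSet A) (hAc : A ⊆ (extChartAt I c).source)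
    (hfA : ∀ x ∈ A, f x ∈ (extChartAt I c').source) (hd : ∀ x ∈ A, MDifferentiableAt I I f x) (hinj : InjOn f A) :
    chartVolume I c' (f '' A) = ∫⁻ x in A, ENNReal.ofReal (absDetDeriv I f x) ∂chartVolume I c := by
  have hs := measurableSet_chart_preimage I (c := c) hA
  rw [chartVolume_apply I c' (measurableSet_image_of_chart I hA hAc hfA hd hinj),
    ← chartRep_image I hAc hfA, lintegral_image_eq_lintegral_abs_det_fderiv_mul volume hs
      (hasFDerivWithinAt_chartRep_of_mem I hfA hd) (injOn_chartRep I hfA hinj),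
    setLIntegral_chartVolume I c hA]
  refine setLIntegral_congr_fun hs fun z hz => ?_
  have h := chartVolumeDensity_chartRep I hz.1 (hfA _ hz.2) (hd _ hz.2)
  have h1 := (chartVolumeDensity_pos I hz.1).le
  rw [← ENNReal.ofReal_mul (abs_nonneg _), ← ENNReal.ofReal_mul h1, mul_comm, h, mul_comm]

/-- Solving `chartVolumeDensity_chartRep` for `absDetDeriv` expresses it in the chart through
continuous densities, the denominator being positive, and the Euclidean Jacobian determinant, which
is almost everywhere measurable. -/
lemma aemeasurable_absDetDeriv_chartVolume
    (hA : MeasurableSet A) (hfA : ∀ x ∈ A, f x ∈ (extChartAt I c').source)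
    (hd : ∀ x ∈ A, MDifferentiableAt I I f x) :
    AEMeasurable (absDetDeriv I f) ((chartVolume I c).restrict A) := by
  have hs := measurableSet_chart_preimage I (c := c) hA
  refine aemeasurable_chartVolume I c hA ?_
  have hdet : AEMeasurable (fun z => |(fderivWithin ℝ (chartRep I f c c') (range I) z).det|)
      (volume.restrict ((extChartAt I c).target ∩ (extChartAt I c).symm ⁻¹' A)) := by
    have := (aemeasurable_ofReal_abs_det_fderivWithin volume hs
      (hasFDerivWithinAt_chartRep_of_mem I hfA hd)).ennreal_toReal
    simpa [ENNReal.toReal_ofReal, abs_nonneg] using this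
  have hrho : AEMeasurable (chartVolumeDensity I c)
      (volume.restrict ((extChartAt I c).target ∩ (extChartAt I c).symm ⁻¹' A)) :=
    ((continuousOn_chartVolumeDensity I c).mono inter_subset_left).aemeasurable hs
  have hrho' : AEMeasurable (fun z => chartVolumeDensity I c' (chartRep I f c c' z))
      (volume.restrict ((extChartAt I c).target ∩ (extChartAt I c).symm ⁻¹' A)) := by
    refine ContinuousOn.aemeasurable ?_ hs
    refine (continuousOn_chartVolumeDensity I c').comp (fun _ hz =>
      (hasFDerivWithinAt_chartRep_of_mem I hfA hd _ hz).continuousWithinAt) ?_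
    intro z hz
    exact (extChartAt I c').map_source (hfA _ hz.2)
  refine ((hrho'.mul hdet).div hrho).congr ?_
  filter_upwards [ae_restrict_mem hs] with z hz
  have h := chartVolumeDensity_chartRep I hz.1 (hfA _ hz.2) (hd _ hz.2)
  have h1 := (chartVolumeDensity_pos I hz.1).ne'
  simp only [Pi.div_apply, Pi.mul_apply]
  rw [h, mul_div_cancel_right₀ _ h1]

end ChangeOfVariables

lemma absDetDeriv_id (x : M) : absDetDeriv I (id : M → M) x = 1 := by
  have : FiniteDimensional ℝ (TangentSpace I x) :=
    inferInstanceAs (FiniteDimensional ℝ (EuclideanSpace ℝ (Fin d)))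
  have h := LinearMap.normDet_id (𝕜 := ℝ) (U := TangentSpace I x)
  unfold absDetDeriv
  rw [mfderiv_id]
  exact h

lemma absDetDeriv_nonneg (f : M → M) (x : M) : 0 ≤ absDetDeriv I f x :=
  have : FiniteDimensional ℝ (TangentSpace I x) :=
    inferInstanceAs (FiniteDimensional ℝ (EuclideanSpace ℝ (Fin d)))
  LinearMap.normDet_nonneg _

/-- This is the change of variables formula for the identity, whose Jacobian is one. -/
lemma chartVolume_eq_of_subset {c c' : M} {A : Set M} (hA : MeasurableSet A)
    (hAc : A ⊆ (extChartAt I c).source) (hAc' : A ⊆ (extChartAt I c').source) :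
    chartVolume I c' A = chartVolume I c A := by
  have := chartVolume_image I (f := id) hA hAc (fun x hx => hAc' hx)
    (fun x _ => mdifferentiableAt_id) (injOn_id _)
  simpa [absDetDeriv_id] using this

/-! ### Gluing the chart volumes. -/

variable [SecondCountableTopology M]

lemma exists_chart_sequence [Nonempty M] :
    ∃ s : ℕ → M, ⋃ i, (extChartAt I (s i)).source = univ := by
  obtain ⟨t, htc, ht⟩ := TopologicalSpace.countable_cover_nhds
    (fun x : M => extChartAt_source_mem_nhds (I := I) x)
  have hne : t.Nonempty := by
    by_contra h
    rw [not_nonempty_iff_eq_empty] at h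
    subst h
    obtain ⟨x⟩ := ‹Nonempty M›
    have := mem_univ x
    rw [← ht] at this
    simp at this
  obtain ⟨s, rfl⟩ := htc.exists_eq_range hne
  exact ⟨s, by simpa [-extChartAt] using ht⟩

/-- A countable measurable partition of the manifold into subsets of chart domains. -/
lemma exists_chart_partition [Nonempty M] :
    ∃ (s : ℕ → M) (D : ℕ → Set M), (∀ i, MeasurableSet (D i)) ∧ Pairwise (Function.onFun Disjoint D) ∧
      ⋃ i, D i = univ ∧ ∀ i, D i ⊆ (extChartAt I (s i)).source := by
  obtain ⟨s, hs⟩ := exists_chart_sequence (I := I) (M := M)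
  refine ⟨s, disjointed fun i => (extChartAt I (s i)).source,
    MeasurableSet.disjointed fun i => measurableSet_extChartAt_source I (s i),
    disjoint_disjointed _, ?_, fun i => disjointed_subset _ _⟩
  rw [iUnion_disjointed, hs]

/-- A supremum of measures is hard to evaluate directly. Here it is dominated by the sum of the
chart volumes cut down to a disjoint cover, because chart volumes agree on overlaps; for the same
reason that sum gives `A` its volume in the chart at `c`. -/
lemma riemannianVolume_apply_of_subset [Nonempty M] {c : M} {A : Set M} (hA : MeasurableSet A)
    (hAc : A ⊆ (extChartAt I c).source) : riemannianVolume I M A = chartVolume I c A := by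
  refine le_antisymm ?_ (Measure.le_iff'.1 (le_iSup (fun c => chartVolume I c) c) A)
  obtain ⟨s, D, hD, hdisj, hU, hsub⟩ := exists_chart_partition I (M := M)
  have hle : riemannianVolume I M ≤
      Measure.sum fun i => (chartVolume I (s i)).restrict (D i) := by
    refine iSup_le fun c' => Measure.le_iff.2 fun B hB => ?_
    rw [Measure.sum_apply _ hB]
    have hS := measurableSet_extChartAt_source I c'
    calc chartVolume I c' B = chartVolume I c' (B ∩ (extChartAt I c').source) := by
          rw [measure_inter_conull (chartVolume_compl_source I c')]
      _ = chartVolume I c' (⋃ i, B ∩ (extChartAt I c').source ∩ D i) := by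
          rw [← inter_iUnion, hU, inter_univ]
      _ ≤ ∑' i, chartVolume I c' (B ∩ (extChartAt I c').source ∩ D i) := measure_iUnion_le _
      _ ≤ ∑' i, ((chartVolume I (s i)).restrict (D i)) B := by
          refine ENNReal.tsum_le_tsum fun i => ?_
          rw [Measure.restrict_apply hB, chartVolume_eq_of_subset I ((hB.inter hS).inter (hD i))
            (inter_subset_right.trans (hsub i)) (fun x hx => hx.1.2)]
          exact measure_mono fun x hx => ⟨hx.1.1, hx.2⟩
  refine (Measure.le_iff'.1 hle A).trans (le_of_eq ?_)
  rw [Measure.sum_apply _ hA]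
  calc ∑' i, ((chartVolume I (s i)).restrict (D i)) A = ∑' i, chartVolume I c (A ∩ D i) := by
        refine tsum_congr fun i => ?_
        rw [Measure.restrict_apply hA]
        exact (chartVolume_eq_of_subset I (hA.inter (hD i)) (inter_subset_right.trans (hsub i))
          (inter_subset_left.trans hAc)).symm
    _ = chartVolume I c (⋃ i, A ∩ D i) := (measure_iUnion (fun i j hij =>
        (hdisj hij).mono inter_subset_right inter_subset_right) fun i => hA.inter (hD i)).symm
    _ = chartVolume I c A := by rw [← inter_iUnion, hU, inter_univ]

lemma riemannianVolume_restrict_of_subset [Nonempty M] {c : M} {A : Set M} (hA : MeasurableSet A)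
    (hAc : A ⊆ (extChartAt I c).source) :
    (riemannianVolume I M).restrict A = (chartVolume I c).restrict A := by
  ext B hB
  rw [Measure.restrict_apply hB, Measure.restrict_apply hB]
  exact riemannianVolume_apply_of_subset I (hB.inter hA) (inter_subset_right.trans hAc)

/-- Near a point the chart density is bounded by continuity and the chart image lies in a ball, so
the measure is locally finite; second countability does the rest. -/
lemma sigmaFinite_riemannianVolume : SigmaFinite (riemannianVolume I M) := by
  have : IsLocallyFiniteMeasure (riemannianVolume I M) := by
    refine ⟨fun x => ?_⟩
    have : Nonempty M := ⟨x⟩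
    let r := chartVolumeDensity I x (extChartAt I x x)
    have hcont : ContinuousOn (fun y => chartVolumeDensity I x (extChartAt I x y))
        (extChartAt I x).source :=
      (continuousOn_chartVolumeDensity I x).comp (continuousOn_extChartAt x)
        fun y hy => (extChartAt I x).map_source hy
    have ho := isOpen_extChartAt_source (I := I) x
    let U := ((extChartAt I x).source ∩ (fun y => chartVolumeDensity I x (extChartAt I x y)) ⁻¹'
      Iio (r + 1)) ∩ ((extChartAt I x).source ∩ (extChartAt I x) ⁻¹'
        Metric.ball (extChartAt I x x) 1)
    have hU : IsOpen U := (hcont.isOpen_inter_preimage ho isOpen_Iio).inter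
      ((continuousOn_extChartAt x).isOpen_inter_preimage ho Metric.isOpen_ball)
    have hxs := mem_extChartAt_source (I := I) x
    refine ⟨U, hU.mem_nhds ⟨⟨hxs, by simp [r]⟩, hxs, by simp⟩, ?_⟩
    rw [riemannianVolume_apply_of_subset I hU.measurableSet (fun y hy => hy.1.1),
      chartVolume_apply I x hU.measurableSet]
    have hsub : (extChartAt I x).target ∩ (extChartAt I x).symm ⁻¹' U ⊆
        Metric.ball (extChartAt I x x) 1 := by
      rintro z ⟨hz, hzU⟩
      have := hzU.2.2
      rwa [mem_preimage, (extChartAt I x).right_inv hz] at this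
    calc ∫⁻ z in (extChartAt I x).target ∩ (extChartAt I x).symm ⁻¹' U,
          ENNReal.ofReal (chartVolumeDensity I x z)
        ≤ ∫⁻ z in (extChartAt I x).target ∩ (extChartAt I x).symm ⁻¹' U,
          ENNReal.ofReal (r + 1) := by
          refine setLIntegral_mono' (measurableSet_chart_preimage I hU.measurableSet) ?_
          rintro z ⟨hz, hzU⟩
          have := hzU.1.2
          rw [mem_preimage, mem_Iio, (extChartAt I x).right_inv hz] at this
          exact ENNReal.ofReal_le_ofReal this.le
      _ ≤ ENNReal.ofReal (r + 1) * volume (Metric.ball (extChartAt I x x) 1) := by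
          rw [setLIntegral_const]
          gcongr
      _ < ⊤ := ENNReal.mul_lt_top ENNReal.ofReal_lt_top measure_ball_lt_top
  infer_instance

/-! ### Change of variables on the manifold. -/

section ChangeOfVariables

variable [Nonempty M] {f : M → M} {A : Set M}

lemma aemeasurable_absDetDeriv (hf : Measurable f) (hA : MeasurableSet A)
    (hd : ∀ x ∈ A, MDifferentiableAt I I f x) :
    AEMeasurable (absDetDeriv I f) ((riemannianVolume I M).restrict A) := by
  obtain ⟨s, D, hD, hdisj, hU, hsub⟩ := exists_chart_partition I (M := M)
  have hcover : A = ⋃ p : ℕ × ℕ, A ∩ D p.1 ∩ f ⁻¹' D p.2 := by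
    ext x
    simp only [mem_iUnion, mem_inter_iff, mem_preimage, Prod.exists]
    have h1 := mem_univ x
    have h2 := mem_univ (f x)
    rw [← hU, mem_iUnion] at h1 h2
    tauto
  rw [hcover, aemeasurable_iUnion_iff]
  rintro ⟨i, j⟩
  have hm : MeasurableSet (A ∩ D i ∩ f ⁻¹' D j) := (hA.inter (hD i)).inter (hf (hD j))
  rw [riemannianVolume_restrict_of_subset I (c := s i) hm fun x hx => hsub i hx.1.2]
  exact aemeasurable_absDetDeriv_chartVolume I (c' := s j) hm
    (fun x hx => hsub j hx.2) fun x hx => hd x hx.1.1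

lemma measurableSet_image_and_riemannianVolume_image (hf : Measurable f) (hA : MeasurableSet A)
    (hd : ∀ x ∈ A, MDifferentiableAt I I f x) (hinj : InjOn f A) :
    MeasurableSet (f '' A) ∧ riemannianVolume I M (f '' A) =
      ∫⁻ x in A, ENNReal.ofReal (absDetDeriv I f x) ∂riemannianVolume I M := by
  obtain ⟨s, D, hD, hdisj, hU, hsub⟩ := exists_chart_partition I (M := M)
  have hcover : A = ⋃ p : ℕ × ℕ, A ∩ D p.1 ∩ f ⁻¹' D p.2 := by
    ext x
    simp only [mem_iUnion, mem_inter_iff, mem_preimage, Prod.exists]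
    have h1 := mem_univ x
    have h2 := mem_univ (f x)
    rw [← hU, mem_iUnion] at h1 h2
    tauto
  have hm : ∀ p : ℕ × ℕ, MeasurableSet (A ∩ D p.1 ∩ f ⁻¹' D p.2) := fun p =>
    (hA.inter (hD p.1)).inter (hf (hD p.2))
  have hpd : Pairwise (Function.onFun Disjoint fun p : ℕ × ℕ => A ∩ D p.1 ∩ f ⁻¹' D p.2) := by
    rintro ⟨i, j⟩ ⟨i', j'⟩ hne
    refine disjoint_left.2 fun x hx hx' => hne ?_
    have h1 : i = i' := by_contra fun h => disjoint_left.1 (hdisj h) hx.1.2 hx'.1.2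
    have h2 : j = j' := by_contra fun h => disjoint_left.1 (hdisj h) hx.2 hx'.2
    rw [h1, h2]
  have him : ∀ p : ℕ × ℕ, MeasurableSet (f '' (A ∩ D p.1 ∩ f ⁻¹' D p.2)) := fun p =>
    measurableSet_image_of_chart I (c := s p.1) (c' := s p.2) (hm p) (fun x hx => hsub _ hx.1.2)
      (fun x hx => hsub _ hx.2) (fun x hx => hd x hx.1.1) (hinj.mono fun x hx => hx.1.1)
  have hval : ∀ p : ℕ × ℕ, riemannianVolume I M (f '' (A ∩ D p.1 ∩ f ⁻¹' D p.2)) =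
      ∫⁻ x in A ∩ D p.1 ∩ f ⁻¹' D p.2, ENNReal.ofReal (absDetDeriv I f x)
        ∂riemannianVolume I M := fun p => by
    rw [riemannianVolume_apply_of_subset I (c := s p.2) (him p),
      riemannianVolume_restrict_of_subset I (c := s p.1) (hm p) fun x hx => hsub _ hx.1.2]
    · exact chartVolume_image I (hm p) (fun x hx => hsub _ hx.1.2)
        (fun x hx => hsub _ hx.2) (fun x hx => hd x hx.1.1) (hinj.mono fun x hx => hx.1.1)
    · rintro _ ⟨x, hx, rfl⟩
      exact hsub _ hx.2
  have hmeas : MeasurableSet (f '' A) := by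
    rw [hcover, image_iUnion]
    exact MeasurableSet.iUnion him
  refine ⟨hmeas, ?_⟩
  conv_lhs => rw [hcover, image_iUnion]
  conv_rhs => rw [hcover]
  rw [measure_iUnion _ him, lintegral_iUnion hm hpd]
  · exact tsum_congr hval
  · intro p q hpq
    refine disjoint_left.2 ?_
    rintro _ ⟨x, hx, rfl⟩ ⟨y, hy, hxy⟩
    have : y = x := hinj hy.1.1 hx.1.1 hxy
    subst this
    exact disjoint_left.1 (hpd hpq) hx hy

/-- Where the derivative is invertible, the chart expressions are, on countably many pieces, so
close to invertible linear maps that they are injective there. -/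
lemma exists_cover_injOn_of_absDetDeriv_pos (hf : Measurable f) (hA : MeasurableSet A)
    (hd : ∀ x ∈ A, MDifferentiableAt I I f x) (hpos : ∀ x ∈ A, 0 < absDetDeriv I f x) :
    ∃ t : ℕ → Set M, (∀ n, MeasurableSet (t n)) ∧ A = ⋃ n, t n ∧ ∀ n, InjOn f (t n) := by
  obtain ⟨s, D, hD, hdisj, hU, hsub⟩ := exists_chart_partition I (M := M)
  have hloc : ∀ p : ℕ × ℕ, ∃ t : ℕ → Set M, (∀ n, MeasurableSet (t n)) ∧
      A ∩ D p.1 ∩ f ⁻¹' D p.2 = ⋃ n, t n ∧ ∀ n, InjOn f (t n) := by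
    rintro ⟨i, j⟩
    have hm : MeasurableSet (A ∩ D i ∩ f ⁻¹' D j) := (hA.inter (hD i)).inter (hf (hD j))
    have hder := hasFDerivWithinAt_chartRep_of_mem I (f := f) (c := s i) (c' := s j)
      (A := A ∩ D i ∩ f ⁻¹' D j) (fun x hx => hsub j hx.2) fun x hx => hd x hx.1.1
    classical
    let r : (EuclideanSpace ℝ (Fin d) →L[ℝ] EuclideanSpace ℝ (Fin d)) → ℝ≥0 := fun L =>
      if h : L.det ≠ 0 then
        if Subsingleton (EuclideanSpace ℝ (Fin d)) then 1 else
        ‖((L.toContinuousLinearEquivOfDetNeZero h).symm :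
          EuclideanSpace ℝ (Fin d) →L[ℝ] EuclideanSpace ℝ (Fin d))‖₊⁻¹ / 2
      else 1
    have hr : ∀ L, r L ≠ 0 := by
      intro L
      by_cases h : L.det ≠ 0
      · by_cases hs : Subsingleton (EuclideanSpace ℝ (Fin d))
        · simp [r, hs]
        · rw [not_subsingleton_iff_nontrivial] at hs
          have := (L.toContinuousLinearEquivOfDetNeZero h).symm.nnnorm_symm_pos
          have h2 := (L.toContinuousLinearEquivOfDetNeZero h).nnnorm_symm_pos
          simp only [r, h, ne_eq, not_false_eq_true, dite_true,
            not_subsingleton_iff_nontrivial.2 hs, if_false]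
          positivity
      · simp only [r, h, dite_false]
        exact one_ne_zero
    obtain ⟨t, L, -, htm, hcov, happ, hL⟩ :=
      exists_partition_approximatesLinearOn_of_hasFDerivWithinAt _ _ _ hder r hr
    refine ⟨fun n => (A ∩ D i ∩ f ⁻¹' D j) ∩ ((extChartAt I (s i)).source ∩
      (extChartAt I (s i)) ⁻¹' t n), fun n => hm.inter ?_, ?_, fun n => ?_⟩
    · have h2 := (measurableEmbedding_extChartAt_symm I (s i)).measurableSet_image'
        (measurable_subtype_coe (htm n))
      convert h2 using 1
      ext y
      constructor
      · rintro ⟨h3, h4⟩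
        exact ⟨⟨_, (extChartAt I (s i)).map_source h3⟩, h4, (extChartAt I (s i)).left_inv h3⟩
      · rintro ⟨z, hz, rfl⟩
        refine ⟨(extChartAt I (s i)).map_target z.2, ?_⟩
        rw [mem_preimage, (extChartAt I (s i)).right_inv z.2]
        exact hz
    · rw [← inter_iUnion, ← inter_iUnion, ← preimage_iUnion]
      refine (inter_eq_left.2 fun x hx => ?_).symm
      have h3 := hsub i hx.1.2
      refine ⟨h3, hcov ⟨(extChartAt I (s i)).map_source h3, ?_⟩⟩
      rwa [mem_preimage, (extChartAt I (s i)).left_inv h3]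
    · have hinj : InjOn (chartRep I f (s i) (s j)) (((extChartAt I (s i)).target ∩
          (extChartAt I (s i)).symm ⁻¹' (A ∩ D i ∩ f ⁻¹' D j)) ∩ t n) := by
        by_cases hne : ((extChartAt I (s i)).target ∩
          (extChartAt I (s i)).symm ⁻¹' (A ∩ D i ∩ f ⁻¹' D j)).Nonempty
        swap
        · rw [not_nonempty_iff_eq_empty.1 hne]
          simp
        obtain ⟨z, hz, hLz⟩ := hL hne n
        have hdet : (L n).det ≠ 0 := by
          intro h0
          have := chartVolumeDensity_chartRep I hz.1 (hsub j hz.2.2) (hd _ hz.2.1.1)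
          rw [← hLz, h0, abs_zero, mul_zero] at this
          exact (mul_pos (hpos _ hz.2.1.1) (chartVolumeDensity_pos I hz.1)).ne this
        have ha := happ n
        rw [← L n |>.coe_toContinuousLinearEquivOfDetNeZero hdet] at ha
        refine ha.injOn ?_
        by_cases hs : Subsingleton (EuclideanSpace ℝ (Fin d))
        · exact Or.inl hs
        · right
          rw [not_subsingleton_iff_nontrivial] at hs
          have h2 := ((L n).toContinuousLinearEquivOfDetNeZero hdet).nnnorm_symm_pos
          rw [(L n).coe_toContinuousLinearEquivOfDetNeZero hdet]
          simp only [r, hdet, ne_eq, not_false_eq_true, dite_true,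
            not_subsingleton_iff_nontrivial.2 hs, if_false]
          exact NNReal.half_lt_self (by positivity)
      rintro x ⟨hx, hxs, hxt⟩ y ⟨hy, hys, hyt⟩ hxy
      refine (extChartAt I (s i)).injOn hxs hys (hinj ⟨⟨(extChartAt I (s i)).map_source hxs, ?_⟩,
        hxt⟩ ⟨⟨(extChartAt I (s i)).map_source hys, ?_⟩, hyt⟩ ?_)
      · rwa [mem_preimage, (extChartAt I (s i)).left_inv hxs]
      · rwa [mem_preimage, (extChartAt I (s i)).left_inv hys]
      · simp only [chartRep]
        rw [(extChartAt I (s i)).left_inv hxs, (extChartAt I (s i)).left_inv hys, hxy]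
  choose t ht hcov hinj using hloc
  let e := Denumerable.eqv ((ℕ × ℕ) × ℕ)
  refine ⟨fun n => t (e.symm n).1 (e.symm n).2, fun n => ht _ _, ?_, fun n => hinj _ _⟩
  have h1 : ⋃ n, t (e.symm n).1 (e.symm n).2 = ⋃ q : (ℕ × ℕ) × ℕ, t q.1 q.2 :=
    e.symm.surjective.iUnion_comp fun q : (ℕ × ℕ) × ℕ => t q.1 q.2
  rw [h1, iUnion_prod']
  simp only [← hcov]
  ext x
  simp only [mem_iUnion, mem_inter_iff, mem_preimage, Prod.exists]
  have h1 := mem_univ x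
  have h2 := mem_univ (f x)
  rw [← hU, mem_iUnion] at h1 h2
  tauto

end ChangeOfVariables

end RiemannianVolume

/-! ### Jacobians of measurable maps -/

section Jacobian

variable {X : Type*} [MeasurableSpace X]

/-- `D` is a Jacobian of `f` with respect to `m` on the set `U`. -/
structure IsJacobianOn (m : Measure X) (f : X → X) (D : X → ℝ≥0∞) (U : Set X) : Prop where
  measurableSet_image : ∀ A ⊆ U, MeasurableSet A → InjOn f A → MeasurableSet (f '' A)
  measure_image : ∀ A ⊆ U, MeasurableSet A → InjOn f A → m (f '' A) = ∫⁻ x in A, D x ∂m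
  aemeasurable : AEMeasurable D (m.restrict U)
  ne_top : ∀ x, D x ≠ ⊤

/-- On a set of injectivity `f` is a measurable embedding carrying `D m` to `m` on the image, so `G`
need not be measurable. -/
lemma IsJacobianOn.setLIntegral_image {m : Measure X} {f : X → X} {D : X → ℝ≥0∞} {U A : Set X}
    (hJ : IsJacobianOn m f D U) (hf : Measurable f) (hAU : A ⊆ U) (hA : MeasurableSet A)
    (hinj : InjOn f A) (G : X → ℝ≥0∞) :
    ∫⁻ y in f '' A, G y ∂m = ∫⁻ x in A, D x * G (f x) ∂m := by
  have hemb : MeasurableEmbedding (fun x : A => f x) := by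
    refine ⟨fun x y hxy => Subtype.ext (hinj x.2 y.2 hxy), hf.comp measurable_subtype_coe, ?_⟩
    intro B hB
    have h1 := (MeasurableEmbedding.subtype_coe hA).measurableSet_image' hB
    have h2 : Subtype.val '' B ⊆ A := by rintro _ ⟨x, _, rfl⟩; exact x.2
    have := hJ.measurableSet_image _ (h2.trans hAU) h1 (hinj.mono h2)
    rwa [← image_comp] at this
  have hmap : Measure.map (fun x : A => f x) (Measure.comap Subtype.val (m.withDensity D)) =
      m.restrict (f '' A) := by
    ext B hB
    have hAB : MeasurableSet (A ∩ f ⁻¹' B) := hA.inter (hf hB)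
    have h3 : (f '' A) ∩ B = f '' (A ∩ f ⁻¹' B) := by rw [image_inter_preimage]
    rw [hemb.map_apply, Measure.restrict_apply hB, inter_comm, h3,
      hJ.measure_image _ (inter_subset_left.trans hAU) hAB (hinj.mono inter_subset_left),
      (MeasurableEmbedding.subtype_coe hA).comap_apply, ← withDensity_apply _ hAB]
    congr 1
    ext x
    simp [and_comm]
  rw [← hmap, hemb.lintegral_map, lintegral_subtype_comap hA (fun x => G (f x)),
    setLIntegral_withDensity_eq_setLIntegral_mul_non_measurable₀ _
      (hJ.aemeasurable.mono_measure (Measure.restrict_mono hAU le_rfl)) _ hA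
      (ae_of_all _ fun x => (hJ.ne_top x).lt_top)]
  rfl

/-- The chain rule for Jacobians of iterates. -/
lemma IsJacobianOn.measure_image_iterate {m : Measure X} {f : X → X} {D : X → ℝ≥0∞} {U : Set X}
    (hJ : IsJacobianOn m f D U) (hf : Measurable f) (r : ℕ) {A : Set X} (hA : MeasurableSet A)
    (hAU : ∀ x ∈ A, ∀ j < r, f^[j] x ∈ U) (hinj : InjOn f^[r] A) :
    m (f^[r] '' A) = ∫⁻ x in A, ∏ j ∈ Finset.range r, D (f^[j] x) ∂m := by
  induction r generalizing A with
  | zero => simp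
  | succ r ih =>
    have hinj1 : InjOn f A := fun x hx y hy hxy => hinj hx hy (by
      rw [Function.iterate_succ_apply, Function.iterate_succ_apply, hxy])
    have hAU1 : A ⊆ U := fun x hx => hAU x hx 0 (Nat.succ_pos r)
    have hinj2 : InjOn f^[r] (f '' A) := by
      rintro _ ⟨x, hx, rfl⟩ _ ⟨y, hy, rfl⟩ hxy
      rw [hinj hx hy hxy]
    rw [Function.iterate_succ, image_comp, ih (hJ.measurableSet_image A hAU1 hA hinj1) _ hinj2,
      hJ.setLIntegral_image hf hAU1 hA hinj1]
    · refine lintegral_congr fun x => ?_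
      rw [Finset.prod_range_succ']
      simp [mul_comm]
    · rintro _ ⟨x, hx, rfl⟩ j hj
      exact hAU x hx (j + 1) (by omega)

end Jacobian

/-! ### Entropy of finite partitions -/

section PartitionEntropy

variable {X : Type*} [MeasurableSpace X]

lemma partitionEntropy_equiv_comp {ι κ : Type*} [Fintype ι] [Fintype κ] (μ : Measure X)
    (ξ : X → ι) (e : ι ≃ κ) : partitionEntropy μ (fun x => e (ξ x)) = partitionEntropy μ ξ := by
  unfold partitionEntropy
  rw [← e.sum_comp]
  refine Finset.sum_congr rfl fun a _ => ?_
  congr 3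
  ext x
  simp

lemma partitionEntropy_nonneg {ι : Type*} [Fintype ι] (μ : Measure X) [IsProbabilityMeasure μ]
    (ξ : X → ι) : 0 ≤ partitionEntropy μ ξ :=
  Finset.sum_nonneg fun _ _ => Real.negMulLog_nonneg measureReal_nonneg measureReal_le_one

/-- The concave function `-t log t` lies below its tangent line at `s`. Both the Jensen and the
Gibbs inequality below are sums or integrals of this bound. -/
lemma negMulLog_le_tangent {t s : ℝ} (ht : 0 ≤ t) (hs : 0 < s) :
    Real.negMulLog t ≤ -t * Real.log s + (s - t) := by
  rcases ht.eq_or_lt with rfl | ht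
  · simpa using hs.le
  have h := Real.log_le_sub_one_of_pos (div_pos hs ht)
  rw [Real.log_div hs.ne' ht.ne'] at h
  have h2 := mul_le_mul_of_nonneg_left h ht.le
  have h3 : t * (s / t - 1) = s - t := by field_simp
  rw [h3] at h2
  unfold Real.negMulLog
  linarith

/-- The densities `g a` of the images of the atoms give a lower bound for the entropy added by
one more step of the dynamics. -/
lemma partitionEntropy_prod_ge {ι κ : Type*} [Fintype ι] [Fintype κ]
    [MeasurableSpace ι] [MeasurableSingletonClass ι] [MeasurableSpace κ]
    [MeasurableSingletonClass κ] {μ : Measure X} [IsProbabilityMeasure μ] {f : X → X}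
    (hf : MeasurePreserving f μ μ) {ξ : X → ι} (hξ : Measurable ξ) {Y : X → κ} (hY : Measurable Y)
    {g : ι → X → ℝ} (hgm : ∀ a, Measurable (g a)) (hg0 : ∀ a x, 0 ≤ g a x)
    (hg1 : ∀ a x, g a x ≤ 1)
    (hg : ∀ a, (μ.restrict (ξ ⁻¹' {a})).map f = μ.withDensity fun x => ENNReal.ofReal (g a x)) :
    partitionEntropy μ Y + ∑ a, ∫ x, Real.negMulLog (g a x) ∂μ ≤
      partitionEntropy μ (fun x => (ξ x, Y (f x))) := by
  have hInt : ∀ a, Integrable (g a) μ := fun a =>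
    Integrable.of_bound (hgm a).aestronglyMeasurable 1 (ae_of_all _ fun x => by
      rw [Real.norm_of_nonneg (hg0 a x)]; exact hg1 a x)
  have hint2 : ∀ a, Integrable (fun x => Real.negMulLog (g a x)) μ := fun a =>
    Integrable.of_bound (Real.continuous_negMulLog.measurable.comp (hgm a)).aestronglyMeasurable 1
      (ae_of_all _ fun x => by
        rw [Real.norm_of_nonneg (Real.negMulLog_nonneg (hg0 a x) (hg1 a x))]
        have := negMulLog_le_tangent (hg0 a x) one_pos
        simp only [Real.log_one, mul_zero, zero_add] at this
        linarith [hg0 a x])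
  have hYm : ∀ b, MeasurableSet (Y ⁻¹' {b}) := fun b => hY (measurableSet_singleton b)
  have hξm : ∀ a, MeasurableSet (ξ ⁻¹' {a}) := fun a => hξ (measurableSet_singleton a)
  -- the joint probabilities
  have hp : ∀ a b, μ.real ((fun x => (ξ x, Y (f x))) ⁻¹' {(a, b)}) =
      ∫ x in Y ⁻¹' {b}, g a x ∂μ := by
    intro a b
    have h1 : (fun x => (ξ x, Y (f x))) ⁻¹' {(a, b)} = f ⁻¹' (Y ⁻¹' {b}) ∩ ξ ⁻¹' {a} := by
      ext x; simp [and_comm]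
    have h2 : μ (f ⁻¹' (Y ⁻¹' {b}) ∩ ξ ⁻¹' {a}) = ∫⁻ x in Y ⁻¹' {b}, ENNReal.ofReal (g a x) ∂μ := by
      rw [← withDensity_apply _ (hYm b), ← hg a, Measure.map_apply hf.measurable (hYm b),
        Measure.restrict_apply (hf.measurable (hYm b))]
    rw [h1, Measure.real, h2, ← ofReal_integral_eq_lintegral_ofReal (hInt a).integrableOn
      (ae_of_all _ (hg0 a)), ENNReal.toReal_ofReal (integral_nonneg (hg0 a))]
  have hpb : ∀ b, ∑ a, ∫ x in Y ⁻¹' {b}, g a x ∂μ = μ.real (Y ⁻¹' {b}) := by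
    intro b
    have h1 : ∀ a, ∫ x in Y ⁻¹' {b}, g a x ∂μ = μ.real (f ⁻¹' (Y ⁻¹' {b}) ∩ ξ ⁻¹' {a}) := by
      intro a
      rw [← hp]
      congr 1
      ext x; simp [and_comm]
    simp only [h1]
    have h2 : μ.real (f ⁻¹' (Y ⁻¹' {b})) = μ.real (Y ⁻¹' {b}) := by
      rw [Measure.real, Measure.real, hf.measure_preimage (hYm b).nullMeasurableSet]
    rw [← h2, ← measureReal_biUnion_finset]
    · congr 1
      ext x; simp
    · intro a _ a' _ haa'
      refine disjoint_left.2 fun x hx hx' => haa' ?_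
      exact hx.2.symm.trans hx'.2
    · intro a _
      exact (hf.measurable (hYm b)).inter (hξm a)
  -- Jensen's inequality on the atom `Y = b`: with `p` the integral of `g a` over it and `q` its
  -- measure, integrate the tangent bound at the mean value `p / q`.
  have key : ∀ a b, (∫ x in Y ⁻¹' {b}, g a x ∂μ) * (-Real.log (μ.real (Y ⁻¹' {b}))) +
      ∫ x in Y ⁻¹' {b}, Real.negMulLog (g a x) ∂μ ≤
      Real.negMulLog (∫ x in Y ⁻¹' {b}, g a x ∂μ) := by
    intro a b
    set p := ∫ x in Y ⁻¹' {b}, g a x ∂μ with hpdef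
    set q := μ.real (Y ⁻¹' {b}) with hqdef
    have hp0 : 0 ≤ p := integral_nonneg (hg0 a)
    have hpq : p ≤ q := by
      rw [hqdef, ← hpb b]
      exact Finset.single_le_sum (f := fun a => ∫ x in Y ⁻¹' {b}, g a x ∂μ)
        (fun a _ => integral_nonneg (hg0 a)) (Finset.mem_univ a)
    rcases hp0.eq_or_lt with h0 | hpos
    · have hz : g a =ᵐ[μ.restrict (Y ⁻¹' {b})] 0 :=
        (integral_eq_zero_iff_of_nonneg (hg0 a) (hInt a).integrableOn).1 h0.symm
      have : ∫ x in Y ⁻¹' {b}, Real.negMulLog (g a x) ∂μ = 0 := by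
        rw [← integral_zero X ℝ (μ := μ.restrict (Y ⁻¹' {b}))]
        refine integral_congr_ae ?_
        filter_upwards [hz] with x hx
        simp [hx]
      rw [this, ← h0]
      simp
    · have hq : 0 < q := hpos.trans_le hpq
      have hs : 0 < p / q := div_pos hpos hq
      have hle : ∫ x in Y ⁻¹' {b}, Real.negMulLog (g a x) ∂μ ≤
          ∫ x in Y ⁻¹' {b}, ((-Real.log (p / q) - 1) * g a x + p / q) ∂μ := by
        refine integral_mono (hint2 a).integrableOn
          (((hInt a).integrableOn.const_mul _).add (integrable_const _)) fun x => ?_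
        have := negMulLog_le_tangent (hg0 a x) hs
        simp only
        linarith
      rw [integral_add ((hInt a).integrableOn.const_mul _) (integrable_const _),
        integral_const_mul, integral_const] at hle
      have hm : (μ.restrict (Y ⁻¹' {b})).real univ = q := by simp [hqdef, Measure.real]
      have hc : q * (p / q) = p := by field_simp
      rw [hm, smul_eq_mul, ← hpdef, hc, Real.log_div hpos.ne' hq.ne'] at hle
      have he : Real.negMulLog p = p * (-Real.log q) + ((-(Real.log p - Real.log q) - 1) * p + p) := by
        unfold Real.negMulLog
        ring
      rw [he]
      gcongr
  have hsum : ∀ a, ∫ x, Real.negMulLog (g a x) ∂μ =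
      ∑ b, ∫ x in Y ⁻¹' {b}, Real.negMulLog (g a x) ∂μ := by
    intro a
    rw [← integral_iUnion_fintype hYm _ fun b => (hint2 a).integrableOn]
    · have : ⋃ b, Y ⁻¹' {b} = univ := by ext x; simp
      rw [this, Measure.restrict_univ]
    · intro b b' hbb'
      refine disjoint_left.2 fun x hx hx' => hbb' ?_
      exact hx.symm.trans hx'
  have hH : partitionEntropy μ Y =
      ∑ a, ∑ b, (∫ x in Y ⁻¹' {b}, g a x ∂μ) * (-Real.log (μ.real (Y ⁻¹' {b}))) := by
    rw [Finset.sum_comm]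
    refine Finset.sum_congr rfl fun b _ => ?_
    rw [← Finset.sum_mul, hpb, Real.negMulLog]
    ring
  rw [hH, ← Finset.sum_add_distrib]
  unfold partitionEntropy
  rw [Fintype.sum_prod_type]
  refine Finset.sum_le_sum fun a _ => ?_
  rw [hsum, ← Finset.sum_add_distrib]
  refine Finset.sum_le_sum fun b _ => ?_
  rw [hp]
  exact key a b

lemma measurable_itinerary {ι : Type*} [MeasurableSpace ι] {f : X → X} (hf : Measurable f)
    {ξ : X → ι} (hξ : Measurable ξ) (n : ℕ) : Measurable (itinerary f ξ n) :=
  measurable_pi_lambda _ fun i => hξ.comp (hf.iterate i)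

/-- The left side is the entropy of `ξ` conditioned on the whole future `f⁻¹` of the σ-algebra. An
itinerary of length `n + 1` is `ξ` together with the itinerary of length `n` of the image, so each
step adds at least this amount. -/
lemma entropyOfPartition_ge {k : ℕ} {μ : Measure X} [IsProbabilityMeasure μ] {f : X → X}
    (hf : MeasurePreserving f μ μ) {ξ : X → Fin k} (hξ : Measurable ξ)
    {g : Fin k → X → ℝ} (hgm : ∀ a, Measurable (g a)) (hg0 : ∀ a x, 0 ≤ g a x)
    (hg1 : ∀ a x, g a x ≤ 1)
    (hg : ∀ a, (μ.restrict (ξ ⁻¹' {a})).map f = μ.withDensity fun x => ENNReal.ofReal (g a x)) :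
    ∑ a, ∫ x, Real.negMulLog (g a x) ∂μ ≤ entropyOfPartition f μ ξ := by
  set S := ∑ a, ∫ x, Real.negMulLog (g a x) ∂μ
  have hn : ∀ n : ℕ, n * S ≤ partitionEntropy μ (itinerary f ξ n) := by
    intro n
    induction n with
    | zero => simpa using partitionEntropy_nonneg μ (itinerary f ξ 0)
    | succ n ih =>
      have h := partitionEntropy_prod_ge hf hξ (measurable_itinerary hf.measurable hξ n)
        hgm hg0 hg1 hg
      have he : itinerary f ξ (n + 1) = fun x =>
          (Fin.consEquiv fun _ : Fin (n + 1) => Fin k) (ξ x, itinerary f ξ n (f x)) := by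
        funext x i
        refine Fin.cases ?_ (fun j => ?_) i
        · simp [itinerary, Fin.consEquiv]
        · simp [itinerary, Fin.consEquiv]
      rw [he, partitionEntropy_equiv_comp]
      push_cast
      linarith
  refine le_ciInf fun n => ?_
  rw [le_div_iff₀ (by positivity), mul_comm]
  have := hn (n + 1)
  push_cast at this
  exact this

end PartitionEntropy

/-! ### The lower bound for the entropy of an absolutely continuous measure -/

section LowerBound

variable {X : Type*} [MeasurableSpace X] {μ : Measure X} [IsProbabilityMeasure μ] {f : X → X}

/-- A coboundary which is bounded from below by an integrable function has integral zero. -/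
lemma integrable_coboundary (hf : MeasurePreserving f μ μ) {u ψ : X → ℝ} (hu : Measurable u)
    (hψ : Integrable ψ μ) (hle : ∀ᵐ x ∂μ, -ψ x ≤ u (f x) - u x) :
    Integrable (fun x => u (f x) - u x) μ ∧ ∫ x, (u (f x) - u x) ∂μ = 0 := by
  -- Truncation makes `u` bounded, so the truncated coboundaries have integral zero. Being monotone
  -- and 1-Lipschitz, truncation preserves the lower bound `-|ψ|`; Fatou then gives integrability of
  -- the limit, and dominated convergence its integral.
  let cl : ℕ → ℝ → ℝ := fun K t => max (-(K : ℝ)) (min t K)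
  have hclm : ∀ K, Measurable (cl K) := fun K => by fun_prop
  have hclb : ∀ K t, |cl K t| ≤ K := by
    intro K t
    have hK : (0 : ℝ) ≤ K := Nat.cast_nonneg K
    rw [abs_le]
    exact ⟨le_max_left _ _, max_le (by linarith) (min_le_right _ _)⟩
  have hcl_lip : ∀ K s t, |cl K s - cl K t| ≤ |s - t| := by
    intro K s t
    simp only [cl]
    have h1 : |max (-(K : ℝ)) (min s K) - max (-(K : ℝ)) (min t K)| ≤ |min s K - min t K| := by
      rw [max_comm, max_comm (-(K : ℝ))]
      exact abs_max_sub_max_le_abs _ _ _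
    have h2 : |min s (K : ℝ) - min t K| ≤ |s - t| := abs_inf_sub_inf_le_abs s t K
    exact h1.trans h2
  have hcl_mono : ∀ K, Monotone (cl K) := fun K s t hst =>
    max_le_max le_rfl (min_le_min hst le_rfl)
  have hcl_lim : ∀ t, ∀ᶠ K : ℕ in atTop, cl K t = t := by
    intro t
    obtain ⟨N, hN⟩ := exists_nat_ge |t|
    filter_upwards [eventually_ge_atTop N] with K hK
    have hK' : (N : ℝ) ≤ K := by exact_mod_cast hK
    have := abs_le.1 hN
    simp only [cl]
    rw [min_eq_left (by linarith), max_eq_right (by linarith)]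
  let v : ℕ → X → ℝ := fun K x => cl K (u (f x)) - cl K (u x)
  have hint1 : ∀ K, Integrable (fun x => cl K (u x)) μ := fun K =>
    Integrable.of_bound ((hclm K).comp hu).aestronglyMeasurable K
      (ae_of_all _ fun x => by rw [Real.norm_eq_abs]; exact hclb K _)
  have hint2 : ∀ K, Integrable (fun x => cl K (u (f x))) μ := fun K =>
    hf.integrable_comp_of_integrable (hint1 K)
  have hv0 : ∀ K, ∫ x, v K x ∂μ = 0 := by
    intro K
    rw [integral_sub (hint2 K) (hint1 K)]
    have : ∫ x, cl K (u (f x)) ∂μ = ∫ x, cl K (u x) ∂μ := by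
      conv_rhs => rw [← hf.map_eq]
      exact (integral_map hf.measurable.aemeasurable
        ((hclm K).comp hu).aestronglyMeasurable).symm
    linarith
  have hvge : ∀ K, ∀ᵐ x ∂μ, 0 ≤ v K x + |ψ x| := by
    intro K
    filter_upwards [hle] with x hx
    rcases le_total (u x) (u (f x)) with h | h
    · have := hcl_mono K h
      simp only [v]
      linarith [abs_nonneg (ψ x)]
    · have h1 := hcl_lip K (u (f x)) (u x)
      rw [abs_of_nonpos (by linarith : u (f x) - u x ≤ 0)] at h1
      have h2 := (abs_le.1 h1).1
      simp only [v]
      linarith [le_abs_self (ψ x)]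
  have hvlim : ∀ x, Tendsto (fun K => v K x) atTop (𝓝 (u (f x) - u x)) := by
    intro x
    refine tendsto_const_nhds.congr' ?_
    filter_upwards [hcl_lim (u (f x)), hcl_lim (u x)] with K h1 h2
    simp only [v, h1, h2]
  have hum : Measurable (fun x => u (f x) - u x) := (hu.comp hf.measurable).sub hu
  have hvint : ∀ K, Integrable (v K) μ := fun K => (hint2 K).sub (hint1 K)
  have hfatou : ∫⁻ x, ENNReal.ofReal (u (f x) - u x + |ψ x|) ∂μ ≤
      ENNReal.ofReal (∫ x, |ψ x| ∂μ) := by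
    have h1 : ∀ x, ENNReal.ofReal (u (f x) - u x + |ψ x|) =
        liminf (fun K => ENNReal.ofReal (v K x + |ψ x|)) atTop := fun x =>
      ((ENNReal.tendsto_ofReal ((hvlim x).add_const _)).liminf_eq).symm
    simp only [h1]
    refine (lintegral_liminf_le' fun K => ?_).trans ?_
    · exact ((hvint K).aemeasurable.add hψ.abs.aemeasurable).ennreal_ofReal
    · have h2 : ∀ K, ∫⁻ x, ENNReal.ofReal (v K x + |ψ x|) ∂μ =
          ENNReal.ofReal (∫ x, |ψ x| ∂μ) := by
        intro K
        have h3 : Integrable (fun x => v K x + |ψ x|) μ := (hvint K).add hψ.abs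
        rw [← ofReal_integral_eq_lintegral_ofReal h3 (hvge K),
          integral_add (hvint K) hψ.abs, hv0, zero_add]
      simp only [h2, liminf_const, le_refl]
  have hInt : Integrable (fun x => u (f x) - u x) μ := by
    have h1 : Integrable (fun x => u (f x) - u x + |ψ x|) μ := by
      refine ⟨hum.aestronglyMeasurable.add hψ.abs.aestronglyMeasurable, ?_⟩
      rw [hasFiniteIntegral_iff_ofReal]
      · exact hfatou.trans_lt ENNReal.ofReal_lt_top
      · filter_upwards [hle] with x hx
        simp only [Pi.zero_apply]
        linarith [le_abs_self (ψ x)]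
    refine (h1.sub hψ.abs).congr (ae_of_all _ fun x => ?_)
    simp
  refine ⟨hInt, ?_⟩
  have hlim := tendsto_integral_of_dominated_convergence (fun x => |u (f x) - u x|)
    (fun K => (hvint K).aestronglyMeasurable) hInt.abs
    (fun K => ae_of_all _ fun x => by rw [Real.norm_eq_abs]; exact hcl_lip K _ _)
    (ae_of_all _ hvlim)
  simp only [hv0] at hlim
  exact tendsto_nhds_unique hlim tendsto_const_nhds |>.symm ▸ rfl

/-- The image of a restriction of `μ` is at most the image of `μ`, which is `μ`. So the density is
at most one almost everywhere, and the minimum with one makes this hold everywhere. -/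
lemma exists_density_map_restrict (hf : MeasurePreserving f μ μ) (E : Set X) :
    ∃ g : X → ℝ, Measurable g ∧ (∀ x, 0 ≤ g x) ∧ (∀ x, g x ≤ 1) ∧
      (μ.restrict E).map f = μ.withDensity fun x => ENNReal.ofReal (g x) := by
  have hle : (μ.restrict E).map f ≤ μ := by
    conv_rhs => rw [← hf.map_eq]
    exact Measure.map_mono Measure.restrict_le_self hf.measurable
  have hac : (μ.restrict E).map f ≪ μ := Measure.absolutelyContinuous_of_le hle
  have : IsFiniteMeasure ((μ.restrict E).map f) := isFiniteMeasure_of_le μ hle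
  set r := ((μ.restrict E).map f).rnDeriv μ with hr
  have hrm : Measurable r := Measure.measurable_rnDeriv _ _
  have h1 : r ≤ᵐ[μ] 1 := Measure.rnDeriv_le_one_of_le hle
  refine ⟨fun x => min 1 (r x).toReal, measurable_const.min hrm.ennreal_toReal,
    fun x => le_min zero_le_one ENNReal.toReal_nonneg, fun x => min_le_left _ _, ?_⟩
  conv_lhs => rw [← Measure.withDensity_rnDeriv_eq _ _ hac]
  refine withDensity_congr_ae ?_
  filter_upwards [h1] with x hx
  have hx' : r x ≤ 1 := hx
  have h2 : (r x).toReal ≤ 1 := by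
    simpa using ENNReal.toReal_mono ENNReal.one_ne_top hx'
  rw [min_eq_right h2, ENNReal.ofReal_toReal (ne_top_of_le_ne_top ENNReal.one_ne_top hx')]

/-- On a set of injectivity, the density of the image measure is the inverse of the Jacobian
with respect to the invariant measure. -/
lemma density_mul_jacobian_ae_eq {m : Measure X} [SigmaFinite m] (hμm : μ ≪ m)
    (hf : MeasurePreserving f μ μ) {D : X → ℝ≥0∞} {U E : Set X} (hJ : IsJacobianOn m f D U)
    (hEU : E ⊆ U) (hE : MeasurableSet E) (hinj : InjOn f E) {g : X → ℝ} (hgm : Measurable g)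
    (hg : (μ.restrict E).map f = μ.withDensity fun x => ENNReal.ofReal (g x)) :
    ∀ᵐ x ∂m.restrict E,
      D x * (ENNReal.ofReal (g (f x)) * μ.rnDeriv m (f x)) = μ.rnDeriv m x := by
  have hh : Measurable (μ.rnDeriv m) := Measure.measurable_rnDeriv _ _
  have hwd : m.withDensity (μ.rnDeriv m) = μ := Measure.withDensity_rnDeriv_eq _ _ hμm
  have hGm : Measurable fun y => ENNReal.ofReal (g y) * μ.rnDeriv m y := hgm.ennreal_ofReal.mul hh
  have hAm : AEMeasurable (fun x => D x * (ENNReal.ofReal (g (f x)) * μ.rnDeriv m (f x)))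
      (m.restrict E) :=
    (hJ.aemeasurable.mono_measure (Measure.restrict_mono hEU le_rfl)).mul
      (hGm.comp hf.measurable).aemeasurable
  -- Transported to `f '' A`, the integral becomes the mass that `f_*(μ|E)` gives to `f '' A`,
  -- namely `μ (E ∩ f⁻¹(f A))`; by injectivity on `E` this is `μ A`.
  have key : ∀ A ⊆ E, MeasurableSet A →
      ∫⁻ x in A, D x * (ENNReal.ofReal (g (f x)) * μ.rnDeriv m (f x)) ∂m = μ A := by
    intro A hAE hA
    have hfA := hJ.measurableSet_image A (hAE.trans hEU) hA (hinj.mono hAE)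
    rw [← hJ.setLIntegral_image hf.measurable (hAE.trans hEU) hA (hinj.mono hAE)
      (fun y => ENNReal.ofReal (g y) * μ.rnDeriv m y)]
    have h1 : ∫⁻ y in f '' A, ENNReal.ofReal (g y) * μ.rnDeriv m y ∂m =
        ∫⁻ y in f '' A, ENNReal.ofReal (g y) ∂μ := by
      conv_rhs => rw [← hwd]
      rw [setLIntegral_withDensity_eq_setLIntegral_mul _ hh hgm.ennreal_ofReal hfA]
      refine lintegral_congr fun x => ?_
      simp [mul_comm]
    rw [h1, ← withDensity_apply _ hfA, ← hg, Measure.map_apply hf.measurable hfA,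
      Measure.restrict_apply (hf.measurable hfA)]
    congr 1
    ext x
    constructor
    · rintro ⟨⟨y, hy, hyx⟩, hx⟩
      rwa [← hinj (hAE hy) hx hyx]
    · intro hx
      exact ⟨⟨x, hx, rfl⟩, hAE hx⟩
  refine ae_eq_of_forall_setLIntegral_eq_of_sigmaFinite₀ hAm hh.aemeasurable ?_
  intro A hA _
  rw [Measure.restrict_restrict hA, key _ inter_subset_right (hA.inter hE)]
  conv_lhs => rw [← hwd]
  rw [withDensity_apply _ (hA.inter hE)]

/-- One factor `g` in `-g log g` turns `μ` into `f_*(μ|E)`, and the integral is then pulled back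
along `f`. -/
lemma integral_negMulLog_density (hf : MeasurePreserving f μ μ) {E : Set X} {g : X → ℝ}
    (hgm : Measurable g) (hg0 : ∀ x, 0 ≤ g x)
    (hg : (μ.restrict E).map f = μ.withDensity fun x => ENNReal.ofReal (g x)) :
    ∫ x, Real.negMulLog (g x) ∂μ = ∫ x in E, -Real.log (g (f x)) ∂μ := by
  have hlm : Measurable fun x => -Real.log (g x) := (Real.measurable_log.comp hgm).neg
  have h1 : ∫ y, -Real.log (g y) ∂((μ.restrict E).map f) = ∫ x in E, -Real.log (g (f x)) ∂μ :=
    integral_map hf.measurable.aemeasurable hlm.aestronglyMeasurable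
  rw [← h1, hg, integral_withDensity_eq_integral_toReal_smul hgm.ennreal_ofReal
    (ae_of_all _ fun x => ENNReal.ofReal_lt_top)]
  refine integral_congr_ae (ae_of_all _ fun x => ?_)
  simp only [ENNReal.toReal_ofReal (hg0 x), smul_eq_mul, Real.negMulLog]
  ring

/-- The logarithm of the Jacobian with respect to the invariant measure, on a set of injectivity. -/
lemma neg_log_density_ae_eq {m : Measure X} [SigmaFinite m] (hμm : μ ≪ m)
    (hf : MeasurePreserving f μ μ) {D : X → ℝ} {U E : Set X}
    (hJ : IsJacobianOn m f (fun x => ENNReal.ofReal (D x)) U)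
    (hEU : E ⊆ U) (hE : MeasurableSet E) (hinj : InjOn f E) (hpos : ∀ x ∈ E, 0 < D x)
    {g : X → ℝ} (hgm : Measurable g) (hg0 : ∀ x, 0 ≤ g x)
    (hg : (μ.restrict E).map f = μ.withDensity fun x => ENNReal.ofReal (g x)) :
    ∀ᵐ x ∂μ.restrict E, -Real.log (g (f x)) = Real.log (D x) +
      (Real.log (μ.rnDeriv m (f x)).toReal - Real.log (μ.rnDeriv m x).toReal) := by
  have h1 := density_mul_jacobian_ae_eq hμm hf hJ hEU hE hinj hgm hg
  have h1' := (hμm.restrict E).ae_le h1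
  have h2 : ∀ᵐ x ∂μ, 0 < μ.rnDeriv m x := Measure.rnDeriv_pos hμm
  have h3 : ∀ᵐ x ∂μ, μ.rnDeriv m x < ⊤ := hμm.ae_le (Measure.rnDeriv_lt_top μ m)
  have h4 : ∀ᵐ x ∂μ, 0 < μ.rnDeriv m (f x) := hf.quasiMeasurePreserving.ae h2
  have h5 : ∀ᵐ x ∂μ, μ.rnDeriv m (f x) < ⊤ := hf.quasiMeasurePreserving.ae h3
  filter_upwards [h1', ae_restrict_of_ae h2, ae_restrict_of_ae h3, ae_restrict_of_ae h4,
    ae_restrict_of_ae h5, ae_restrict_mem hE] with x e1 e2 e3 e4 e5 hx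
  have hD := hpos x hx
  have e6 := congrArg ENNReal.toReal e1
  rw [ENNReal.toReal_mul, ENNReal.toReal_mul, ENNReal.toReal_ofReal hD.le,
    ENNReal.toReal_ofReal (hg0 _)] at e6
  have hx1 := ENNReal.toReal_pos e2.ne' e3.ne
  have hx2 := ENNReal.toReal_pos e4.ne' e5.ne
  have hgx : 0 < g (f x) := by
    refine lt_of_le_of_ne (hg0 _) fun h0 => ?_
    rw [← h0] at e6
    simp only [zero_mul, mul_zero] at e6
    exact hx1.ne e6
  rw [← e6, Real.log_mul hD.ne' (mul_pos hgx hx2).ne', Real.log_mul hgx.ne' hx2.ne']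
  ring

/-- For an absolutely continuous invariant probability measure, the entropy is at least the integral
of the logarithm of the Jacobian. -/
theorem integral_log_jacobian_le_measureEntropy {m : Measure X} [SigmaFinite m] (hμm : μ ≪ m)
    (hf : MeasurePreserving f μ μ) {D : X → ℝ} {U : Set X}
    (hJ : IsJacobianOn m f (fun x => ENNReal.ofReal (D x)) U) {E : ℕ → Set X}
    (hEU : ∀ n, E n ⊆ U) (hE : ∀ n, MeasurableSet (E n))
    (hdisj : Pairwise (Function.onFun Disjoint E)) (hcov : μ (⋃ n, E n)ᶜ = 0)
    (hinj : ∀ n, InjOn f (E n)) (hpos : ∀ n, ∀ x ∈ E n, 0 < D x)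
    (hInt : Integrable (fun x => Real.log (D x)) μ) :
    ((∫ x, Real.log (D x) ∂μ : ℝ) : EReal) ≤ measureEntropy f μ := by
  classical
  let u : X → ℝ := fun x => Real.log (μ.rnDeriv m x).toReal
  have hu : Measurable u := Real.measurable_log.comp (Measure.measurable_rnDeriv _ _).ennreal_toReal
  let W : X → ℝ := fun x => Real.log (D x) + (u (f x) - u x)
  have hcov' : ∀ᵐ x ∂μ, x ∈ ⋃ n, E n := by rwa [ae_iff]
  have hUE : μ.restrict (⋃ n, E n) = μ := Measure.restrict_eq_self_of_ae_mem hcov'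
  -- On each `E n`, `W` is `-log g∘f` for a density `g ≤ 1`. This is what bounds the coboundary from
  -- below by an integrable function.
  have hW0 : ∀ᵐ x ∂μ, 0 ≤ W x := by
    rw [← hUE, ae_restrict_iUnion_iff]
    intro n
    obtain ⟨g, hgm, hg0, hg1, hg⟩ := exists_density_map_restrict hf (E n)
    filter_upwards [neg_log_density_ae_eq hμm hf hJ (hEU n) (hE n) (hinj n) (hpos n) hgm hg0 hg]
      with x hx
    simp only [W, u]
    rw [← hx]
    exact neg_nonneg.2 (Real.log_nonpos (hg0 _) (hg1 _))
  obtain ⟨hφ, hφ0⟩ := integrable_coboundary hf hu hInt (by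
    filter_upwards [hW0] with x hx
    simp only [W] at hx
    linarith)
  have hWint : Integrable W μ := hInt.add hφ
  have hWval : ∫ x, W x ∂μ = ∫ x, Real.log (D x) ∂μ := by
    simp only [W]
    rw [integral_add hInt hφ, hφ0, add_zero]
  -- the labelling by the sets of injectivity
  let L : X → ℕ := fun x => if h : ∃ n, x ∈ E n then h.choose + 1 else 0
  have hLsucc : ∀ n x, L x = n + 1 ↔ x ∈ E n := by
    intro n x
    simp only [L]
    constructor
    · intro h
      split_ifs at h with h1
      have := h1.choose_spec
      rwa [Nat.succ_injective h] at this
    · intro hx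
      have h1 : ∃ n, x ∈ E n := ⟨n, hx⟩
      rw [dif_pos h1]
      by_contra hne
      have hne' : h1.choose ≠ n := fun h => hne (by rw [h])
      exact disjoint_left.1 (hdisj hne') h1.choose_spec hx
  have hLm : Measurable L := by
    refine measurable_to_countable' fun n => ?_
    cases n with
    | zero =>
      convert (MeasurableSet.iUnion hE).compl using 1
      ext x
      simp only [mem_preimage, mem_singleton_iff, mem_compl_iff, mem_iUnion, L]
      split_ifs with h <;> simp [h]
    | succ n =>
      convert hE n using 1
      ext x
      simp [hLsucc]
  -- Entropy is tested on finite partitions only, so take `E 0, …, E (K - 1)` and put all other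
  -- points into the atom 0, which contributes a nonnegative term; then let `K` grow.
  have hK : ∀ K : ℕ, ((∑ n ∈ Finset.range K, ∫ x in E n, W x ∂μ : ℝ) : EReal) ≤
      measureEntropy f μ := by
    intro K
    let ξ : X → Fin (K + 1) := fun x => if h : L x < K + 1 then ⟨L x, h⟩ else 0
    have hξ : Measurable ξ := by
      have : Measurable fun n : ℕ => if h : n < K + 1 then (⟨n, h⟩ : Fin (K + 1)) else 0 :=
        measurable_of_countable _
      exact this.comp hLm
    have hat : ∀ n : Fin K, ξ ⁻¹' {n.succ} = E n := by
      intro n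
      ext x
      rw [← hLsucc]
      simp only [mem_preimage, mem_singleton_iff, ξ]
      have hn := n.2
      constructor
      · intro h
        split_ifs at h with h1
        · have := congrArg Fin.val h
          simpa using this
        · exact absurd h (Fin.succ_ne_zero n).symm
      · intro h
        have h1 : L x < K + 1 := by omega
        rw [dif_pos h1]
        ext
        simp [h]
    choose g hgm hg0 hg1 hg using fun a : Fin (K + 1) =>
      exists_density_map_restrict hf (ξ ⁻¹' {a})
    have h1 := entropyOfPartition_ge hf hξ hgm hg0 hg1 hg
    have h2 : ∑ n ∈ Finset.range K, ∫ x in E n, W x ∂μ ≤ ∑ a, ∫ x, Real.negMulLog (g a x) ∂μ := by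
      rw [Fin.sum_univ_succ, ← Fin.sum_univ_eq_sum_range fun n => ∫ x in E n, W x ∂μ]
      have h3 : 0 ≤ ∫ x, Real.negMulLog (g 0 x) ∂μ :=
        integral_nonneg fun x => Real.negMulLog_nonneg (hg0 _ _) (hg1 _ _)
      have h4 : ∀ n : Fin K, ∫ x in E n, W x ∂μ = ∫ x, Real.negMulLog (g n.succ x) ∂μ := by
        intro n
        have hgn := hg n.succ
        rw [integral_negMulLog_density hf (hgm _) (hg0 _) hgn]
        rw [hat] at hgn ⊢
        refine integral_congr_ae ?_
        filter_upwards [neg_log_density_ae_eq hμm hf hJ (hEU n) (hE n) (hinj n) (hpos n)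
          (hgm _) (hg0 _) hgn] with x hx
        rw [hx]
      simp only [h4]
      linarith
    calc ((∑ n ∈ Finset.range K, ∫ x in E n, W x ∂μ : ℝ) : EReal)
        ≤ (entropyOfPartition f μ ξ : EReal) := EReal.coe_le_coe_iff.2 (h2.trans h1)
      _ ≤ measureEntropy f μ :=
        le_iSup_of_le (K + 1) (le_iSup_of_le ξ (le_iSup_of_le hξ le_rfl))
  have hsum := (hasSum_integral_iUnion hE hdisj hWint.integrableOn).tendsto_sum_nat
  rw [hUE, hWval] at hsum
  exact le_of_tendsto ((continuous_coe_real_ereal.tendsto _).comp hsum) (Eventually.of_forall hK)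

end LowerBound

/-! ### Towers over induced maps -/

section Tower

variable {M : Type*}

/-- The tower map over `F` with roof function `R`. -/
def towerMap (F : M → M) (R : M → ℕ) (z : M × ℕ) : M × ℕ :=
  if z.2 + 1 < R z.1 then (z.1, z.2 + 1) else (F z.1, 0)

/-- The label of a point of the tower: it is positive on the base and determines there the partition
element, and it is zero above the base. -/
def towerLabel (idx : M → ℕ) (z : M × ℕ) : ℕ := if z.2 = 0 then idx z.1 + 1 else 0

/-- The function on the tower equal to `ψ` on the base and to zero above it. -/
noncomputable def towerLift (ψ : M → ℝ) (z : M × ℕ) : ℝ := if z.2 = 0 then ψ z.1 else 0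

variable {F : M → M} {R : M → ℕ}

lemma towerMap_of_lt {x : M} {l : ℕ} (h : l + 1 < R x) : towerMap F R (x, l) = (x, l + 1) :=
  if_pos h

lemma towerMap_of_le {x : M} {l : ℕ} (h : R x ≤ l + 1) : towerMap F R (x, l) = (F x, 0) :=
  if_neg (not_lt.2 h)

lemma towerMap_iterate_of_lt {x : M} {l i : ℕ} (h : l + i < R x) :
    (towerMap F R)^[i] (x, l) = (x, l + i) := by
  induction i with
  | zero => rfl
  | succ i ih =>
    rw [Function.iterate_succ_apply', ih (by omega), towerMap_of_lt (by omega)]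
    rfl

lemma towerMap_iterate_roof {x : M} {l : ℕ} (h : l < R x) :
    (towerMap F R)^[R x - l] (x, l) = (F x, 0) := by
  obtain ⟨i, hi⟩ : ∃ i, R x - l = i + 1 := ⟨R x - l - 1, by omega⟩
  rw [hi, Function.iterate_succ_apply', towerMap_iterate_of_lt (by omega), towerMap_of_le (by omega)]

/-- A point of level `l` reached after `l` steps starts from the base. -/
lemma towerMap_iterate_eq_level {z : M × ℕ} {x : M} {l : ℕ}
    (h : (towerMap F R)^[l] z = (x, l)) : z = (x, 0) := by
  induction l with
  | zero => exact h
  | succ l ih =>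
    refine ih ?_
    rw [Function.iterate_succ_apply'] at h
    unfold towerMap at h
    split_ifs at h with h1
    · simp only [Prod.mk.injEq, Nat.add_right_cancel_iff] at h
      exact Prod.ext h.1 h.2
    · simp at h

lemma towerMap_iterate_level_iff {z : M × ℕ} {B : Set M} {l : ℕ} :
    (towerMap F R)^[l] z ∈ {w : M × ℕ | w.2 = l ∧ w.1 ∈ B ∧ l < R w.1} ↔
      z ∈ {w : M × ℕ | w.2 = 0 ∧ w.1 ∈ B ∧ l < R w.1} := by
  constructor
  · rintro ⟨h1, h2, h3⟩
    have : z = (((towerMap F R)^[l] z).1, 0) := by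
      refine towerMap_iterate_eq_level (F := F) (R := R) (l := l) ?_
      exact Prod.ext rfl h1
    rw [this]
    exact ⟨rfl, h2, h3⟩
  · obtain ⟨x, k⟩ := z
    rintro ⟨h1, h2, h3⟩
    simp only at h1 h2 h3
    subst h1
    rw [towerMap_iterate_of_lt (by omega)]
    exact ⟨by simp, h2, h3⟩

/-! ### Labels of tower orbits and returns to the base. -/

section Labels

variable {idx : M → ℕ} {ρ : ℕ → ℕ}

/-- The first `s` labels of a base point are determined by the indices of its first `j` returns,
where `j` is the number of visits to the base before time `s`. -/
lemma exists_returns_determine_labels (hρ : ∀ n, 1 ≤ ρ n) (ψ : M → ℝ) (s : ℕ) (y : M) :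
    ∃ j, ∑ i ∈ Finset.range s, towerLift ψ ((towerMap F (fun x => ρ (idx x)))^[i] (y, 0)) =
        ∑ i ∈ Finset.range j, ψ (F^[i] y) ∧
      ∀ y', (∀ i < j, idx (F^[i] y') = idx (F^[i] y)) → ∀ i < s,
        towerLabel idx ((towerMap F (fun x => ρ (idx x)))^[i] (y', 0)) =
          towerLabel idx ((towerMap F (fun x => ρ (idx x)))^[i] (y, 0)) := by
  induction s using Nat.strong_induction_on generalizing y with
  | _ s ih =>
  rcases Nat.eq_zero_or_pos s with rfl | hs
  · exact ⟨0, by simp, by simp⟩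
  have hr := hρ (idx y)
  have hlow : ∀ y', ρ (idx y') = ρ (idx y) → ∀ i < ρ (idx y),
      (towerMap F (fun x => ρ (idx x)))^[i] (y', 0) = (y', i) := by
    intro y' h' i hi
    rw [towerMap_iterate_of_lt (by simpa [h'] using hi), zero_add]
  have hlab : ∀ y', idx y' = idx y → ∀ i < ρ (idx y),
      towerLabel idx ((towerMap F (fun x => ρ (idx x)))^[i] (y', 0)) =
        towerLabel idx ((towerMap F (fun x => ρ (idx x)))^[i] (y, 0)) := by
    intro y' h' i hi
    rw [hlow y' (by rw [h']) i hi, hlow y rfl i hi]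
    simp [towerLabel, h']
  have hroof : ∀ y', idx y' = idx y →
      (towerMap F (fun x => ρ (idx x)))^[ρ (idx y)] (y', 0) = (F y', 0) := by
    intro y' h'
    have := towerMap_iterate_roof (F := F) (R := fun x => ρ (idx x)) (x := y') (l := 0)
      (Nat.lt_of_lt_of_le one_pos (hρ (idx y')))
    simpa [h'] using this
  have hsum : ∀ t, 1 ≤ t → t ≤ ρ (idx y) →
      ∑ i ∈ Finset.range t, towerLift ψ ((towerMap F (fun x => ρ (idx x)))^[i] (y, 0)) = ψ y := by
    intro t ht1 ht2
    rw [Finset.sum_eq_single_of_mem 0 (Finset.mem_range.2 (by omega))]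
    · simp [towerLift]
    · intro i hi hi0
      rw [hlow y rfl i (by rw [Finset.mem_range] at hi; omega)]
      simp [towerLift, hi0]
  -- Up to time `ρ (idx y)` only the initial visit at time 0 is seen, so one index is enough.
  -- Otherwise split off this first column and apply the induction hypothesis to the remaining time,
  -- starting from `F y`.
  rcases le_total s (ρ (idx y)) with hsr | hsr
  · refine ⟨1, ?_, fun y' hy' i hi => ?_⟩
    · rw [hsum s hs hsr]
      simp
    · exact hlab y' (by simpa using hy' 0 one_pos) i (by omega)
  · obtain ⟨s', rfl⟩ := Nat.exists_eq_add_of_le hsr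
    obtain ⟨j, hj1, hj2⟩ := ih s' (by omega) (F y)
    have hshift : ∀ y', idx y' = idx y → ∀ i,
        (towerMap F (fun x => ρ (idx x)))^[ρ (idx y) + i] (y', 0) =
          (towerMap F (fun x => ρ (idx x)))^[i] (F y', 0) := by
      intro y' h' i
      rw [add_comm, Function.iterate_add_apply, hroof y' h']
    refine ⟨j + 1, ?_, fun y' hy' i hi => ?_⟩
    · rw [Finset.sum_range_add, hsum _ hr le_rfl, Finset.sum_range_succ']
      simp only [hshift y rfl, hj1, Function.iterate_succ_apply, Function.iterate_zero, id]
      ring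
    · have h0 : idx y' = idx y := by simpa using hy' 0 (Nat.succ_pos j)
      rcases lt_or_ge i (ρ (idx y)) with h | h
      · exact hlab y' h0 i h
      · obtain ⟨i', rfl⟩ := Nat.exists_eq_add_of_le h
        rw [hshift y' h0, hshift y rfl]
        refine hj2 (F y') (fun k hk => ?_) i' (by omega)
        simpa using hy' (k + 1) (by omega)

/-- Before its first visit to the base, a point of the tower has zero labels. -/
lemma exists_first_visit {z : M × ℕ} (hz : z.2 < R z.1) (N : ℕ) (ψ : M → ℝ) :
    ∃ t ≤ N, ∃ y, (y = z.1 ∨ y = F z.1) ∧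
      (∀ i < t, towerLabel idx ((towerMap F R)^[i] z) = 0 ∧
        towerLift ψ ((towerMap F R)^[i] z) = 0) ∧
      ∀ i, t + i < N → (towerMap F R)^[t + i] z = (towerMap F R)^[i] (y, 0) := by
  obtain ⟨x, l⟩ := z
  simp only at hz
  rcases Nat.eq_zero_or_pos l with rfl | hl
  · exact ⟨0, Nat.zero_le _, x, Or.inl rfl, by simp, fun i _ => by rw [zero_add]⟩
  -- The base is reached after `R x - l` steps. If this exceeds the horizon `N`, all observed labels
  -- are zero and the last clause is vacuous.
  refine ⟨min (R x - l) N, min_le_right _ _, F x, Or.inr rfl, fun i hi => ?_, fun i hi => ?_⟩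
  · have h1 : l + i < R x := by
      have := hi.trans_le (min_le_left _ _)
      omega
    rw [towerMap_iterate_of_lt h1]
    have h2 : l + i ≠ 0 := by omega
    simp only [towerLabel, towerLift, if_neg h2, and_self]
  · have h1 : min (R x - l) N = R x - l := by omega
    rw [h1, add_comm, Function.iterate_add_apply, towerMap_iterate_roof hz]

end Labels

variable [MeasurableSpace M]

/-- The unnormalized tower measure. -/
noncomputable def towerMeasure (R : M → ℕ) (ν : Measure M) : Measure (M × ℕ) :=
  Measure.sum fun l : ℕ => (ν.restrict {x | l < R x}).map fun x => (x, l)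

lemma lintegral_towerMeasure {ν : Measure M} (hR : Measurable R) {g : M × ℕ → ℝ≥0∞}
    (hg : Measurable g) :
    ∫⁻ z, g z ∂towerMeasure R ν = ∫⁻ x, ∑ l ∈ Finset.range (R x), g (x, l) ∂ν := by
  have hRl : ∀ l : ℕ, MeasurableSet {x | l < R x} := fun l =>
    measurableSet_lt measurable_const hR
  have hgl : ∀ l : ℕ, Measurable fun x => g (x, l) := fun l => hg.comp measurable_prodMk_right
  rw [towerMeasure, lintegral_sum_measure]
  have h1 : ∀ l : ℕ, ∫⁻ z, g z ∂((ν.restrict {x | l < R x}).map fun x => (x, l)) =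
      ∫⁻ x, {x | l < R x}.indicator (fun x => g (x, l)) x ∂ν := fun l => by
    rw [lintegral_map hg measurable_prodMk_right, lintegral_indicator (hRl l)]
  simp only [h1]
  rw [← lintegral_tsum fun l => ((hgl l).indicator (hRl l)).aemeasurable]
  refine lintegral_congr fun x => ?_
  rw [tsum_eq_sum (s := Finset.range (R x))]
  · refine Finset.sum_congr rfl fun l hl => ?_
    rw [indicator_of_mem]
    simpa using hl
  · intro l hl
    rw [indicator_of_notMem]
    simpa using hl

lemma measurable_towerMap (hF : Measurable F) (hR : Measurable R) :
    Measurable (towerMap F R) := by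
  refine measurable_from_prod_countable_left fun l => ?_
  refine Measurable.ite ?_ (measurable_prodMk_right (y := l + 1)) (hF.prodMk measurable_const)
  exact measurableSet_lt (measurable_const (a := l + 1)) hR

/-- Summed over the column of `x`, composing `g` with the tower map replaces the base term `g (x,
0)` by `g (F x, 0)`, and these have the same integral by invariance under `F`. -/
lemma measurePreserving_towerMap {ν : Measure M} (hF : MeasurePreserving F ν ν) (hR : Measurable R)
    (hR1 : ∀ x, 1 ≤ R x) :
    MeasurePreserving (towerMap F R) (towerMeasure R ν) (towerMeasure R ν) := by
  have hT := measurable_towerMap hF.measurable hR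
  refine ⟨hT, Measure.ext_of_lintegral _ fun g hg => ?_⟩
  rw [lintegral_map hg hT, lintegral_towerMeasure hR hg,
    lintegral_towerMeasure hR (g := fun z => g (towerMap F R z)) (hg.comp hT)]
  have h1 : ∀ x, ∑ l ∈ Finset.range (R x), g (towerMap F R (x, l)) =
      ∑ l ∈ Finset.range (R x - 1), g (x, l + 1) + g (F x, 0) := by
    intro x
    obtain ⟨r, hr⟩ : ∃ r, R x = r + 1 := ⟨R x - 1, by have := hR1 x; omega⟩
    rw [hr, Finset.sum_range_succ, Nat.add_sub_cancel, towerMap_of_le (by omega)]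
    congr 1
    refine Finset.sum_congr rfl fun l hl => ?_
    rw [towerMap_of_lt (by rw [Finset.mem_range] at hl; omega)]
  have h2 : ∀ x, ∑ l ∈ Finset.range (R x), g (x, l) =
      ∑ l ∈ Finset.range (R x - 1), g (x, l + 1) + g (x, 0) := by
    intro x
    obtain ⟨r, hr⟩ : ∃ r, R x = r + 1 := ⟨R x - 1, by have := hR1 x; omega⟩
    rw [hr, Finset.sum_range_succ', Nat.add_sub_cancel]
  have hg0 : Measurable fun x => g (x, 0) := hg.comp measurable_prodMk_right
  simp only [h1, h2]
  have hg1 : Measurable fun x => g (F x, 0) := hg0.comp hF.measurable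
  rw [lintegral_add_right _ hg1, lintegral_add_right _ hg0,
    hF.lintegral_comp (f := fun x => g (x, 0)) hg0]

lemma ae_towerMeasure_iff {ν : Measure M} (hR : Measurable R) {p : M × ℕ → Prop}
    (hp : MeasurableSet {z | p z}) :
    (∀ᵐ z ∂towerMeasure R ν, p z) ↔ ∀ᵐ x ∂ν, ∀ l < R x, p (x, l) := by
  have hRl : ∀ l : ℕ, MeasurableSet {x | l < R x} := fun l =>
    measurableSet_lt measurable_const hR
  have h1 : ∀ l : ℕ, (∀ᵐ z ∂((ν.restrict {x | l < R x}).map fun x => (x, l)), p z) ↔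
      ∀ᵐ x ∂ν, l < R x → p (x, l) := fun l => by
    rw [ae_map_iff measurable_prodMk_right.aemeasurable hp, ae_restrict_iff' (hRl l)]
    rfl
  rw [towerMeasure, Measure.ae_sum_iff]
  simp only [h1]
  rw [ae_all_iff]

lemma ae_towerMeasure_of_ae {ν : Measure M} (hR : Measurable R) {p : M → Prop}
    (hp : ∀ᵐ x ∂ν, p x) : ∀ᵐ z ∂towerMeasure R ν, p z.1 ∧ z.2 < R z.1 := by
  obtain ⟨s, hs, hsm, hs0⟩ := exists_measurable_superset_of_null hp
  have hms : MeasurableSet {z : M × ℕ | z.1 ∉ s ∧ z.2 < R z.1} :=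
    (measurable_fst hsm.compl).inter (measurableSet_lt measurable_snd (hR.comp measurable_fst))
  have : ∀ᵐ z ∂towerMeasure R ν, z.1 ∉ s ∧ z.2 < R z.1 := by
    rw [ae_towerMeasure_iff hR hms]
    filter_upwards [measure_eq_zero_iff_ae_notMem.1 hs0] with x hx l hl
    exact ⟨hx, hl⟩
  filter_upwards [this] with z hz
  refine ⟨?_, hz.2⟩
  by_contra h
  exact hz.1 (hs h)

end Tower

/-! ### Approximation by windows of a label process -/

section Window

variable {X : Type*}

/-- The sequence of labels along the orbit of a point. -/
def labelSeq (T : X → X) (ζ : X → ℕ) (z : X) : ℕ → ℕ := fun i => ζ (T^[i] z)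

lemma labelSeq_iterate (T : X → X) (ζ : X → ℕ) (z : X) (i : ℕ) :
    labelSeq T ζ (T^[i] z) = fun j => labelSeq T ζ z (j + i) := by
  funext j
  simp only [labelSeq, Function.iterate_add_apply]

/-- Such a function factors through the countable discrete space `Fin L → ℕ`. -/
lemma measurable_of_window {β : Type*} [MeasurableSpace β] {L : ℕ} {Φ : (ℕ → ℕ) → β}
    (hΦ : ∀ a b : ℕ → ℕ, (∀ j < L, a j = b j) → Φ a = Φ b) : Measurable Φ := by
  let ext0 : (Fin L → ℕ) → (ℕ → ℕ) := fun c i => if h : i < L then c ⟨i, h⟩ else 0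
  have h1 : Φ = (fun c => Φ (ext0 c)) ∘ fun (a : ℕ → ℕ) (i : Fin L) => a i := by
    funext a
    refine hΦ _ _ fun j hj => ?_
    simp [ext0, hj]
  rw [h1]
  exact (measurable_of_countable _).comp (measurable_pi_lambda _ fun i => measurable_pi_apply _)

variable [MeasurableSpace X] {T : X → X} {ζ : X → ℕ} {ν : Measure X}

lemma measurable_labelSeq (hT : Measurable T) (hζ : Measurable ζ) : Measurable (labelSeq T ζ) :=
  measurable_pi_lambda _ fun i => hζ.comp (hT.iterate i)

/-- After some iterate of `T`, the set `E` can be read off a finite window of labels, up to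
arbitrarily small measure. -/
def IsWindowApproximable (T : X → X) (ζ : X → ℕ) (ν : Measure X) (E : Set X) : Prop :=
  MeasurableSet E ∧ ∀ δ : ℝ≥0∞, 0 < δ → ∃ k L : ℕ, ∃ S : Set (ℕ → ℕ),
    (∀ a b : ℕ → ℕ, (∀ j < L, a j = b j) → (a ∈ S ↔ b ∈ S)) ∧
      ν (symmDiff (T^[k] ⁻¹' E) (labelSeq T ζ ⁻¹' S)) ≤ δ

/-- Pulling back by `T^[j]` shifts the window and preserves measure. This brings approximations made
after different iterates to a common iterate, so that they can be combined. -/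
lemma window_shift (hT : MeasurePreserving T ν ν) (hζ : Measurable ζ) {E : Set X}
    (hE : MeasurableSet E) {k L : ℕ} {S : Set (ℕ → ℕ)} {δ : ℝ≥0∞}
    (hS : ∀ a b : ℕ → ℕ, (∀ j < L, a j = b j) → (a ∈ S ↔ b ∈ S))
    (hδ : ν (symmDiff (T^[k] ⁻¹' E) (labelSeq T ζ ⁻¹' S)) ≤ δ) (j : ℕ) :
    ∃ S' : Set (ℕ → ℕ), (∀ a b : ℕ → ℕ, (∀ i < L + j, a i = b i) → (a ∈ S' ↔ b ∈ S')) ∧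
      ν (symmDiff (T^[k + j] ⁻¹' E) (labelSeq T ζ ⁻¹' S')) ≤ δ := by
  refine ⟨{a | (fun i => a (i + j)) ∈ S}, fun a b hab => hS _ _ fun i hi => hab _ (by omega), ?_⟩
  have hSm : MeasurableSet S := measurableSet_setOfPred.2 (measurable_of_window (L := L)
    fun a b hab => propext (hS a b hab))
  have hm : MeasurableSet (symmDiff (T^[k] ⁻¹' E) (labelSeq T ζ ⁻¹' S)) :=
    ((hT.measurable.iterate k) hE).symmDiff ((measurable_labelSeq hT.measurable hζ) hSm)
  have he : symmDiff (T^[k + j] ⁻¹' E) (labelSeq T ζ ⁻¹' {a | (fun i => a (i + j)) ∈ S}) =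
      T^[j] ⁻¹' symmDiff (T^[k] ⁻¹' E) (labelSeq T ζ ⁻¹' S) := by
    rw [preimage_symmDiff]
    congr 1
    · ext z
      simp [Function.iterate_add_apply]
    · ext z
      simp only [mem_preimage, mem_ofPred_eq, labelSeq_iterate]
  rw [he, (hT.iterate j).measure_preimage hm.nullMeasurableSet]
  exact hδ

namespace IsWindowApproximable

lemma congr_ae {E E' : Set X} (hT : MeasurePreserving T ν ν) (hE : IsWindowApproximable T ζ ν E)
    (hE' : MeasurableSet E') (h : E =ᵐ[ν] E') : IsWindowApproximable T ζ ν E' := by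
  refine ⟨hE', fun δ hδ => ?_⟩
  obtain ⟨k, L, S, hS, hle⟩ := hE.2 δ hδ
  refine ⟨k, L, S, hS, le_trans (le_of_eq ?_) hle⟩
  have h1 : (T^[k] ⁻¹' E' : Set X) =ᵐ[ν] T^[k] ⁻¹' E :=
    ((hT.iterate k).quasiMeasurePreserving.preimage_ae_eq h).symm
  refine measure_congr ?_
  exact h1.symmDiff (ae_eq_refl _)

lemma compl {E : Set X} (hE : IsWindowApproximable T ζ ν E) : IsWindowApproximable T ζ ν Eᶜ := by
  refine ⟨hE.1.compl, fun δ hδ => ?_⟩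
  obtain ⟨k, L, S, hS, hle⟩ := hE.2 δ hδ
  refine ⟨k, L, Sᶜ, fun a b hab => not_congr (hS a b hab), ?_⟩
  rwa [preimage_compl, preimage_compl, compl_symmDiff_compl]

lemma union {E E' : Set X} (hT : MeasurePreserving T ν ν) (hζ : Measurable ζ)
    (hE : IsWindowApproximable T ζ ν E) (hE' : IsWindowApproximable T ζ ν E') :
    IsWindowApproximable T ζ ν (E ∪ E') := by
  refine ⟨hE.1.union hE'.1, fun δ hδ => ?_⟩
  obtain ⟨k, L, S, hS, hle⟩ := hE.2 (δ / 2) (ENNReal.half_pos hδ.ne')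
  obtain ⟨k', L', S', hS', hle'⟩ := hE'.2 (δ / 2) (ENNReal.half_pos hδ.ne')
  obtain ⟨U, hU, hUle⟩ := window_shift hT hζ hE.1 hS hle k'
  obtain ⟨U', hU', hUle'⟩ := window_shift hT hζ hE'.1 hS' hle' k
  rw [add_comm k' k] at hUle'
  refine ⟨k + k', max (L + k') (L' + k), U ∪ U', fun a b hab => or_congr
    (hU a b fun i hi => hab i (lt_max_of_lt_left hi))
    (hU' a b fun i hi => hab i (lt_max_of_lt_right hi)), ?_⟩
  calc ν (symmDiff (T^[k + k'] ⁻¹' (E ∪ E')) (labelSeq T ζ ⁻¹' (U ∪ U')))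
      ≤ ν (symmDiff (T^[k + k'] ⁻¹' E) (labelSeq T ζ ⁻¹' U) ∪
          symmDiff (T^[k + k'] ⁻¹' E') (labelSeq T ζ ⁻¹' U')) := by
        refine measure_mono fun z hz => ?_
        simp only [mem_symmDiff, mem_preimage, mem_union] at hz ⊢
        tauto
    _ ≤ δ / 2 + δ / 2 := (measure_union_le _ _).trans (add_le_add hUle hUle')
    _ = δ := ENNReal.add_halves δ

lemma inter {E E' : Set X} (hT : MeasurePreserving T ν ν) (hζ : Measurable ζ)
    (hE : IsWindowApproximable T ζ ν E) (hE' : IsWindowApproximable T ζ ν E') :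
    IsWindowApproximable T ζ ν (E ∩ E') := by
  have := (hE.compl.union hT hζ hE'.compl).compl
  rwa [← compl_inter, compl_compl] at this

lemma iUnion [IsFiniteMeasure ν] {E : ℕ → Set X} (hT : MeasurePreserving T ν ν)
    (hζ : Measurable ζ) (hE : ∀ n, IsWindowApproximable T ζ ν (E n)) :
    IsWindowApproximable T ζ ν (⋃ n, E n) := by
  have hacc : ∀ n, IsWindowApproximable T ζ ν (Set.accumulate E n) := by
    intro n
    induction n with
    | zero => simpa using hE 0
    | succ n ih =>
      rw [Set.accumulate_succ]
      exact ih.union hT hζ (hE _)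
  have hm : MeasurableSet (⋃ n, E n) := MeasurableSet.iUnion fun n => (hE n).1
  refine ⟨hm, fun δ hδ => ?_⟩
  -- By finiteness of `ν`, a finite union already exhausts the whole union up to measure `δ / 2`;
  -- the other half of `δ` pays for approximating that finite union.
  have hlim : Tendsto (fun n => ν ((⋃ n, E n) \ Set.accumulate E n)) atTop (𝓝 0) := by
    have h0 : ⋂ n, ((⋃ n, E n) \ Set.accumulate E n) = ∅ := by
      rw [← sdiff_iUnion, Set.iUnion_accumulate, sdiff_self]
    rw [← measure_empty (μ := ν), ← h0]
    refine tendsto_measure_iInter_atTop (fun n => (hm.diff (hacc n).1).nullMeasurableSet) ?_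
      ⟨0, measure_ne_top _ _⟩
    intro i j hij
    exact sdiff_subset_sdiff_right (Set.monotone_accumulate hij)
  obtain ⟨n, hn⟩ := ((tendsto_order.1 hlim).2 _ (ENNReal.half_pos hδ.ne')).exists
  obtain ⟨k, L, S, hS, hle⟩ := (hacc n).2 (δ / 2) (ENNReal.half_pos hδ.ne')
  refine ⟨k, L, S, hS, ?_⟩
  have hk : ν (T^[k] ⁻¹' ((⋃ n, E n) \ Set.accumulate E n)) ≤ δ / 2 := by
    rw [(hT.iterate k).measure_preimage (hm.diff (hacc n).1).nullMeasurableSet]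
    exact hn.le
  calc ν (symmDiff (T^[k] ⁻¹' (⋃ n, E n)) (labelSeq T ζ ⁻¹' S))
      ≤ ν (symmDiff (T^[k] ⁻¹' Set.accumulate E n) (labelSeq T ζ ⁻¹' S) ∪
          T^[k] ⁻¹' ((⋃ n, E n) \ Set.accumulate E n)) := by
        refine measure_mono fun z hz => ?_
        have hsub : T^[k] z ∈ Set.accumulate E n → T^[k] z ∈ ⋃ n, E n := fun h =>
          Set.accumulate_subset_iUnion n h
        simp only [mem_symmDiff, mem_preimage, mem_union, Set.mem_sdiff] at hz ⊢
        tauto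
    _ ≤ δ / 2 + δ / 2 := (measure_union_le _ _).trans (add_le_add hle hk)
    _ = δ := ENNReal.add_halves δ

lemma preimage {E : Set X} (hT : MeasurePreserving T ν ν) (hζ : Measurable ζ)
    (hE : IsWindowApproximable T ζ ν E) (j : ℕ) : IsWindowApproximable T ζ ν (T^[j] ⁻¹' E) := by
  refine ⟨(hT.measurable.iterate j) hE.1, fun δ hδ => ?_⟩
  obtain ⟨k, L, S, hS, hle⟩ := hE.2 δ hδ
  obtain ⟨U, hU, hUle⟩ := window_shift hT hζ hE.1 hS hle j
  refine ⟨k, L + j, U, hU, ?_⟩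
  rwa [← preimage_comp, ← Function.iterate_add, add_comm]

/-- This is the purpose of allowing an iterate first: forward labels need not determine a set above
the base, but they may determine its preimage. The shift is harmless for entropy because the measure
is invariant. -/
lemma of_preimage {E : Set X} (hE : MeasurableSet E) {j : ℕ}
    (h : IsWindowApproximable T ζ ν (T^[j] ⁻¹' E)) : IsWindowApproximable T ζ ν E := by
  refine ⟨hE, fun δ hδ => ?_⟩
  obtain ⟨k, L, S, hS, hle⟩ := h.2 δ hδ
  refine ⟨j + k, L, S, hS, ?_⟩
  rwa [← preimage_comp, ← Function.iterate_add] at hle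

lemma label (hζ : Measurable ζ) (n : ℕ) : IsWindowApproximable T ζ ν (ζ ⁻¹' {n}) := by
  refine ⟨hζ (measurableSet_singleton n), fun δ _ => ⟨0, 1, {a | a 0 = n}, fun a b hab => ?_, ?_⟩⟩
  · simp [hab 0 one_pos]
  · have : symmDiff (T^[0] ⁻¹' (ζ ⁻¹' {n})) (labelSeq T ζ ⁻¹' {a | a 0 = n}) = ∅ := by
      rw [symmDiff_eq_bot.2]
      · rfl
      · ext z
        simp [labelSeq]
    rw [this]
    simp

end IsWindowApproximable

/-- A finite partition into window approximable sets is approximated by a function of a window. -/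
lemma exists_window_function {r : ℕ} [NeZero r] (hT : MeasurePreserving T ν ν) (hζ : Measurable ζ)
    {ξ : X → Fin r} (hξ : ∀ c, IsWindowApproximable T ζ ν (ξ ⁻¹' {c})) {ε : ℝ≥0∞} (hε : 0 < ε) :
    ∃ k L : ℕ, ∃ Φ : (ℕ → ℕ) → Fin r, (∀ a b : ℕ → ℕ, (∀ j < L, a j = b j) → Φ a = Φ b) ∧
      ν {z | ξ (T^[k] z) ≠ Φ (labelSeq T ζ z)} ≤ ε := by
  classical
  have hr : (r : ℝ≥0∞) ≠ 0 := by exact_mod_cast NeZero.ne r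
  choose k L S hS hle using fun c => (hξ c).2 (ε / r)
    (ENNReal.div_pos hε.ne' (ENNReal.natCast_ne_top r))
  set K := ∑ c, k c
  have hkK : ∀ c, k c ≤ K := fun c => Finset.single_le_sum (fun _ _ => Nat.zero_le _)
    (Finset.mem_univ c)
  choose U hU hUle using fun c => window_shift hT hζ (hξ c).1 (hS c) (hle c) (K - k c)
  -- Outside the union of the approximation errors exactly one `U c` contains the label sequence,
  -- and the choice returns the true atom. Elsewhere the value is immaterial.
  let pick : (Fin r → Prop) → Fin r := fun p => if h : ∃ c, p c then h.choose else 0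
  let Φ : (ℕ → ℕ) → Fin r := fun a => pick fun c => a ∈ U c
  refine ⟨K, ∑ c, (L c + K), Φ, fun a b hab => ?_, ?_⟩
  · have h1 : ∀ c, a ∈ U c ↔ b ∈ U c := fun c => hU c a b fun i hi => hab i (by
      have h2 : L c + K ≤ ∑ c, (L c + K) := Finset.single_le_sum
        (f := fun c => L c + K) (fun _ _ => Nat.zero_le _) (Finset.mem_univ c)
      omega)
    exact congrArg pick (funext fun c => propext (h1 c))
  · have hsub : {z | ξ (T^[K] z) ≠ Φ (labelSeq T ζ z)} ⊆
        ⋃ c, symmDiff (T^[k c + (K - k c)] ⁻¹' (ξ ⁻¹' {c})) (labelSeq T ζ ⁻¹' U c) := by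
      intro z hz
      by_contra hcon
      simp only [mem_iUnion, not_exists, mem_symmDiff, mem_preimage, mem_singleton_iff] at hcon
      have h1 : ∀ c, labelSeq T ζ z ∈ U c ↔ ξ (T^[K] z) = c := by
        intro c
        have := hcon c
        rw [Nat.add_sub_cancel' (hkK c)] at this
        tauto
      have h2 : ∃ c, labelSeq T ζ z ∈ U c := ⟨_, (h1 _).2 rfl⟩
      have h3 := (h1 _).1 h2.choose_spec
      refine hz ?_
      simp only [Φ, pick]
      rw [dif_pos h2, ← h3]
    calc ν {z | ξ (T^[K] z) ≠ Φ (labelSeq T ζ z)}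
        ≤ ∑ c : Fin r, ν (symmDiff (T^[k c + (K - k c)] ⁻¹' (ξ ⁻¹' {c})) (labelSeq T ζ ⁻¹' U c)) :=
          (measure_mono hsub).trans (measure_iUnion_fintype_le _ _)
      _ ≤ ∑ _c : Fin r, ε / r := Finset.sum_le_sum fun c _ => hUle c
      _ = ε := by
          rw [Finset.sum_const, Finset.card_univ, Fintype.card_fin, nsmul_eq_mul,
            ENNReal.mul_div_cancel hr (ENNReal.natCast_ne_top r)]

end Window

/-! ### An upper bound for the entropy from a reference measure on label sequences -/

section GibbsInequality

/-- Gibbs' inequality; a subprobability vector `q` suffices. -/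
lemma sum_negMulLog_le_of_sum_le_one {ι : Type*} [Fintype ι] {p q : ι → ℝ} (hp : ∀ a, 0 ≤ p a)
    (hp1 : ∑ a, p a = 1) (hq : ∀ a, 0 < q a) (hq1 : ∑ a, q a ≤ 1) :
    ∑ a, Real.negMulLog (p a) ≤ ∑ a, p a * (-Real.log (q a)) := by
  have h : ∑ a, Real.negMulLog (p a) ≤ ∑ a, (p a * (-Real.log (q a)) + (q a - p a)) :=
    Finset.sum_le_sum fun a _ => by
      have := negMulLog_le_tangent (hp a) (hq a)
      linarith
  rw [Finset.sum_add_distrib, Finset.sum_sub_distrib] at h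
  linarith

variable {X : Type*} [MeasurableSpace X] {ν : Measure X} [IsProbabilityMeasure ν]

lemma partitionEntropy_le_integral_neg_log {ι : Type*} [Fintype ι] [MeasurableSpace ι]
    [MeasurableSingletonClass ι] {Y : X → ι} (hY : Measurable Y) {q : ι → ℝ}
    (hq : ∀ a, 0 < q a) (hq1 : ∑ a, q a ≤ 1) :
    partitionEntropy ν Y ≤ ∫ z, -Real.log (q (Y z)) ∂ν := by
  have hYm : ∀ a, MeasurableSet (Y ⁻¹' {a}) := fun a => hY (measurableSet_singleton a)
  have hreal : ∀ a, (ν.map Y).real {a} = ν.real (Y ⁻¹' {a}) := fun a => by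
    rw [map_measureReal_apply hY (measurableSet_singleton a)]
  have : IsProbabilityMeasure (ν.map Y) := Measure.isProbabilityMeasure_map hY.aemeasurable
  have h1 : ∫ z, -Real.log (q (Y z)) ∂ν = ∑ a, ν.real (Y ⁻¹' {a}) * (-Real.log (q a)) := by
    have h2 : ∫ a, -Real.log (q a) ∂(ν.map Y) = ∫ z, -Real.log (q (Y z)) ∂ν :=
      integral_map hY.aemeasurable (measurable_of_finite _).aestronglyMeasurable
    rw [← h2, integral_fintype (Integrable.of_finite)]
    simp only [hreal, smul_eq_mul]
  rw [h1]
  refine sum_negMulLog_le_of_sum_le_one (fun a => measureReal_nonneg) ?_ hq hq1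
  simp only [← hreal]
  have := integral_fintype (μ := ν.map Y) (f := fun _ => (1 : ℝ)) Integrable.of_finite
  simp

/-- If label sequences have large weight for the reference measure `κ`, then a partition which is
approximated by a window of labels has small entropy. -/
lemma partitionEntropy_le_of_window {T : X → X} (hT : MeasurePreserving T ν ν) {ζ : X → ℕ}
    (hζ : Measurable ζ) {r : ℕ} [NeZero r] {ξ : X → Fin r} (hξ : Measurable ξ)
    {κ : Measure (ℕ → ℕ)} [IsProbabilityMeasure κ] {N n k L : ℕ} (hN : n + L ≤ N) {G : X → ℝ}
    (hG : Integrable G ν)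
    (hκ : ∀ᵐ z ∂ν, Real.exp (-G z) ≤ κ.real {a | ∀ i < N, a i = labelSeq T ζ z i})
    {Φ : (ℕ → ℕ) → Fin r} (hΦ : ∀ a b : ℕ → ℕ, (∀ j < L, a j = b j) → Φ a = Φ b)
    {δ ε : ℝ} (hδ0 : 0 < δ) (hδ1 : δ < 1)
    (hε : ν.real {z | ξ (T^[k] z) ≠ Φ (labelSeq T ζ z)} ≤ ε) :
    partitionEntropy ν (fun z => itinerary T ξ n (T^[k] z)) ≤
      ∫ z, G z ∂ν + n * (-Real.log (1 - δ) + ε * Real.log (r / δ)) := by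
  have hr : (0 : ℝ) < r := by exact_mod_cast NeZero.pos r
  have hr1 : (1 : ℝ) ≤ r := by exact_mod_cast NeZero.one_le
  have hθ := measurable_labelSeq hT.measurable hζ
  have hΦm : Measurable Φ := measurable_of_window hΦ
  -- A noisy channel from the predicted symbol `b` to the actual symbol `a`: a correct guess costs
  -- `-log (1 - δ)`, a wrong one `log (r / δ)`.
  let w : Fin r → Fin r → ℝ := fun a b => if a = b then 1 - δ else δ / r
  have hw0 : ∀ a b, 0 < w a b := by
    intro a b
    simp only [w]
    split_ifs
    · linarith
    · positivity
  have hδr : δ / r ≤ 1 := by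
    rw [div_le_one hr]
    linarith
  have hw1 : ∀ a b, w a b ≤ 1 := by
    intro a b
    simp only [w]
    split_ifs
    · linarith
    · exact hδr
  have hwsum : ∀ b, ∑ a, w a b ≤ 1 := by
    intro b
    have h1 : ∀ a, w a b ≤ δ / r + if a = b then 1 - δ else 0 := by
      intro a
      simp only [w]
      split_ifs
      · have : 0 ≤ δ / r := by positivity
        linarith
      · simp
    refine (Finset.sum_le_sum fun a _ => h1 a).trans (le_of_eq ?_)
    rw [Finset.sum_add_distrib, Finset.sum_const, Finset.sum_ite_eq' Finset.univ b]
    simp only [Finset.card_univ, Fintype.card_fin, nsmul_eq_mul, Finset.mem_univ, if_true]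
    field_simp
    ring
  let v : (Fin n → Fin r) → (ℕ → ℕ) → ℝ := fun x a =>
    ∏ i : Fin n, w (x i) (Φ fun j => a (j + i))
  have hv0 : ∀ x a, 0 < v x a := fun x a => Finset.prod_pos fun i _ => hw0 _ _
  have hv1 : ∀ x a, v x a ≤ 1 := fun x a =>
    Finset.prod_le_one (fun i _ => (hw0 _ _).le) fun i _ => hw1 _ _
  have hshift : ∀ i : ℕ, Measurable fun (a : ℕ → ℕ) (j : ℕ) => a (j + i) := fun i =>
    measurable_pi_lambda _ fun j => measurable_pi_apply _
  have hvm : ∀ x, Measurable (v x) := fun x => Finset.measurable_prod _ fun i _ =>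
    (measurable_of_finite (w (x i))).comp (hΦm.comp (hshift i))
  have hvint : ∀ x, Integrable (v x) κ := fun x =>
    Integrable.of_bound (hvm x).aestronglyMeasurable 1 (ae_of_all _ fun a => by
      rw [Real.norm_of_nonneg (hv0 x a).le]; exact hv1 x a)
  have hvsum : ∀ a, ∑ x, v x a ≤ 1 := by
    intro a
    have h1 : ∏ i : Fin n, ∑ c, w c (Φ fun j => a (j + i)) = ∑ x, v x a := by
      rw [Finset.prod_univ_sum]
      simp [v]
    rw [← h1]
    exact Finset.prod_le_one (fun i _ => Finset.sum_nonneg fun c _ => (hw0 _ _).le)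
      fun i _ => hwsum _
  -- The reference weights for words: draw labels from `κ`, predict by `Φ`, and pass the prediction
  -- through the channel.
  let q : (Fin n → Fin r) → ℝ := fun x => ∫ a, v x a ∂κ
  have hq0 : ∀ x, 0 < q x := by
    intro x
    refine (integral_pos_iff_support_of_nonneg (fun a => (hv0 x a).le) (hvint x)).2 ?_
    have : Function.support (v x) = univ := by
      ext a
      simp [(hv0 x a).ne']
    rw [this]
    simp
  have hq1 : ∑ x, q x ≤ 1 := by
    simp only [q]
    rw [← integral_finsetSum _ fun x _ => hvint x]
    calc ∫ a, ∑ x, v x a ∂κ ≤ ∫ _, (1 : ℝ) ∂κ :=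
          integral_mono (integrable_finsetSum _ fun x _ => hvint x) (integrable_const _) hvsum
      _ = 1 := by simp
  have hYm : Measurable fun z => itinerary T ξ n (T^[k] z) :=
    (measurable_itinerary hT.measurable hξ n).comp (hT.measurable.iterate k)
  set bad : Set X := {z | ξ (T^[k] z) ≠ Φ (labelSeq T ζ z)} with hbad
  have hbadm : MeasurableSet bad := by
    have h1 : Measurable fun z => ξ (T^[k] z) := hξ.comp (hT.measurable.iterate k)
    have h2 : Measurable fun z => Φ (labelSeq T ζ z) := hΦm.comp hθ
    exact (measurableSet_eq_fun h1 h2).compl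
  have hlogr : 0 ≤ Real.log (r / δ) := Real.log_nonneg (by
    rw [le_div_iff₀ hδ0]
    linarith)
  let Q : X → ℝ := fun z => G z + ∑ i : Fin n,
    (-Real.log (1 - δ) + (T^[i] ⁻¹' bad).indicator (fun _ => Real.log (r / δ)) z)
  have hindint : ∀ i : ℕ, Integrable ((T^[i] ⁻¹' bad).indicator fun _ => Real.log (r / δ)) ν :=
    fun i => (integrable_const _).indicator ((hT.measurable.iterate i) hbadm)
  have hQint : Integrable Q ν :=
    hG.add (integrable_finsetSum _ fun i _ => (integrable_const _).add (hindint i))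
  have hle : ∀ᵐ z ∂ν, -Real.log (q (itinerary T ξ n (T^[k] z))) ≤ Q z := by
    filter_upwards [hκ] with z hz
    set x := itinerary T ξ n (T^[k] z) with hx
    set A : Set (ℕ → ℕ) := {a | ∀ i < N, a i = labelSeq T ζ z i} with hA
    have hAm : MeasurableSet A := by
      have : A = ⋂ i, ⋂ (_ : i < N), {a | a i = labelSeq T ζ z i} := by
        ext a; simp [hA]
      rw [this]
      exact MeasurableSet.iInter fun i => MeasurableSet.iInter fun _ =>
        (measurable_pi_apply i) (measurableSet_singleton _)
    have hvA : ∀ a ∈ A, v x a = v x (labelSeq T ζ z) := by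
      intro a ha
      refine Finset.prod_congr rfl fun i _ => ?_
      rw [hΦ (fun j => a (j + i)) (fun j => labelSeq T ζ z (j + i)) fun j hj => ha _ (by
        have := i.2
        omega)]
    -- Keep only the label sequences that agree with that of `z` up to `N`. All windows used by `v
    -- x` lie below `n + L ≤ N`, so `v x` is constant on this cylinder, whose `κ`-measure is bounded
    -- below.
    have hqge : Real.exp (-G z) * v x (labelSeq T ζ z) ≤ q x := by
      calc Real.exp (-G z) * v x (labelSeq T ζ z) ≤ κ.real A * v x (labelSeq T ζ z) := by
            have := (hv0 x (labelSeq T ζ z)).le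
            gcongr
        _ = ∫ a in A, v x a ∂κ := by
            rw [setIntegral_congr_fun hAm hvA, setIntegral_const, smul_eq_mul]
        _ ≤ q x := setIntegral_le_integral (hvint x) (ae_of_all _ fun a => (hv0 x a).le)
    have hvz := hv0 x (labelSeq T ζ z)
    have h1 := Real.log_le_log (mul_pos (Real.exp_pos _) hvz) hqge
    rw [Real.log_mul (Real.exp_pos _).ne' hvz.ne', Real.log_exp] at h1
    have h2 : Real.log (v x (labelSeq T ζ z)) =
        ∑ i : Fin n, Real.log (w (x i) (Φ fun j => labelSeq T ζ z (j + i))) :=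
      Real.log_prod fun i _ => (hw0 _ _).ne'
    have h3 : ∀ i : Fin n, -Real.log (w (x i) (Φ fun j => labelSeq T ζ z (j + i))) ≤
        -Real.log (1 - δ) + (T^[i] ⁻¹' bad).indicator (fun _ => Real.log (r / δ)) z := by
      intro i
      -- The `i`-th symbol is mispredicted exactly when `T^[i] z` lies in `bad`; by invariance each
      -- time has the same error probability.
      have hxi : x i = ξ (T^[k] (T^[i] z)) := by
        simp only [hx, itinerary]
        rw [← Function.iterate_add_apply, ← Function.iterate_add_apply, add_comm]
      rw [← labelSeq_iterate, hxi]
      have h1d : 0 ≤ -Real.log (1 - δ) :=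
        neg_nonneg.2 (Real.log_nonpos (by linarith) (by linarith))
      by_cases hb : T^[i] z ∈ bad
      · have hb' : ξ (T^[k] (T^[i] z)) ≠ Φ (labelSeq T ζ (T^[i] z)) := hb
        rw [indicator_of_mem (by exact hb)]
        simp only [w, if_neg hb']
        rw [← Real.log_inv, inv_div]
        linarith
      · have hb' : ξ (T^[k] (T^[i] z)) = Φ (labelSeq T ζ (T^[i] z)) := by
          by_contra h
          exact hb h
        rw [indicator_of_notMem (by exact hb)]
        simp only [w, if_pos hb', add_zero, le_refl]
    have h4 : -Real.log (v x (labelSeq T ζ z)) ≤ ∑ i : Fin n,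
        (-Real.log (1 - δ) + (T^[i] ⁻¹' bad).indicator (fun _ => Real.log (r / δ)) z) := by
      rw [h2, ← Finset.sum_neg_distrib]
      exact Finset.sum_le_sum fun i _ => h3 i
    simp only [Q]
    linarith
  have hlhs : Integrable (fun z => -Real.log (q (itinerary T ξ n (T^[k] z)))) ν := by
    have : Measurable fun x => -Real.log (q x) := measurable_of_finite _
    obtain ⟨B, hB⟩ := (Set.finite_range fun x => ‖-Real.log (q x)‖).bddAbove
    exact Integrable.of_bound (this.comp hYm).aestronglyMeasurable B
      (ae_of_all _ fun z => hB (mem_range_self _))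
  refine (partitionEntropy_le_integral_neg_log hYm hq0 hq1).trans
    ((integral_mono_ae hlhs hQint hle).trans ?_)
  simp only [Q]
  have hterm : ∀ i : Fin n, Integrable (fun z => -Real.log (1 - δ) +
      (T^[i] ⁻¹' bad).indicator (fun _ => Real.log (r / δ)) z) ν :=
    fun i => (integrable_const _).add (hindint i)
  have hsumint : Integrable (fun z => ∑ i : Fin n, (-Real.log (1 - δ) +
      (T^[i] ⁻¹' bad).indicator (fun _ => Real.log (r / δ)) z)) ν :=
    integrable_finsetSum _ fun i _ => hterm i
  rw [integral_add hG hsumint, integral_finsetSum _ fun i _ => hterm i]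
  gcongr
  have h5 : ∀ i : Fin n, ∫ z, (-Real.log (1 - δ) +
      (T^[i] ⁻¹' bad).indicator (fun _ => Real.log (r / δ)) z) ∂ν ≤
      -Real.log (1 - δ) + ε * Real.log (r / δ) := by
    intro i
    rw [integral_add (integrable_const _) (hindint i), integral_const,
      integral_indicator ((hT.measurable.iterate i) hbadm), setIntegral_const]
    have h6 : ν.real (T^[i] ⁻¹' bad) = ν.real bad := by
      rw [Measure.real, Measure.real, (hT.iterate i).measure_preimage hbadm.nullMeasurableSet]
    rw [h6]
    simp only [probReal_univ, one_mul, smul_eq_mul]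
    gcongr
  refine (Finset.sum_le_sum fun i _ => h5 i).trans (le_of_eq ?_)
  rw [Finset.sum_const, Finset.card_univ, Fintype.card_fin, nsmul_eq_mul]

end GibbsInequality

/-! ### The entropy of a map given by a tower -/

section TowerEntropy

variable {M : Type*} [MeasurableSpace M] {F : M → M} {idx : M → ℕ} {ρ : ℕ → ℕ}

/-- Apply the nonnegative formula `lintegral_towerMeasure` to the positive and the negative part. -/
lemma integrable_and_integral_towerMeasure {R : M → ℕ} {ν₀ : Measure M} (hR : Measurable R)
    {g : M × ℕ → ℝ} (hg : Measurable g) (hgi : Integrable g (towerMeasure R ν₀)) :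
    Integrable (fun x => ∑ l ∈ Finset.range (R x), g (x, l)) ν₀ ∧
      ∫ z, g z ∂towerMeasure R ν₀ = ∫ x, ∑ l ∈ Finset.range (R x), g (x, l) ∂ν₀ := by
  have key : ∀ h : M × ℕ → ℝ, Measurable h → (∀ z, 0 ≤ h z) → Integrable h (towerMeasure R ν₀) →
      Integrable (fun x => ∑ l ∈ Finset.range (R x), h (x, l)) ν₀ ∧
        ∫ z, h z ∂towerMeasure R ν₀ = ∫ x, ∑ l ∈ Finset.range (R x), h (x, l) ∂ν₀ := by
    intro h hh h0 hi
    have hm : Measurable fun x => ∑ l ∈ Finset.range (R x), h (x, l) := by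
      have h1 : Measurable fun p : M × ℕ => ∑ l ∈ Finset.range p.2, h (p.1, l) :=
        measurable_from_prod_countable_left fun k =>
          Finset.measurable_sum (Finset.range k) (f := fun l x => h (x, l)) fun l _ =>
            hh.comp measurable_prodMk_right
      exact h1.comp (measurable_id.prodMk hR)
    have hs0 : ∀ x, 0 ≤ ∑ l ∈ Finset.range (R x), h (x, l) := fun x =>
      Finset.sum_nonneg fun l _ => h0 _
    have hl : ∫⁻ z, ENNReal.ofReal (h z) ∂towerMeasure R ν₀ =
        ∫⁻ x, ENNReal.ofReal (∑ l ∈ Finset.range (R x), h (x, l)) ∂ν₀ := by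
      rw [lintegral_towerMeasure hR (g := fun z => ENNReal.ofReal (h z)) hh.ennreal_ofReal]
      refine lintegral_congr fun x => ?_
      rw [ENNReal.ofReal_sum_of_nonneg fun l _ => h0 _]
    constructor
    · refine ⟨hm.aestronglyMeasurable, ?_⟩
      rw [hasFiniteIntegral_iff_ofReal (ae_of_all _ hs0), ← hl,
        ← hasFiniteIntegral_iff_ofReal (ae_of_all _ h0)]
      exact hi.2
    · rw [integral_eq_lintegral_of_nonneg_ae (ae_of_all _ h0) hh.aestronglyMeasurable,
        integral_eq_lintegral_of_nonneg_ae (ae_of_all _ hs0) hm.aestronglyMeasurable, hl]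
  obtain ⟨p1, p2⟩ := key (fun z => max (g z) 0) (hg.max measurable_const)
    (fun z => le_max_right _ _) hgi.pos_part
  obtain ⟨n1, n2⟩ := key (fun z => max (-g z) 0) (hg.neg.max measurable_const)
    (fun z => le_max_right _ _) hgi.neg_part
  have hsplit : ∀ z, g z = max (g z) 0 - max (-g z) 0 := fun z => by
    rcases le_total 0 (g z) with h | h
    · rw [max_eq_left h, max_eq_right (by linarith)]; ring
    · rw [max_eq_right h, max_eq_left (by linarith)]; ring
  have hsum : (fun x => ∑ l ∈ Finset.range (R x), g (x, l)) = fun x =>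
      ∑ l ∈ Finset.range (R x), max (g (x, l)) 0 - ∑ l ∈ Finset.range (R x), max (-g (x, l)) 0 := by
    funext x
    rw [← Finset.sum_sub_distrib]
    exact Finset.sum_congr rfl fun l _ => hsplit _
  rw [hsum]
  refine ⟨p1.sub n1, ?_⟩
  rw [integral_sub p1 n1, ← p2, ← n2, ← integral_sub hgi.pos_part hgi.neg_part]
  exact integral_congr_ae (ae_of_all _ hsplit)

lemma integrable_towerMeasure_iff {R : M → ℕ} {ν₀ : Measure M} (hR : Measurable R)
    {g : M × ℕ → ℝ} (hg : Measurable g) :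
    Integrable g (towerMeasure R ν₀) ↔
      ∫⁻ x, ∑ l ∈ Finset.range (R x), ‖g (x, l)‖ₑ ∂ν₀ < ⊤ := by
  rw [← lintegral_towerMeasure hR (g := fun z => ‖g z‖ₑ) hg.enorm]
  exact ⟨fun h => h.2, fun h => ⟨hg.aestronglyMeasurable, h⟩⟩

lemma map_towerMeasure {R : M → ℕ} {ν₀ : Measure M} {f : M → M} (hf : Measurable f) :
    (towerMeasure R ν₀).map (fun z : M × ℕ => f^[z.2] z.1) =
      Measure.sum fun l : ℕ => (ν₀.restrict {x | l < R x}).map f^[l] := by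
  have hpr : Measurable fun z : M × ℕ => f^[z.2] z.1 :=
    measurable_from_prod_countable_left fun l => hf.iterate l
  rw [towerMeasure, Measure.map_sum hpr.aemeasurable]
  congr 1
  funext l
  rw [Measure.map_map hpr measurable_prodMk_right]
  rfl

lemma measurable_towerLabel (hidx : Measurable idx) : Measurable (towerLabel idx) := by
  refine measurable_from_prod_countable_left fun l => ?_
  rcases eq_or_ne l 0 with rfl | h
  · simpa [towerLabel] using hidx.add_const 1
  · simp [towerLabel, h]

lemma measurable_towerLift {ψ : M → ℝ} (hψ : Measurable ψ) : Measurable (towerLift ψ) := by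
  refine measurable_from_prod_countable_left fun l => ?_
  rcases eq_or_ne l 0 with rfl | h
  · simpa [towerLift] using hψ
  · simp [towerLift, h]

lemma integrable_towerLift (hidx : Measurable idx) (hρ : ∀ n, 1 ≤ ρ n) {ψ : M → ℝ}
    (hψ : Measurable ψ) {ν₀ : Measure M} (hψi : Integrable ψ ν₀) :
    Integrable (towerLift ψ) (towerMeasure (fun x => ρ (idx x)) ν₀) ∧
      ∫ z, towerLift ψ z ∂towerMeasure (fun x => ρ (idx x)) ν₀ = ∫ x, ψ x ∂ν₀ := by
  have hR : Measurable fun x => ρ (idx x) := (measurable_of_countable ρ).comp hidx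
  have hmem : ∀ x, 0 ∈ Finset.range (ρ (idx x)) := fun x => Finset.mem_range.2 (hρ _)
  have hsum : ∀ x, ∑ l ∈ Finset.range (ρ (idx x)), towerLift ψ (x, l) = ψ x := fun x => by
    rw [Finset.sum_eq_single_of_mem 0 (hmem x)]
    · simp [towerLift]
    · intro l _ hl
      simp [towerLift, hl]
  have hsum' : ∀ x, ∑ l ∈ Finset.range (ρ (idx x)), ‖towerLift ψ (x, l)‖ₑ = ‖ψ x‖ₑ := fun x => by
    rw [Finset.sum_eq_single_of_mem 0 (hmem x)]
    · simp [towerLift]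
    · intro l _ hl
      simp [towerLift, hl]
  have hi : Integrable (towerLift ψ) (towerMeasure (fun x => ρ (idx x)) ν₀) := by
    rw [integrable_towerMeasure_iff hR (measurable_towerLift hψ)]
    simp only [hsum']
    exact hψi.2
  refine ⟨hi, ?_⟩
  rw [(integrable_and_integral_towerMeasure hR (measurable_towerLift hψ) hi).2]
  simp only [hsum]

/-! ### Labels generate the σ-algebra of the tower. -/

section Approximable

variable {ν₀ : Measure M} {ν : Measure (M × ℕ)} [IsFiniteMeasure ν]

/-- The index of the base point is its label. To read the index of a later return, split according
to the current index `c'` and move `ρ c'` steps ahead, which leads to the next base point. The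
approximable sets are closed under the operations of a σ-algebra, so generators suffice. -/
lemma isWindowApproximable_base (hρ : ∀ n, 1 ≤ ρ n) (hidx : Measurable idx)
    (hT : MeasurePreserving (towerMap F fun x => ρ (idx x)) ν ν) {B : Set M}
    (hB : MeasurableSet[MeasurableSpace.generateFrom
      {A : Set M | ∃ i c, A = {x | idx (F^[i] x) = c}}] B) :
    IsWindowApproximable (towerMap F fun x => ρ (idx x)) (towerLabel idx) ν
      {z | z.2 = 0 ∧ z.1 ∈ B} := by
  have hζ := measurable_towerLabel hidx
  set W := IsWindowApproximable (towerMap F fun x => ρ (idx x)) (towerLabel idx) ν with hW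
  have hbase : W {z : M × ℕ | z.2 = 0} := by
    have h1 : W (towerLabel idx ⁻¹' {0}) := IsWindowApproximable.label hζ 0
    have h2 : {z : M × ℕ | z.2 = 0} = (towerLabel idx ⁻¹' {0})ᶜ := by
      ext z
      by_cases h : z.2 = 0 <;> simp [towerLabel, h]
    rw [h2]
    exact IsWindowApproximable.compl h1
  induction B, hB using MeasurableSpace.generateFrom_induction with
  | hC A hA hA' =>
    clear hA'
    obtain ⟨i, c, rfl⟩ := hA
    induction i with
    | zero =>
      have h2 : {z : M × ℕ | z.2 = 0 ∧ z.1 ∈ {x | idx (F^[0] x) = c}} =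
          towerLabel idx ⁻¹' {c + 1} := by
        ext z
        by_cases h : z.2 = 0 <;> simp [towerLabel, h]
      rw [h2]
      exact IsWindowApproximable.label hζ _
    | succ i ih =>
      have h2 : {z : M × ℕ | z.2 = 0 ∧ z.1 ∈ {x | idx (F^[i + 1] x) = c}} =
          ⋃ c' : ℕ, (towerLabel idx ⁻¹' {c' + 1} ∩
            (towerMap F fun x => ρ (idx x))^[ρ c'] ⁻¹'
              {z | z.2 = 0 ∧ z.1 ∈ {x | idx (F^[i] x) = c}}) := by
        have hroof : ∀ x, (towerMap F fun x => ρ (idx x))^[ρ (idx x)] (x, 0) = (F x, 0) :=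
          fun x => towerMap_iterate_roof (F := F) (R := fun x => ρ (idx x)) (x := x) (l := 0)
            (hρ (idx x))
        ext ⟨x, l⟩
        simp only [mem_ofPred_eq, mem_iUnion, mem_inter_iff, mem_preimage, mem_singleton_iff]
        constructor
        · rintro ⟨rfl, h⟩
          refine ⟨idx x, by simp [towerLabel], ?_⟩
          rw [hroof]
          exact ⟨rfl, h⟩
        · rintro ⟨c', h1, h3⟩
          by_cases hl : l = 0
          · subst hl
            simp only [towerLabel, if_true, Nat.add_right_cancel_iff] at h1
            subst h1
            rw [hroof] at h3
            exact ⟨rfl, h3.2⟩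
          · simp [towerLabel, hl] at h1
      rw [h2]
      refine IsWindowApproximable.iUnion hT hζ fun c' => IsWindowApproximable.inter hT hζ ?_ ?_
      · exact IsWindowApproximable.label hζ _
      · exact IsWindowApproximable.preimage hT hζ ih _
  | empty =>
    have h2 : {z : M × ℕ | z.2 = 0 ∧ z.1 ∈ (∅ : Set M)} = {z | z.2 = 0} ∩ {z | z.2 = 0}ᶜ := by
      ext z
      simp
    rw [h2]
    exact hbase.inter hT hζ hbase.compl
  | compl A _ ih =>
    have h2 : {z : M × ℕ | z.2 = 0 ∧ z.1 ∈ Aᶜ} =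
        {z | z.2 = 0} ∩ {z : M × ℕ | z.2 = 0 ∧ z.1 ∈ A}ᶜ := by
      ext z
      simp only [mem_ofPred_eq, mem_inter_iff, mem_compl_iff]
      tauto
    rw [h2]
    exact hbase.inter hT hζ ih.compl
  | iUnion A _ ih =>
    have h2 : {z : M × ℕ | z.2 = 0 ∧ z.1 ∈ ⋃ n, A n} =
        ⋃ n, {z : M × ℕ | z.2 = 0 ∧ z.1 ∈ A n} := by
      ext z
      simp
    rw [h2]
    exact IsWindowApproximable.iUnion hT hζ ih

/-- If the index process generates mod 0, then every measurable subset of the tower is approximated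
by windows of labels. -/
lemma isWindowApproximable_tower (hρ : ∀ n, 1 ≤ ρ n) (hidx : Measurable idx) (hF : Measurable F)
    (hT : MeasurePreserving (towerMap F fun x => ρ (idx x)) ν ν)
    (hν : ν ≪ towerMeasure (fun x => ρ (idx x)) ν₀)
    (hgen : ∀ B, MeasurableSet B → ∃ B', MeasurableSet[MeasurableSpace.generateFrom
      {A : Set M | ∃ i c, A = {x | idx (F^[i] x) = c}}] B' ∧ B =ᵐ[ν₀] B')
    {E : Set (M × ℕ)} (hE : MeasurableSet E) :
    IsWindowApproximable (towerMap F fun x => ρ (idx x)) (towerLabel idx) ν E := by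
  have hζ := measurable_towerLabel hidx
  have hR : Measurable fun x => ρ (idx x) := (measurable_of_countable ρ).comp hidx
  have hsub : MeasurableSpace.generateFrom {A : Set M | ∃ i c, A = {x | idx (F^[i] x) = c}} ≤
      ‹MeasurableSpace M› := by
    refine MeasurableSpace.generateFrom_le ?_
    rintro A ⟨i, c, rfl⟩
    exact (hidx.comp (hF.iterate i)) (measurableSet_singleton c)
  have hlev : ∀ (l : ℕ) {B : Set M}, MeasurableSet B →
      MeasurableSet {z : M × ℕ | z.2 = l ∧ z.1 ∈ B} := fun l B hB =>
    (measurable_snd (measurableSet_singleton l)).inter (measurable_fst hB)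
  have hbase : ∀ B, MeasurableSet B → IsWindowApproximable (towerMap F fun x => ρ (idx x))
      (towerLabel idx) ν {z | z.2 = 0 ∧ z.1 ∈ B} := by
    intro B hB
    obtain ⟨B', hB', hBB'⟩ := hgen B hB
    refine (isWindowApproximable_base hρ hidx hT hB').congr_ae hT (hlev 0 hB) ?_
    have := hν.ae_le (ae_towerMeasure_of_ae hR hBB')
    filter_upwards [this] with z hz
    have h1 : (z.1 ∈ B) = (z.1 ∈ B') := hz.1
    change (z.2 = 0 ∧ z.1 ∈ B') = (z.2 = 0 ∧ z.1 ∈ B)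
    rw [h1]
  -- The preimage under `l` tower steps of a set at level `l` lies in the base, because a point at
  -- level `l` has spent its last `l` steps climbing.
  have hlevel : ∀ (l : ℕ) (B : Set M), MeasurableSet B →
      IsWindowApproximable (towerMap F fun x => ρ (idx x)) (towerLabel idx) ν
        {w : M × ℕ | w.2 = l ∧ w.1 ∈ B ∧ l < ρ (idx w.1)} := by
    intro l B hB
    have hBl : MeasurableSet (B ∩ {x | l < ρ (idx x)}) :=
      hB.inter (measurableSet_lt measurable_const hR)
    refine IsWindowApproximable.of_preimage (hlev l hBl) (j := l) ?_
    have h1 : (towerMap F fun x => ρ (idx x))^[l] ⁻¹'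
        {w : M × ℕ | w.2 = l ∧ w.1 ∈ B ∧ l < ρ (idx w.1)} =
        {w : M × ℕ | w.2 = 0 ∧ w.1 ∈ B ∩ {x | l < ρ (idx x)}} := by
      ext z
      exact towerMap_iterate_level_iff (R := fun x => ρ (idx x))
    have h2 := hbase _ hBl
    rw [← h1] at h2
    exact h2
  have hU := IsWindowApproximable.iUnion hT hζ fun l => hlevel l {x | (x, l) ∈ E}
    (measurable_prodMk_right hE)
  refine hU.congr_ae hT hE ?_
  have := hν.ae_le (ae_towerMeasure_of_ae (p := fun _ => True) hR (ae_of_all _ fun _ => trivial))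
  filter_upwards [this] with z hz
  refine propext ?_
  change z ∈ ⋃ l, {w : M × ℕ | w.2 = l ∧ w.1 ∈ {x | (x, l) ∈ E} ∧ l < ρ (idx w.1)} ↔ z ∈ E
  simp only [mem_iUnion, mem_ofPred_eq]
  constructor
  · rintro ⟨l, rfl, h, _⟩
    exact h
  · exact fun h => ⟨z.2, rfl, h, hz.2⟩

end Approximable

/-- A reference measure on label sequences built from the weights of cylinders of the base. -/
lemma exists_label_reference (hρ : ∀ n, 1 ≤ ρ n) (hidx : Measurable idx) {ν₀ m' : Measure M}
    [IsProbabilityMeasure m'] (hF : MeasurePreserving F ν₀ ν₀) {ψ : M → ℝ} {K : ℝ}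
    (hcyl : ∀ᵐ x ∂ν₀, ∀ j : ℕ, Real.exp (-K - ∑ i ∈ Finset.range j, ψ (F^[i] x)) ≤
      m'.real {y | ∀ i < j, idx (F^[i] y) = idx (F^[i] x)}) (N : ℕ) :
    ∃ κ : Measure (ℕ → ℕ), IsProbabilityMeasure κ ∧
      ∀ᵐ z ∂towerMeasure (fun x => ρ (idx x)) ν₀,
        Real.exp (-(Real.log (N + 1) + K + ∑ i ∈ Finset.range N,
          towerLift ψ ((towerMap F fun x => ρ (idx x))^[i] z))) ≤
        κ.real {a | ∀ i < N, a i = labelSeq (towerMap F fun x => ρ (idx x)) (towerLabel idx) z i} := by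
  have hR : Measurable fun x => ρ (idx x) := (measurable_of_countable ρ).comp hidx
  have hζ := measurable_towerLabel hidx
  have hTm := measurable_towerMap hF.measurable hR
  set T := towerMap F fun x => ρ (idx x) with hTdef
  -- The label sequence that shows `t` zeros before reaching the base at `y`. The waiting time is
  -- not known in advance, so the reference measure averages over `t ≤ N`, at the cost of the term
  -- `log (N + 1)`.
  let α : ℕ → M → ℕ → ℕ := fun t y i => if i < t then 0 else towerLabel idx (T^[i - t] (y, 0))
  have hα : ∀ t, Measurable (α t) := fun t => measurable_pi_lambda _ fun i => by
    by_cases h : i < t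
    · simp [α, h]
    · simp only [α, if_neg h]
      exact hζ.comp ((hTm.iterate (i - t)).comp measurable_prodMk_right)
  have hN0 : (N + 1 : ℝ≥0∞) ≠ 0 := by simp
  have hNt : (N + 1 : ℝ≥0∞) ≠ ⊤ := by finiteness
  refine ⟨(N + 1 : ℝ≥0∞)⁻¹ • ∑ t ∈ Finset.range (N + 1), m'.map (α t), ⟨?_⟩, ?_⟩
  · have h1 : ∀ t, m'.map (α t) univ = 1 := fun t => by
      rw [Measure.map_apply (hα t) MeasurableSet.univ, preimage_univ, measure_univ]
    rw [Measure.smul_apply, Measure.finsetSum_apply]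
    simp only [h1, Finset.sum_const, Finset.card_range, smul_eq_mul, nsmul_eq_mul, mul_one]
    push_cast
    exact ENNReal.inv_mul_cancel hN0 hNt
  -- The first base point on the orbit is either the foot of the column or its image under `F`, so
  -- the cylinder bound is needed at both.
  have hcylF := hF.quasiMeasurePreserving.ae hcyl
  filter_upwards [ae_towerMeasure_of_ae hR (hcyl.and hcylF)] with z hz
  obtain ⟨⟨hz1, hz2⟩, hzR⟩ := hz
  obtain ⟨t, htN, y, hy, hpre, hpost⟩ := exists_first_visit (F := F) (idx := idx)
    (R := fun x => ρ (idx x)) hzR N ψ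
  have hycyl : ∀ j : ℕ, Real.exp (-K - ∑ i ∈ Finset.range j, ψ (F^[i] y)) ≤
      m'.real {y' | ∀ i < j, idx (F^[i] y') = idx (F^[i] y)} := by
    rcases hy with rfl | rfl
    · exact hz1
    · exact hz2
  obtain ⟨j, hj1, hj2⟩ := exists_returns_determine_labels (F := F) (idx := idx) hρ ψ (N - t) y
  have hsum : ∑ i ∈ Finset.range N, towerLift ψ (T^[i] z) = ∑ i ∈ Finset.range j, ψ (F^[i] y) := by
    rw [← hj1]
    conv_lhs => rw [← Nat.add_sub_cancel' htN]
    rw [Finset.sum_range_add, Finset.sum_eq_zero fun i hi => (hpre i (Finset.mem_range.1 hi)).2,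
      zero_add]
    refine Finset.sum_congr rfl fun i hi => ?_
    rw [hpost i (by rw [Finset.mem_range] at hi; omega)]
  set A : Set (ℕ → ℕ) := {a | ∀ i < N, a i = labelSeq T (towerLabel idx) z i} with hA
  have hAm : MeasurableSet A := by
    have : A = ⋂ i, ⋂ (_ : i < N), {a | a i = labelSeq T (towerLabel idx) z i} := by
      ext a; simp [hA]
    rw [this]
    exact MeasurableSet.iInter fun i => MeasurableSet.iInter fun _ =>
      (measurable_pi_apply i) (measurableSet_singleton _)
  have hsubA : {y' | ∀ i < j, idx (F^[i] y') = idx (F^[i] y)} ⊆ α t ⁻¹' A := by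
    intro y' hy' i hi
    rcases lt_or_ge i t with h | h
    · simp only [α, if_pos h, labelSeq]
      exact (hpre i h).1.symm
    · obtain ⟨i', rfl⟩ := Nat.exists_eq_add_of_le h
      simp only [α, if_neg (not_lt.2 h), labelSeq]
      rw [hpost i' hi, Nat.add_sub_cancel_left]
      exact hj2 y' hy' i' (by omega)
  have hκ : (N + 1 : ℝ)⁻¹ * m'.real (α t ⁻¹' A) ≤
      ((N + 1 : ℝ≥0∞)⁻¹ • ∑ t ∈ Finset.range (N + 1), m'.map (α t)).real A := by
    rw [measureReal_ennreal_smul_apply, ENNReal.toReal_inv]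
    have h1 : ((N : ℝ≥0∞) + 1).toReal = N + 1 := by
      rw [ENNReal.toReal_add (by finiteness) (by finiteness)]
      simp
    rw [h1]
    gcongr
    rw [← map_measureReal_apply (hα t) hAm, Measure.real, Measure.real]
    refine ENNReal.toReal_mono ?_ ?_
    · rw [Measure.finsetSum_apply]
      refine ENNReal.sum_ne_top.2 fun i _ => ?_
      rw [Measure.map_apply (hα i) hAm]
      finiteness
    · rw [Measure.finsetSum_apply]
      exact Finset.single_le_sum (f := fun t => m'.map (α t) A) (fun _ _ => zero_le)
        (Finset.mem_range.2 (by omega))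
  refine le_trans ?_ hκ
  have hlog : Real.exp (-(Real.log (N + 1) + K + ∑ i ∈ Finset.range N, towerLift ψ (T^[i] z))) =
      (N + 1 : ℝ)⁻¹ * Real.exp (-K - ∑ i ∈ Finset.range j, ψ (F^[i] y)) := by
    rw [hsum, show -(Real.log (N + 1) + K + ∑ i ∈ Finset.range j, ψ (F^[i] y)) =
      -Real.log (N + 1) + (-K - ∑ i ∈ Finset.range j, ψ (F^[i] y)) by ring, Real.exp_add,
      Real.exp_neg, Real.exp_log (by positivity)]
  rw [hlog]
  gcongr
  exact (hycyl j).trans (measureReal_mono hsubA)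

/-- Divide by `n`: the logarithm is of smaller order. Concretely, with `t` half the gap, `log (t y)
≤ t y - 1` contradicts the hypothesis for large `n`. -/
lemma le_of_forall_nat_mul_le_log {a b c : ℝ} {L : ℕ}
    (h : ∀ n : ℕ, 1 ≤ n → n * a ≤ Real.log (n + L + 1) + c + n * b) : a ≤ b := by
  by_contra! hab
  obtain ⟨t, ht⟩ : ∃ t, t = (a - b) / 2 := ⟨_, rfl⟩
  have ht0 : 0 < t := by linarith
  obtain ⟨n, hn⟩ := exists_nat_gt (max 1 ((t * (L + 1) - 1 - Real.log t + c) / t))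
  have hn1 : 1 ≤ n := by exact_mod_cast ((le_max_left _ _).trans_lt hn).le
  have hn2 := (le_max_right _ _).trans_lt hn
  rw [div_lt_iff₀ ht0] at hn2
  have h1 := h n hn1
  have hy : (0 : ℝ) < n + L + 1 := by positivity
  have h2 := Real.log_le_sub_one_of_pos (mul_pos ht0 hy)
  rw [Real.log_mul ht0.ne' hy.ne'] at h2
  have h3 : a = b + 2 * t := by linarith
  rw [h3] at h1
  nlinarith

/-- An upper bound for the entropy of a factor of a system whose label sequences have large weight
for suitable reference measures. -/
theorem measureEntropy_le_of_label_reference {X : Type*} [MeasurableSpace X] {ν : Measure X}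
    [IsProbabilityMeasure ν] {T : X → X} (hT : MeasurePreserving T ν ν) {ζ : X → ℕ}
    (hζ : Measurable ζ) {μ : Measure M} [IsProbabilityMeasure μ] {f : M → M} (hf : Measurable f)
    {pr : X → M} (hprmp : MeasurePreserving pr ν μ) (hstep : ∀ᵐ z ∂ν, pr (T z) = f (pr z))
    (happ : ∀ E, MeasurableSet E → IsWindowApproximable T ζ ν E) {ψ : X → ℝ}
    (hψ : Integrable ψ ν) {K : ℝ}
    (href : ∀ N : ℕ, ∃ κ : Measure (ℕ → ℕ), IsProbabilityMeasure κ ∧ ∀ᵐ z ∂ν,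
      Real.exp (-(Real.log (N + 1) + K + ∑ i ∈ Finset.range N, ψ (T^[i] z))) ≤
        κ.real {a | ∀ i < N, a i = labelSeq T ζ z i}) :
    measureEntropy f μ ≤ ((∫ z, ψ z ∂ν : ℝ) : EReal) := by
  have hpr := hprmp.measurable
  have hequiv : ∀ᵐ z ∂ν, ∀ n, pr (T^[n] z) = f^[n] (pr z) := by
    have h1 : ∀ n : ℕ, ∀ᵐ z ∂ν, pr (T (T^[n] z)) = f (pr (T^[n] z)) := fun n => by
      have h2 := (hT.iterate n).quasiMeasurePreserving.ae hstep
      exact h2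
    filter_upwards [ae_all_iff.2 h1] with z hz n
    induction n with
    | zero => rfl
    | succ n ih => rw [Function.iterate_succ_apply', Function.iterate_succ_apply', hz, ih]
  -- Itineraries downstairs and upstairs have the same distribution, and invariance allows the start
  -- to be delayed by `k`, the iterate required by the window approximation.
  have hent : ∀ {r : ℕ} {ξ : M → Fin r}, Measurable ξ → ∀ n k : ℕ,
      partitionEntropy μ (itinerary f ξ n) =
        partitionEntropy ν (fun z => itinerary T (fun z => ξ (pr z)) n (T^[k] z)) := by
    intro r ξ hξ n k
    refine Finset.sum_congr rfl fun a _ => ?_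
    have hm1 : MeasurableSet (itinerary f ξ n ⁻¹' {a}) :=
      measurable_itinerary hf hξ n (measurableSet_singleton a)
    have hm2 : MeasurableSet (itinerary T (fun z => ξ (pr z)) n ⁻¹' {a}) :=
      measurable_itinerary hT.measurable (hξ.comp hpr) n (measurableSet_singleton a)
    congr 1
    have h3 : (pr ⁻¹' (itinerary f ξ n ⁻¹' {a}) : Set X) =ᵐ[ν]
        itinerary T (fun z => ξ (pr z)) n ⁻¹' {a} := by
      filter_upwards [hequiv] with z hz
      have : itinerary f ξ n (pr z) = itinerary T (fun z => ξ (pr z)) n z := by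
        funext i
        simp only [itinerary, hz]
      change (itinerary f ξ n (pr z) = a) = (itinerary T (fun z => ξ (pr z)) n z = a)
      rw [this]
    rw [Measure.real, Measure.real, ← hprmp.measure_preimage hm1.nullMeasurableSet, measure_congr h3,
      ← (hT.iterate k).measure_preimage hm2.nullMeasurableSet]
    rfl
  have hLiter : ∀ i : ℕ, Integrable (fun z => ψ (T^[i] z)) ν := fun i =>
    (hT.iterate i).integrable_comp_of_integrable hψ
  obtain ⟨a, ha⟩ : ∃ a, a = ∫ z, ψ z ∂ν := ⟨_, rfl⟩
  rw [← ha]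
  have hLa : ∀ i : ℕ, ∫ z, ψ (T^[i] z) ∂ν = a := by
    intro i
    have h1 := (hT.iterate i).map_eq
    rw [ha]
    conv_rhs => rw [← h1]
    rw [integral_map (hT.measurable.iterate i).aemeasurable (by rw [h1]; exact hψ.1)]
  refine iSup_le fun r => iSup_le fun ξ => iSup_le fun hξ => ?_
  rw [EReal.coe_le_coe_iff]
  have hr : NeZero r := by
    obtain ⟨x⟩ : Nonempty M := nonempty_of_isProbabilityMeasure μ
    exact ⟨fun h => by subst h; exact (ξ x).elim0⟩
  have hr1 : (1 : ℝ) ≤ r := by exact_mod_cast NeZero.one_le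
  refine le_of_forall_pos_le_add fun η hη => ?_
  -- The noise level makes `-log (1 - δ) = η / 2`. The error probability `ε` is chosen afterwards,
  -- so that mispredictions cost at most another `η / 2` per step.
  set δ := 1 - Real.exp (-(η / 2)) with hδ
  have hδ0 : 0 < δ := by
    have : Real.exp (-(η / 2)) < 1 := Real.exp_lt_one_iff.2 (by linarith)
    linarith
  have hδ1 : δ < 1 := by
    have := Real.exp_pos (-(η / 2))
    linarith
  have hlogr : 0 ≤ Real.log (r / δ) := Real.log_nonneg (by
    rw [le_div_iff₀ hδ0]
    linarith)
  set ε := η / 2 / (Real.log (r / δ) + 1) with hε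
  have hε0 : 0 < ε := by positivity
  have hεη : ε * Real.log (r / δ) ≤ η / 2 := by
    rw [hε, div_mul_eq_mul_div, div_le_iff₀ (by linarith)]
    nlinarith
  obtain ⟨k, L, Φ, hΦ, hΦε⟩ := exists_window_function hT hζ (ξ := fun z => ξ (pr z))
    (fun b => happ _
      ((hξ.comp hpr) (measurableSet_singleton b))) (ENNReal.ofReal_pos.2 hε0)
  -- Predicting `n` symbols takes `n + L` labels; the surplus `L * a` does not depend on `n`.
  refine le_of_forall_nat_mul_le_log (L := L) (c := K + L * a) fun n hn => ?_
  obtain ⟨κ, hκp, hκ⟩ := href (n + L)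
  have hsumint : Integrable (fun z => ∑ i ∈ Finset.range (n + L), ψ (T^[i] z)) ν :=
    integrable_finsetSum _ fun i _ => hLiter i
  have hb := partitionEntropy_le_of_window hT hζ (ξ := fun z => ξ (pr z)) (hξ.comp hpr) (κ := κ)
    (N := n + L) (n := n) (k := k) le_rfl
    (G := fun z => Real.log ((n + L : ℕ) + 1) + K +
      ∑ i ∈ Finset.range (n + L), ψ (T^[i] z))
    ((integrable_const _).add hsumint) hκ hΦ hδ0 hδ1
    (ENNReal.toReal_le_of_le_ofReal hε0.le hΦε)
  rw [← hent hξ, integral_add (integrable_const _) hsumint,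
    integral_finsetSum _ fun i _ => hLiter i] at hb
  simp only [hLa, integral_const, probReal_univ, one_smul, Finset.sum_const, Finset.card_range,
    nsmul_eq_mul] at hb
  have hlog1 : -Real.log (1 - δ) = η / 2 := by
    rw [hδ, sub_sub_cancel, Real.log_exp, neg_neg]
  rw [hlog1] at hb
  have hinf : entropyOfPartition f μ ξ ≤ partitionEntropy μ (itinerary f ξ n) / n := by
    obtain ⟨n', rfl⟩ : ∃ n', n = n' + 1 := ⟨n - 1, by omega⟩
    have hbdd : BddBelow (range fun n : ℕ =>
        partitionEntropy μ (itinerary f ξ (n + 1)) / ((n : ℝ) + 1)) := by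
      refine ⟨0, ?_⟩
      rintro _ ⟨q, rfl⟩
      have := partitionEntropy_nonneg μ (itinerary f ξ (q + 1))
      positivity
    have := ciInf_le hbdd n'
    push_cast
    exact this
  have hn0 : (0 : ℝ) < n := by exact_mod_cast hn
  rw [le_div_iff₀ hn0] at hinf
  push_cast at hb
  have hnε : (n : ℝ) * (ε * Real.log (r / δ)) ≤ n * (η / 2) := by gcongr
  nlinarith

/-- The entropy of a map given by a tower whose base map has cylinders of measure comparable with
the exponentials of the Birkhoff sums of `-ψ`. -/
theorem measureEntropy_le_of_tower (hρ : ∀ n, 1 ≤ ρ n) (hidx : Measurable idx) {f : M → M}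
    (hf : Measurable f) {ν₀ m' μ : Measure M} [IsProbabilityMeasure m'] [IsProbabilityMeasure μ]
    (hF : MeasurePreserving F ν₀ ν₀) (hFf : ∀ᵐ x ∂ν₀, F x = f^[ρ (idx x)] x) {c : ℝ≥0∞}
    (hμ : μ = c • Measure.sum fun l : ℕ => (ν₀.restrict {x | l < ρ (idx x)}).map f^[l])
    {ψ : M → ℝ} (hψ : Measurable ψ) (hψi : Integrable ψ ν₀) (hc : c ≠ ⊤) {K : ℝ}
    (hcyl : ∀ᵐ x ∂ν₀, ∀ j : ℕ, Real.exp (-K - ∑ i ∈ Finset.range j, ψ (F^[i] x)) ≤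
      m'.real {y | ∀ i < j, idx (F^[i] y) = idx (F^[i] x)})
    (hgen : ∀ B, MeasurableSet B → ∃ B', MeasurableSet[MeasurableSpace.generateFrom
      {A : Set M | ∃ i c, A = {x | idx (F^[i] x) = c}}] B' ∧ B =ᵐ[ν₀] B') :
    measureEntropy f μ ≤ ((c.toReal * ∫ x, ψ x ∂ν₀ : ℝ) : EReal) := by
  have hR : Measurable fun x => ρ (idx x) := (measurable_of_countable ρ).comp hidx
  have hζ := measurable_towerLabel hidx
  have hT0 := measurePreserving_towerMap hF hR fun x => hρ _
  set T := towerMap F fun x => ρ (idx x) with hTdef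
  set ν := c • towerMeasure (fun x => ρ (idx x)) ν₀ with hνdef
  have hνac : ν ≪ towerMeasure (fun x => ρ (idx x)) ν₀ := Measure.smul_absolutelyContinuous (c := c)
  have hT : MeasurePreserving T ν ν := hT0.smul_measure c
  let pr : M × ℕ → M := fun z => f^[z.2] z.1
  have hpr : Measurable pr := measurable_from_prod_countable_left fun l => hf.iterate l
  have hmap : ν.map pr = μ := by
    rw [hνdef, Measure.map_smul, map_towerMeasure hf, ← hμ]
  have hprmp : MeasurePreserving pr ν μ := ⟨hpr, hmap⟩
  have hνprob : IsProbabilityMeasure ν := by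
    constructor
    rw [← preimage_univ (f := pr), hprmp.measure_preimage MeasurableSet.univ.nullMeasurableSet,
      measure_univ]
  have hstep : ∀ᵐ z ∂ν, pr (T z) = f (pr z) := by
    filter_upwards [hνac.ae_le (ae_towerMeasure_of_ae hR hFf)] with z hz
    obtain ⟨x, l⟩ := z
    obtain ⟨h1, h2⟩ := hz
    simp only at h1 h2
    rcases lt_or_ge (l + 1) (ρ (idx x)) with h | h
    · rw [hTdef, towerMap_of_lt (R := fun x => ρ (idx x)) h]
      simp only [pr, Function.iterate_succ_apply']
    · rw [hTdef, towerMap_of_le (R := fun x => ρ (idx x)) h]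
      have : ρ (idx x) = l + 1 := by omega
      simp only [pr, Function.iterate_zero, id, h1, this, Function.iterate_succ_apply']
  obtain ⟨hLi, hLint⟩ := integrable_towerLift hidx hρ hψ hψi
  have hInt : c.toReal * ∫ x, ψ x ∂ν₀ = ∫ z, towerLift ψ z ∂ν := by
    rw [hνdef, integral_smul_measure, hLint, smul_eq_mul]
  rw [hInt]
  refine measureEntropy_le_of_label_reference hT hζ hf hprmp hstep
    (fun E hE => isWindowApproximable_tower hρ hidx hF.measurable hT hνac hgen hE)
    (hLi.smul_measure hc) (K := K) fun N => ?_
  obtain ⟨κ, hκp, hκ⟩ := exists_label_reference (F := F) hρ hidx hF hcyl N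
  exact ⟨κ, hκp, hνac.ae_le hκ⟩

end TowerEntropy

/-! ### Cylinders of Gibbs–Markov maps -/

section GibbsMarkov

variable {M : Type*}

/-- That the orbits do separate must be assumed, since `separationTime` takes the default value zero
otherwise. -/
lemma le_separationTime {F : M → M} {P : Set (Set M)} (hdisj : P.PairwiseDisjoint id) {x y : M}
    {w : ℕ → Set M} (hw : ∀ i, w i ∈ P) {n : ℕ} (hx : ∀ i < n, F^[i] x ∈ w i)
    (hy : ∀ i < n, F^[i] y ∈ w i)
    (hne : ∃ k, ∃ v ∈ P, ∃ v' ∈ P, v ≠ v' ∧ F^[k] x ∈ v ∧ F^[k] y ∈ v') :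
    n ≤ separationTime F P x y := by
  refine le_csInf hne ?_
  rintro k ⟨v, hv, v', hv', hvv, hxv, hyv⟩
  by_contra! hk
  have h1 : v = w k := hdisj.elim_set hv (hw k) _ hxv (hx k hk)
  have h2 : v' = w k := hdisj.elim_set hv' (hw k) _ hyv (hy k hk)
  exact hvv (h1.trans h2.symm)

/-- Bounded distortion on cylinders. -/
lemma sum_log_le_of_mem_cylinder {F : M → M} {P : Set (Set M)} (hdisj : P.PairwiseDisjoint id)
    {J : M → ℝ} (hJ0 : ∀ w ∈ P, ∀ x ∈ w, 0 < J x) {C β : ℝ} (hC : 0 < C) (hβ0 : 0 < β) (hβ1 : β < 1)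
    (hJ : ∀ w ∈ P, ∀ x ∈ w, ∀ y ∈ w,
      Real.log (J x / J y) ≤ C * β ^ separationTime F P (F x) (F y)) {Z : Set M}
    (hZ : ∀ A ∈ dynPartitionInfty F P, (A ∩ Z).Subsingleton) {x y : M} (hxZ : x ∈ Z) (hyZ : y ∈ Z)
    (hxP : ∀ i, F^[i] x ∈ ⋃₀ P) (hyP : ∀ i, F^[i] y ∈ ⋃₀ P) {w : ℕ → Set M} (hw : ∀ i, w i ∈ P)
    {n : ℕ} (hx : ∀ i < n, F^[i] x ∈ w i) (hy : ∀ i < n, F^[i] y ∈ w i) :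
    ∑ i ∈ Finset.range n, Real.log (J (F^[i] y)) ≤
      C / (1 - β) + ∑ i ∈ Finset.range n, Real.log (J (F^[i] x)) := by
  have hβ : 0 < 1 - β := by linarith
  rcases eq_or_ne x y with rfl | hxy
  · have : 0 < C / (1 - β) := div_pos hC hβ
    linarith
  choose v hv hxv using hxP
  choose v' hv' hyv using hyP
  -- Distinct points of `Z` cannot share all their partition elements, so the separation times below
  -- are genuine minima and not the default value.
  obtain ⟨k, hk⟩ : ∃ k, v k ≠ v' k := by
    by_contra! hcon
    refine hxy (hZ _ ⟨v, hv, rfl⟩ ⟨hxv, hxZ⟩ ⟨fun i => ?_, hyZ⟩)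
    rw [hcon]
    exact hyv i
  have hkn : n ≤ k := by
    by_contra! hkn
    exact hk ((hdisj.elim_set (hv k) (hw k) _ (hxv k) (hx k hkn)).trans
      (hdisj.elim_set (hv' k) (hw k) _ (hyv k) (hy k hkn)).symm)
  -- After `i + 1` steps the two points still share `n - 1 - i` partition elements. The resulting
  -- errors form a geometric series read backwards, with sum at most `C / (1 - β)`.
  have hterm : ∀ i ∈ Finset.range n, Real.log (J (F^[i] y)) - Real.log (J (F^[i] x)) ≤
      C * β ^ (n - 1 - i) := by
    intro i hi
    rw [Finset.mem_range] at hi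
    have h1 := hJ _ (hw i) _ (hy i hi) _ (hx i hi)
    rw [Real.log_div (hJ0 _ (hw i) _ (hy i hi)).ne' (hJ0 _ (hw i) _ (hx i hi)).ne'] at h1
    refine h1.trans ?_
    have hs : n - 1 - i ≤ separationTime F P (F (F^[i] y)) (F (F^[i] x)) := by
      refine le_separationTime hdisj (w := fun q => w (q + (i + 1))) (fun q => hw _)
        (fun q hq => ?_) (fun q hq => ?_) ⟨k - (i + 1), v' k, hv' k, v k, hv k, hk.symm, ?_, ?_⟩
      · rw [← Function.iterate_succ_apply' F i, ← Function.iterate_add_apply]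
        exact hy _ (by omega)
      · rw [← Function.iterate_succ_apply' F i, ← Function.iterate_add_apply]
        exact hx _ (by omega)
      · rw [← Function.iterate_succ_apply' F i, ← Function.iterate_add_apply,
          show k - (i + 1) + i.succ = k by omega]
        exact hyv k
      · rw [← Function.iterate_succ_apply' F i, ← Function.iterate_add_apply,
          show k - (i + 1) + i.succ = k by omega]
        exact hxv k
    have := pow_le_pow_of_le_one hβ0.le hβ1.le hs
    gcongr
  have hsum := Finset.sum_le_sum hterm
  rw [Finset.sum_sub_distrib, Finset.sum_range_reflect (fun i => C * β ^ i) n, ← Finset.mul_sum]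
    at hsum
  have hgeo : ∑ i ∈ Finset.range n, β ^ i ≤ 1 / (1 - β) := by
    rw [one_div, ← tsum_geometric_of_lt_one hβ0.le hβ1]
    exact (summable_geometric_of_lt_one hβ0.le hβ1).sum_le_tsum _ fun i _ => by positivity
  have h2 : C * ∑ i ∈ Finset.range n, β ^ i ≤ C * (1 / (1 - β)) := by gcongr
  rw [mul_one_div] at h2
  linarith

variable [MeasurableSpace M] {m : Measure M} {F : M → M} {Δ₀ : Set M} {P : Set (Set M)} {J : M → ℝ}

/-- Change of variables on an element of the partition. -/
lemma setLIntegral_mul_comp_eq (hF : Measurable F) {w : Set M}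
    (hFw : MapsTo F w Δ₀)
    (hmk : ∃ A ⊆ w, MeasurableSet A ∧ m (w \ A) = 0 ∧ InjOn F A ∧ m (Δ₀ \ F '' A) = 0)
    (hJm : Measurable J)
    (hJ : ∀ A ⊆ w, MeasurableSet A → m (F '' A) = ∫⁻ x in A, ENNReal.ofReal (J x) ∂m)
    {g : M → ℝ≥0∞} (hg : Measurable g) :
    ∫⁻ x in w, ENNReal.ofReal (J x) * g (F x) ∂m = ∫⁻ x in Δ₀, g x ∂m := by
  obtain ⟨A, hAw, hA, hwA, -, hcov⟩ := hmk
  have hJm' : Measurable fun x => ENNReal.ofReal (J x) := hJm.ennreal_ofReal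
  have hmap : ((m.restrict w).withDensity fun x => ENNReal.ofReal (J x)).map F =
      m.restrict Δ₀ := by
    ext B hB
    have hres : m.restrict w = m.restrict A := by
      refine Measure.restrict_congr_set ?_
      rw [ae_eq_set]
      exact ⟨hwA, by rw [sdiff_eq_empty.2 hAw, measure_empty]⟩
    rw [Measure.map_apply hF hB, hres, withDensity_apply _ (hF hB),
      Measure.restrict_restrict (hF hB), inter_comm,
      ← hJ _ (inter_subset_left.trans hAw) (hA.inter (hF hB)), image_inter_preimage,
      Measure.restrict_apply hB]
    refine measure_congr ?_
    have h1 : (F '' A : Set M) =ᵐ[m] Δ₀ := by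
      rw [ae_eq_set]
      refine ⟨?_, hcov⟩
      rw [sdiff_eq_empty.2 ((image_mono hAw).trans hFw.image_subset), measure_empty]
    rw [inter_comm B]
    exact h1.inter (ae_eq_refl B)
  have h2 := lintegral_withDensity_eq_lintegral_mul (m.restrict w) hJm' (hg.comp hF)
  rw [← hmap, lintegral_map hg hF]
  exact h2.symm

/-- The standing assumptions on a Gibbs–Markov map and its Jacobian. -/
structure IsMarkovJacobian (m : Measure M) (F : M → M) (Δ₀ : Set M) (P : Set (Set M))
    (J : M → ℝ) : Prop where
  measurableSet_base : MeasurableSet Δ₀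
  measurable_map : Measurable F
  countable : P.Countable
  measurableSet : ∀ w ∈ P, MeasurableSet w
  subset : ∀ w ∈ P, w ⊆ Δ₀
  cover : m (Δ₀ \ ⋃₀ P) = 0
  measurable : Measurable J
  pos : ∀ x ∈ Δ₀, 0 < J x
  setLIntegral : ∀ w ∈ P, ∀ g : M → ℝ≥0∞, Measurable g →
    ∫⁻ x in w, ENNReal.ofReal (J x) * g (F x) ∂m = ∫⁻ x in Δ₀, g x ∂m

namespace IsMarkovJacobian

/-- On each partition element the integral of `J` over the preimage of a null set vanishes; as `J >
0`, the preimage is null there, and there are only countably many elements. -/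
lemma quasiMeasurePreserving (h : IsMarkovJacobian m F Δ₀ P J) :
    Measure.QuasiMeasurePreserving F (m.restrict Δ₀) (m.restrict Δ₀) := by
  refine ⟨h.measurable_map, Measure.AbsolutelyContinuous.mk fun B hB hB0 => ?_⟩
  rw [Measure.map_apply h.measurable_map hB, Measure.restrict_apply (h.measurable_map hB)]
  have hw0 : ∀ w ∈ P, m (w ∩ F ⁻¹' B) = 0 := by
    intro w hw
    have h1 := h.setLIntegral w hw (B.indicator 1) (measurable_one.indicator hB)
    have hm : Measurable fun x => ENNReal.ofReal (J x) * B.indicator 1 (F x) :=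
      h.measurable.ennreal_ofReal.mul ((measurable_one.indicator hB).comp h.measurable_map)
    rw [lintegral_indicator_one hB, hB0, lintegral_eq_zero_iff hm] at h1
    have h2 := (ae_restrict_iff' (h.measurableSet w hw)).1 h1
    refine measure_mono_null ?_ h2
    rintro x ⟨hxw, hxB⟩ hx
    have h3 := hx hxw
    have h4 : F x ∈ B := hxB
    have h5 := h.pos x (h.subset w hw hxw)
    simp only [indicator_of_mem h4, Pi.one_apply, mul_one, Pi.zero_apply,
      ENNReal.ofReal_eq_zero] at h3
    exact absurd h3 (not_le.2 h5)
  have hsub : F ⁻¹' B ∩ Δ₀ ⊆ (Δ₀ \ ⋃₀ P) ∪ ⋃ w ∈ P, w ∩ F ⁻¹' B := by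
    rintro x ⟨hxB, hxΔ⟩
    by_cases hx : x ∈ ⋃₀ P
    · obtain ⟨w, hw, hxw⟩ := hx
      exact Or.inr (mem_biUnion hw ⟨hxw, hxB⟩)
    · exact Or.inl ⟨hxΔ, hx⟩
  refine measure_mono_null hsub (measure_union_null h.cover ?_)
  exact (measure_biUnion_null_iff h.countable).2 hw0

lemma ae_iterate_mem (h : IsMarkovJacobian m F Δ₀ P J) :
    ∀ᵐ x ∂m.restrict Δ₀, ∀ i, F^[i] x ∈ ⋃₀ P := by
  have h0 : ∀ᵐ x ∂m.restrict Δ₀, x ∈ ⋃₀ P := by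
    rw [ae_restrict_iff' h.measurableSet_base]
    refine measure_mono_null (fun x hx => ?_) h.cover
    rw [mem_compl_iff, mem_ofPred_eq, Classical.not_imp] at hx
    exact hx
  exact ae_all_iff.2 fun i => (h.quasiMeasurePreserving.iterate i).ae h0

/-- The integral over a cylinder of the Jacobian of the corresponding iterate. -/
lemma lintegral_cylinder (h : IsMarkovJacobian m F Δ₀ P J) (n : ℕ) (w : ℕ → Set M)
    (hw : ∀ i, w i ∈ P) :
    ∫⁻ x in Δ₀, {x | ∀ i < n, F^[i] x ∈ w i}.indicator
      (fun x => ∏ i ∈ Finset.range n, ENNReal.ofReal (J (F^[i] x))) x ∂m = m Δ₀ := by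
  induction n generalizing w with
  | zero => simp
  | succ n ih =>
    have hcyl : ∀ (k : ℕ) (w : ℕ → Set M), (∀ i, w i ∈ P) →
        MeasurableSet {x | ∀ i < k, F^[i] x ∈ w i} := by
      intro k w hw
      have : {x | ∀ i < k, F^[i] x ∈ w i} = ⋂ i, ⋂ (_ : i < k), F^[i] ⁻¹' w i := by
        ext; simp
      rw [this]
      exact MeasurableSet.iInter fun i => MeasurableSet.iInter fun _ =>
        (h.measurable_map.iterate i) (h.measurableSet _ (hw i))
    have hprod : ∀ k : ℕ, Measurable fun x => ∏ i ∈ Finset.range k, ENNReal.ofReal (J (F^[i] x)) :=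
      fun k => Finset.measurable_prod _ fun i _ =>
        (h.measurable.comp (h.measurable_map.iterate i)).ennreal_ofReal
    have h1 := ih (fun i => w (i + 1)) fun i => hw _
    -- The full branch over `w 0` pulls the shifted cylinder of length `n` back to the cylinder of
    -- length `n + 1` and supplies the extra factor `J`.
    rw [← h.setLIntegral (w 0) (hw 0) _ ((hprod n).indicator (hcyl n _ fun i => hw (i + 1)))] at h1
    rw [← h1, ← lintegral_indicator h.measurableSet_base,
      ← lintegral_indicator (h.measurableSet _ (hw 0))]
    refine lintegral_congr fun x => ?_
    by_cases hx0 : x ∈ w 0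
    · rw [indicator_of_mem (h.subset _ (hw 0) hx0), indicator_of_mem hx0]
      have hiff : x ∈ {x | ∀ i < n + 1, F^[i] x ∈ w i} ↔
          F x ∈ {x | ∀ i < n, F^[i] x ∈ w (i + 1)} := by
        constructor
        · intro hx i hi
          exact hx (i + 1) (by omega)
        · intro hx i hi
          rcases i with _ | i
          · exact hx0
          · exact hx i (by omega)
      by_cases hx : x ∈ {x | ∀ i < n + 1, F^[i] x ∈ w i}
      · rw [indicator_of_mem hx, indicator_of_mem (hiff.1 hx), Finset.prod_range_succ', mul_comm]
        rfl
      · rw [indicator_of_notMem hx, indicator_of_notMem (mt hiff.2 hx), mul_zero]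
    · have hx : x ∉ {x | ∀ i < n + 1, F^[i] x ∈ w i} := fun hx => hx0 (hx 0 n.succ_pos)
      rw [indicator_of_notMem hx0]
      by_cases hxΔ : x ∈ Δ₀
      · rw [indicator_of_mem hxΔ, indicator_of_notMem hx]
      · rw [indicator_of_notMem hxΔ]

/-- Lower bound for the measure of cylinders of a Gibbs–Markov map. -/
lemma exists_le_measure_cylinder (h : IsMarkovJacobian m F Δ₀ P J) (hfin : m Δ₀ ≠ ⊤)
    (hdisj : P.PairwiseDisjoint id) {C β : ℝ} (hC : 0 < C) (hβ0 : 0 < β) (hβ1 : β < 1)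
    (hJ : ∀ w ∈ P, ∀ x ∈ w, ∀ y ∈ w,
      Real.log (J x / J y) ≤ C * β ^ separationTime F P (F x) (F y)) {Z : Set M}
    (hZ0 : m (Δ₀ \ Z) = 0) (hZ : ∀ A ∈ dynPartitionInfty F P, (A ∩ Z).Subsingleton) :
    ∃ K : ℝ, ∀ᵐ x ∂m.restrict Δ₀, ∀ w : ℕ → Set M, (∀ i, w i ∈ P) → ∀ n : ℕ,
      (∀ i < n, F^[i] x ∈ w i) →
      m.real Δ₀ * Real.exp (-K - ∑ i ∈ Finset.range n, Real.log (J (F^[i] x))) ≤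
        m.real (Δ₀ ∩ {y | ∀ i < n, F^[i] y ∈ w i}) := by
  have hZae : ∀ᵐ x ∂m.restrict Δ₀, x ∈ Z := by
    rw [ae_restrict_iff' h.measurableSet_base]
    refine measure_mono_null (fun x hx => ?_) hZ0
    rw [mem_compl_iff, mem_ofPred_eq, Classical.not_imp] at hx
    exact hx
  have hJ0 : ∀ w ∈ P, ∀ x ∈ w, 0 < J x := fun w hw x hx => h.pos x (h.subset w hw hx)
  refine ⟨C / (1 - β), ?_⟩
  filter_upwards [hZae, h.ae_iterate_mem] with x hxZ hxP w hw n hx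
  set E : Set M := {y | ∀ i < n, F^[i] y ∈ w i} with hE
  have hEm : MeasurableSet E := by
    have : E = ⋂ i, ⋂ (_ : i < n), F^[i] ⁻¹' w i := by
      ext; simp [hE]
    rw [this]
    exact MeasurableSet.iInter fun i => MeasurableSet.iInter fun _ =>
      (h.measurable_map.iterate i) (h.measurableSet _ (hw i))
  set S := ∑ i ∈ Finset.range n, Real.log (J (F^[i] x)) with hS
  have hprod : ∀ y ∈ E, ∏ i ∈ Finset.range n, ENNReal.ofReal (J (F^[i] y)) =
      ENNReal.ofReal (Real.exp (∑ i ∈ Finset.range n, Real.log (J (F^[i] y)))) := by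
    intro y hy
    rw [Real.exp_sum, ENNReal.ofReal_prod_of_nonneg fun i _ => (Real.exp_pos _).le]
    refine Finset.prod_congr rfl fun i hi => ?_
    rw [Real.exp_log (hJ0 _ (hw i) _ (hy i (Finset.mem_range.1 hi)))]
  -- The cylinder is mapped onto the whole base, so the Jacobian of the iterate integrates over it
  -- to `m Δ₀`; by bounded distortion that Jacobian is almost everywhere at most `exp (C / (1 - β) +
  -- S)`.
  have hle : m Δ₀ ≤ ENNReal.ofReal (Real.exp (C / (1 - β) + S)) * m (Δ₀ ∩ E) := by
    rw [← h.lintegral_cylinder n w hw]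
    calc _ ≤ ∫⁻ y in Δ₀, E.indicator
          (fun _ => ENNReal.ofReal (Real.exp (C / (1 - β) + S))) y ∂m := by
          refine lintegral_mono_ae ?_
          filter_upwards [hZae, h.ae_iterate_mem] with y hyZ hyP
          by_cases hy : y ∈ E
          · rw [indicator_of_mem hy, indicator_of_mem hy, hprod y hy]
            refine ENNReal.ofReal_le_ofReal (Real.exp_le_exp.2 ?_)
            exact sum_log_le_of_mem_cylinder hdisj hJ0 hC hβ0 hβ1 hJ hZ hxZ hyZ hxP hyP hw hx hy
          · rw [indicator_of_notMem hy, indicator_of_notMem hy]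
      _ = _ := by
          rw [lintegral_indicator_const hEm, Measure.restrict_apply hEm, inter_comm]
  have hfin' : m (Δ₀ ∩ E) ≠ ⊤ := measure_ne_top_of_subset inter_subset_left hfin
  have hreal : m.real Δ₀ ≤ Real.exp (C / (1 - β) + S) * m.real (Δ₀ ∩ E) := by
    have := ENNReal.toReal_mono (by finiteness) hle
    rwa [ENNReal.toReal_mul, ENNReal.toReal_ofReal (Real.exp_pos _).le] at this
  rw [show -(C / (1 - β)) - S = -(C / (1 - β) + S) by ring, Real.exp_neg, mul_inv_le_iff₀
    (Real.exp_pos _), mul_comm]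
  exact hreal

end IsMarkovJacobian

end GibbsMarkov

/-! ### Entropy of maps with a Gibbs–Markov induced map -/

section InducedEntropy

variable {M : Type*} [MeasurableSpace M]

/-- A measurable indexing of the elements of a countable partition by natural numbers, together with
the recurrence time as a function of the index. -/
lemma exists_index {P : Set (Set M)} (hP : P.Countable) (hdisj : P.PairwiseDisjoint id)
    (hm : ∀ w ∈ P, MeasurableSet w) {R : M → ℕ} (hR1 : ∀ w ∈ P, ∀ x ∈ w, 1 ≤ R x)
    (hRc : ∀ w ∈ P, ∀ x ∈ w, ∀ y ∈ w, R x = R y) :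
    ∃ (idx : M → ℕ) (ρ : ℕ → ℕ), Measurable idx ∧ (∀ n, 1 ≤ ρ n) ∧
      (∀ x ∈ ⋃₀ P, ρ (idx x) = R x) ∧ ∀ w ∈ P, ∀ x ∈ w, ∀ y, idx y = idx x ↔ y ∈ w := by
  classical
  obtain ⟨e, he⟩ := countable_iff_exists_injOn.1 hP
  -- Index 0 is reserved for points in no partition element. Below, `ρ` defaults to 1 so that the
  -- roof is positive everywhere, as the tower requires.
  let idx : M → ℕ := fun x => if h : x ∈ ⋃₀ P then e h.choose + 1 else 0
  have hidx : ∀ w ∈ P, ∀ x ∈ w, idx x = e w + 1 := by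
    intro w hw x hx
    have h : x ∈ ⋃₀ P := ⟨w, hw, hx⟩
    have h1 : h.choose = w := hdisj.elim_set h.choose_spec.1 hw x h.choose_spec.2 hx
    simp only [idx, dif_pos h, h1]
  have hidx0 : ∀ x, x ∉ ⋃₀ P → idx x = 0 := fun x hx => dif_neg hx
  have hiff : ∀ w ∈ P, ∀ y, idx y = e w + 1 ↔ y ∈ w := by
    intro w hw y
    refine ⟨fun h => ?_, hidx w hw y⟩
    by_cases hy : y ∈ ⋃₀ P
    · obtain ⟨v, hv, hyv⟩ := hy
      rw [hidx v hv y hyv, Nat.add_right_cancel_iff] at h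
      rwa [← he hv hw h]
    · rw [hidx0 y hy] at h
      omega
  let ρ : ℕ → ℕ := fun n => if h : ∃ x ∈ ⋃₀ P, idx x = n then R h.choose else 1
  refine ⟨idx, ρ, measurable_to_countable' fun n => ?_, fun n => ?_, fun x hx => ?_,
    fun w hw x hx y => ?_⟩
  · by_cases hn : ∃ w ∈ P, e w + 1 = n
    · obtain ⟨w, hw, rfl⟩ := hn
      have : idx ⁻¹' {e w + 1} = w := by
        ext y
        exact hiff w hw y
      rw [this]
      exact hm w hw
    · push Not at hn
      rcases Nat.eq_zero_or_pos n with rfl | hn0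
      · have : idx ⁻¹' {0} = (⋃₀ P)ᶜ := by
          ext y
          simp only [mem_preimage, mem_singleton_iff, mem_compl_iff]
          refine ⟨fun h hy => ?_, hidx0 y⟩
          obtain ⟨v, hv, hyv⟩ := hy
          rw [hidx v hv y hyv] at h
          omega
        rw [this]
        exact (MeasurableSet.sUnion hP hm).compl
      · have : idx ⁻¹' {n} = ∅ := by
          ext y
          simp only [mem_preimage, mem_singleton_iff, mem_empty_iff_false, iff_false]
          intro h
          by_cases hy : y ∈ ⋃₀ P
          · obtain ⟨v, hv, hyv⟩ := hy
            exact hn v hv ((hidx v hv y hyv).symm.trans h)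
          · rw [hidx0 y hy] at h
            omega
        rw [this]
        exact MeasurableSet.empty
  · by_cases h : ∃ x ∈ ⋃₀ P, idx x = n
    · simp only [ρ, dif_pos h]
      obtain ⟨w, hw, hxw⟩ := h.choose_spec.1
      exact hR1 w hw _ hxw
    · simp only [ρ, dif_neg h, le_refl]
  · have h : ∃ y ∈ ⋃₀ P, idx y = idx x := ⟨x, hx, rfl⟩
    simp only [ρ, dif_pos h]
    obtain ⟨w, hw, hxw⟩ := hx
    have h1 := (hiff w hw _).1 (h.choose_spec.2.trans (hidx w hw x hxw))
    exact hRc w hw _ h1 _ hxw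
  · rw [hidx w hw x hx]
    exact hiff w hw y

/-- Integrals with respect to a measure spread out from the base of a tower, for functions whose sum
up the tower is bounded below. -/
lemma integral_log_of_tower {idx : M → ℕ} {ρ : ℕ → ℕ} (hidx : Measurable idx) {f : M → M}
    (hf : Measurable f) {ν₀ μ : Measure M} [IsProbabilityMeasure ν₀] [IsProbabilityMeasure μ]
    {c : ℝ≥0∞} (hc : c ≠ ⊤)
    (hμ : μ = c • Measure.sum fun l : ℕ => (ν₀.restrict {x | l < ρ (idx x)}).map f^[l])
    {D G : M → ℝ} (hDm : Measurable D) (hGm : Measurable G) {C K : ℝ} (hDC : ∀ x, D x ≤ C)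
    (hpos : ∀ᵐ x ∂ν₀, ∀ l < ρ (idx x), 0 < D (f^[l] x))
    (hG : ∀ᵐ x ∂ν₀, ∑ l ∈ Finset.range (ρ (idx x)), Real.log (D (f^[l] x)) = G x)
    (hK : ∀ᵐ x ∂ν₀, -K ≤ G x) :
    (∀ᵐ y ∂μ, 0 < D y) ∧ Integrable G ν₀ ∧ Integrable (fun y => Real.log (D y)) μ ∧
      ∫ y, Real.log (D y) ∂μ = c.toReal * ∫ x, G x ∂ν₀ := by
  have hR : Measurable fun x => ρ (idx x) := (measurable_of_countable ρ).comp hidx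
  let pr : M × ℕ → M := fun z => f^[z.2] z.1
  have hpr : Measurable pr := measurable_from_prod_countable_left fun l => hf.iterate l
  set τ := towerMeasure (fun x => ρ (idx x)) ν₀ with hτ
  have hmap : (c • τ).map pr = μ := by
    rw [Measure.map_smul, map_towerMeasure hf, ← hμ]
  have hφ : Measurable fun y => Real.log (D y) := Real.measurable_log.comp hDm
  have hφpr : Measurable fun z => Real.log (D (pr z)) := hφ.comp hpr
  -- This integral is the total mass of the tower, and `c` times it equals one.
  have hτfin : ∫⁻ x, (ρ (idx x) : ℝ≥0∞) ∂ν₀ < ⊤ := by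
    have h1 : τ univ = ∫⁻ x, (ρ (idx x) : ℝ≥0∞) ∂ν₀ := by
      have := lintegral_towerMeasure (ν := ν₀) hR (g := fun _ => 1) measurable_const
      simpa using this
    have h2 : c * τ univ = 1 := by
      have h3 : (c • τ).map pr univ = 1 := by rw [hmap]; exact measure_univ
      rwa [Measure.map_apply hpr MeasurableSet.univ, preimage_univ, Measure.smul_apply,
        smul_eq_mul] at h3
    rw [← h1, lt_top_iff_ne_top]
    intro h
    rw [h] at h2
    rcases eq_or_ne c 0 with rfl | h0
    · simp at h2
    · rw [ENNReal.mul_top h0] at h2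
      exact ENNReal.top_ne_one h2
  have hRint : Integrable (fun x => (ρ (idx x) : ℝ)) ν₀ := by
    refine ⟨(measurable_from_top.comp hR).aestronglyMeasurable, ?_⟩
    rw [HasFiniteIntegral]
    refine lt_of_le_of_lt (lintegral_mono fun x => ?_) hτfin
    simp
  set L := Real.log (max C 1) with hL
  have hL0 : 0 ≤ L := Real.log_nonneg (le_max_right _ _)
  have hφL : ∀ y, 0 < D y → Real.log (D y) ≤ L := fun y hy =>
    Real.log_le_log hy ((hDC y).trans (le_max_left _ _))
  have hGi : Integrable G ν₀ := by
    refine Integrable.mono' ((hRint.mul_const L).add (integrable_const |K|))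
      hGm.aestronglyMeasurable ?_
    filter_upwards [hpos, hG, hK] with x h1 h2 h3
    have h4 : G x ≤ ρ (idx x) * L := by
      rw [← h2]
      refine (Finset.sum_le_sum fun l hl => hφL _ (h1 l (Finset.mem_range.1 hl))).trans ?_
      simp
    have h5 := le_abs_self K
    have h6 := abs_nonneg K
    have h7 : 0 ≤ ρ (idx x) * L := by positivity
    rw [Real.norm_eq_abs, abs_le]
    simp only [Pi.add_apply]
    constructor <;> linarith
  have hφτ : Integrable (fun z => Real.log (D (pr z))) τ := by
    rw [integrable_towerMeasure_iff hR hφpr]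
    -- Since `log D ≤ L` with `L ≥ 0`, one has `|log D| ≤ 2 L - log D`. Summed over a column, where
    -- `log D` adds up to `G`, this gives an integrable majorant.
    have hbd : Integrable (fun x => 2 * L * ρ (idx x) - G x) ν₀ := (hRint.const_mul _).sub hGi
    refine lt_of_le_of_lt (lintegral_mono_ae ?_) hbd.lintegral_lt_top
    filter_upwards [hpos, hG] with x h1 h2
    have h3 : ∀ l ∈ Finset.range (ρ (idx x)), ‖Real.log (D (f^[l] x))‖ ≤
        2 * L - Real.log (D (f^[l] x)) := by
      intro l hl
      have := hφL _ (h1 l (Finset.mem_range.1 hl))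
      rw [Real.norm_eq_abs, abs_le]
      constructor <;> linarith
    have h4 := Finset.sum_le_sum h3
    rw [Finset.sum_sub_distrib, h2, Finset.sum_const, Finset.card_range, nsmul_eq_mul,
      mul_comm] at h4
    calc ∑ l ∈ Finset.range (ρ (idx x)), ‖Real.log (D (pr (x, l)))‖ₑ
        = ENNReal.ofReal (∑ l ∈ Finset.range (ρ (idx x)), ‖Real.log (D (f^[l] x))‖) := by
          rw [ENNReal.ofReal_sum_of_nonneg fun l _ => norm_nonneg _]
          exact Finset.sum_congr rfl fun l _ => (ofReal_norm _).symm
      _ ≤ _ := ENNReal.ofReal_le_ofReal h4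
  have hφi : Integrable (fun y => Real.log (D y)) μ := by
    rw [← hmap]
    exact (integrable_map_measure hφ.aestronglyMeasurable hpr.aemeasurable).2
      (hφτ.smul_measure hc)
  refine ⟨?_, hGi, hφi, ?_⟩
  · rw [← hmap, ae_map_iff hpr.aemeasurable (measurableSet_lt measurable_const hDm)]
    refine (Measure.smul_absolutelyContinuous (c := c)).ae_le ?_
    exact (ae_towerMeasure_iff hR (measurableSet_lt measurable_const (hDm.comp hpr))).2 hpos
  · rw [← hmap, integral_map hpr.aemeasurable hφ.aestronglyMeasurable, integral_smul_measure,
      (integrable_and_integral_towerMeasure hR hφpr hφτ).2, smul_eq_mul]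
    congr 1
    exact integral_congr_ae hG

variable [TopologicalSpace M] [OpensMeasurableSpace M] {m : Measure M} {f : M → M} {U Δ₀ : Set M}
  {P : Set (Set M)} {R : M → ℕ}

lemma IsInducingScheme.measurableSet (h : IsInducingScheme m f Uᶜ Δ₀ P R) {w : Set M}
    (hw : w ∈ P) : MeasurableSet w := by
  obtain ⟨V, hV, rfl⟩ := h.relOpen w hw
  exact h.measurableSet_base.inter hV.measurableSet

lemma IsInducingScheme.subset (h : IsInducingScheme m f Uᶜ Δ₀ P R) {w : Set M} (hw : w ∈ P) :
    w ⊆ Δ₀ := by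
  obtain ⟨V, hV, rfl⟩ := h.relOpen w hw
  exact inter_subset_left

lemma inducedMap_of_mem {w : Set M} (hw : w ∈ P) {x : M} (hx : x ∈ w) :
    inducedMap f P R x = f^[R x] x := if_pos ⟨w, hw, hx⟩

/-- The Jacobian of the induced map is the product of the Jacobians along the orbit. -/
lemma IsInducingScheme.jacobian_eq_prod [SigmaFinite m] (h : IsInducingScheme m f Uᶜ Δ₀ P R)
    (hf : Measurable f) {D : M → ℝ} (hDm : Measurable D) (hD0 : ∀ x, 0 ≤ D x)
    (hJD : IsJacobianOn m f (fun x => ENNReal.ofReal (D x)) U) {J : M → ℝ} (hJm : Measurable J)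
    (hJ0 : ∀ x ∈ Δ₀, 0 < J x) {w : Set M} (hw : w ∈ P)
    (hmk : ∃ A ⊆ w, MeasurableSet A ∧ m (w \ A) = 0 ∧ InjOn (inducedMap f P R) A ∧
      m (Δ₀ \ inducedMap f P R '' A) = 0)
    (hJ : ∀ A ⊆ w, MeasurableSet A →
      m (inducedMap f P R '' A) = ∫⁻ x in A, ENNReal.ofReal (J x) ∂m) :
    ∀ᵐ x ∂m.restrict w, J x = ∏ j ∈ Finset.range (R x), D (f^[j] x) := by
  obtain ⟨A, hAw, hA, hwA, hinj, -⟩ := hmk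
  rcases w.eq_empty_or_nonempty with rfl | ⟨x₀, hx₀⟩
  · simp
  have hR : ∀ x ∈ w, R x = R x₀ := fun x hx => h.time_const w hw x hx x₀ hx₀
  set r := R x₀
  have hF : ∀ x ∈ w, inducedMap f P R x = f^[r] x := fun x hx => by
    rw [inducedMap_of_mem hw hx, hR x hx]
  have hres : m.restrict w = m.restrict A := by
    refine Measure.restrict_congr_set ?_
    rw [ae_eq_set]
    exact ⟨hwA, by rw [sdiff_eq_empty.2 hAw, measure_empty]⟩
  have hprodm : Measurable fun x => ∏ j ∈ Finset.range r, ENNReal.ofReal (D (f^[j] x)) :=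
    Finset.measurable_prod _ fun j _ => (hDm.comp (hf.iterate j)).ennreal_ofReal
  have hU : ∀ x ∈ w, ∀ j < r, f^[j] x ∈ U := by
    intro x hx j hj
    rcases Nat.eq_zero_or_pos j with rfl | hj0
    · have := h.base_subset (h.subset hw hx)
      rwa [compl_compl] at this
    · have := h.avoids w hw x hx j hj0 (by rw [hR x hx]; exact hj.le)
      rwa [notMem_compl_iff] at this
  -- Both functions integrate over every measurable `s ∩ A` to the measure of its image under
  -- `f^[r]`, which is injective there because the induced map is.
  have hae : (fun x => ENNReal.ofReal (J x)) =ᵐ[m.restrict A]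
      fun x => ∏ j ∈ Finset.range r, ENNReal.ofReal (D (f^[j] x)) := by
    refine ae_eq_of_forall_setLIntegral_eq_of_sigmaFinite hJm.ennreal_ofReal hprodm
      fun s hs _ => ?_
    have hsA : s ∩ A ⊆ w := inter_subset_right.trans hAw
    have himg : f^[r] '' (s ∩ A) = inducedMap f P R '' (s ∩ A) :=
      image_congr fun x hx => (hF x (hsA hx)).symm
    rw [Measure.restrict_restrict hs, ← hJ _ hsA (hs.inter hA), ← himg,
      hJD.measure_image_iterate hf r (hs.inter hA) (fun x hx => hU x (hsA hx))]
    intro x hx y hy hxy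
    refine hinj hx.2 hy.2 ?_
    rw [hF x (hsA hx), hF y (hsA hy), hxy]
  rw [hres]
  filter_upwards [hae, ae_restrict_mem hA] with x hx hxA
  rw [← ENNReal.ofReal_prod_of_nonneg fun j _ => hD0 _] at hx
  rw [hR x (hAw hxA)]
  exact (ENNReal.ofReal_eq_ofReal_iff (hJ0 x (h.subset hw (hAw hxA))).le
    (Finset.prod_nonneg fun j _ => hD0 _)).1 hx

/-- The entropy formula for a map with a bounded Jacobian and an ergodic measure given by a
Gibbs–Markov induced map. -/
theorem IsErgodicSRBGivenBy.measureEntropy_eq [SigmaFinite m] {μ : Measure M}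
    (hμ : IsErgodicSRBGivenBy m f Uᶜ Δ₀ P R μ) {D : M → ℝ} (hDm : Measurable D)
    (hD0 : ∀ x, 0 ≤ D x) {C : ℝ} (hDC : ∀ x, D x ≤ C)
    (hJD : IsJacobianOn m f (fun x => ENNReal.ofReal (D x)) U) {E : ℕ → Set M}
    (hEU : ∀ n, E n ⊆ U) (hE : ∀ n, MeasurableSet (E n))
    (hdisj : Pairwise (Function.onFun Disjoint E)) (hinj : ∀ n, InjOn f (E n))
    (hpos : ∀ n, ∀ x ∈ E n, 0 < D x) (hcov : ∀ᵐ x ∂m, 0 < D x → x ∈ ⋃ n, E n) :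
    (∀ᵐ x ∂μ, 0 < D x) ∧ Integrable (fun x => Real.log (D x)) μ ∧
      measureEntropy f μ = ((∫ x, Real.log (D x) ∂μ : ℝ) : EReal) := by
  have hs := hμ.scheme
  have hf := hμ.isSRB.measurePreserving.measurable
  have hμp := hμ.isSRB.isProbabilityMeasure
  obtain ⟨ν₀, hν₀, -, hspread⟩ := hμ.exists_base
  have hν₀p := hν₀.isProbabilityMeasure
  have hF := hν₀.measurePreserving
  have hac := hν₀.absolutelyContinuous
  obtain ⟨J, hJm, hJ0, hJint, Cd, hCd, β, hβ0, hβ1, hJdist⟩ := hμ.gibbsMarkov.exists_jacobian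
  obtain ⟨Z, hZ0, hZ⟩ := hμ.gibbsMarkov.separating
  set F := inducedMap f P R with hFdef
  have hmaps : ∀ w ∈ P, MapsTo F w Δ₀ := fun w hw x hx => by
    rw [hFdef, inducedMap_of_mem hw hx]
    exact hs.returns w hw x hx
  have hMJ : IsMarkovJacobian m F Δ₀ P J :=
    { measurableSet_base := hs.measurableSet_base
      measurable_map := hF.measurable
      countable := hs.countable
      measurableSet := fun w hw => hs.measurableSet hw
      subset := fun w hw => hs.subset hw
      cover := hs.cover
      measurable := hJm
      pos := hJ0
      setLIntegral := fun w hw g hg => setLIntegral_mul_comp_eq hF.measurable (hmaps w hw)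
        (hμ.gibbsMarkov.markov w hw) hJm (hJint w hw) hg }
  -- The recurrence time is at least one, so `m Δ₀` is bounded by its finite integral.
  have hfin : m Δ₀ ≠ ⊤ := by
    refine ne_top_of_le_ne_top hμ.integrable_time.ne ?_
    rw [← setLIntegral_one]
    refine setLIntegral_mono' hs.measurableSet_base fun x hx => ?_
    exact_mod_cast hs.time_pos x hx
  have hΔ0 : m Δ₀ ≠ 0 := hs.base_pos.ne'
  obtain ⟨K, hK⟩ := hMJ.exists_le_measure_cylinder hfin hs.disjoint hCd hβ0 hβ1 hJdist hZ0 hZ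
  obtain ⟨idx, ρ, hidx, hρ, hρR, hidxw⟩ := exists_index hs.countable hs.disjoint
    (fun w hw => hs.measurableSet hw) (fun w hw x hx => hs.time_pos x (hs.subset hw hx))
    hs.time_const
  have hmem : ∀ᵐ x ∂ν₀, ∀ i, F^[i] x ∈ ⋃₀ P := hac.ae_le hMJ.ae_iterate_mem
  have hFf : ∀ᵐ x ∂ν₀, F x = f^[ρ (idx x)] x := by
    filter_upwards [hmem] with x hx
    rw [hρR x (hx 0)]
    exact if_pos (hx 0)
  have hlev : ∀ j : ℕ, ({x ∈ Δ₀ | j < R x} : Set M) =ᵐ[ν₀] {x | j < ρ (idx x)} := by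
    intro j
    filter_upwards [hmem] with x hx
    have h1 : x ∈ Δ₀ := by
      obtain ⟨w, hw, hxw⟩ := hx 0
      exact hs.subset hw hxw
    change (x ∈ Δ₀ ∧ j < R x) = (j < ρ (idx x))
    rw [hρR x (hx 0)]
    exact propext ⟨fun h => h.2, fun h => ⟨h1, h⟩⟩
  obtain ⟨c, hcdef⟩ : ∃ c, c = (∑' j : ℕ, ν₀ {x ∈ Δ₀ | j < R x})⁻¹ := ⟨_, rfl⟩
  have hμc : μ = c • Measure.sum fun l : ℕ => (ν₀.restrict {x | l < ρ (idx x)}).map f^[l] := by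
    rw [hspread, spreadMeasure, ← hcdef]
    congr 2
    funext j
    rw [Measure.restrict_congr_set (hlev j)]
  -- The summand `j = 0` of the normalizing series is the full mass of `ν₀`, hence the series is
  -- nonzero.
  have hc : c ≠ ⊤ := by
    rw [hcdef, Ne, ENNReal.inv_eq_top]
    intro h0
    have h1 := ENNReal.tsum_eq_zero.1 h0 0
    rw [measure_congr (hlev 0)] at h1
    have h2 : {x | 0 < ρ (idx x)} = univ := eq_univ_of_forall fun x => hρ (idx x)
    rw [h2, measure_univ] at h1
    exact one_ne_zero h1
  have hprod : ∀ᵐ x ∂ν₀, J x = ∏ l ∈ Finset.range (ρ (idx x)), D (f^[l] x) := by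
    have h1 : ∀ᵐ x ∂m, ∀ w ∈ P, x ∈ w → J x = ∏ l ∈ Finset.range (R x), D (f^[l] x) := by
      rw [ae_ball_iff hs.countable]
      intro w hw
      exact (ae_restrict_iff' (hs.measurableSet hw)).1 (hs.jacobian_eq_prod hf hDm hD0 hJD hJm hJ0 hw
        (hμ.gibbsMarkov.markov w hw) (hJint w hw))
    filter_upwards [hac.ae_le (ae_restrict_of_ae h1), hmem] with x hx hxP
    rw [hρR x (hxP 0)]
    obtain ⟨w, hw, hxw⟩ := hxP 0
    exact hx w hw hxw
  have hJpos : ∀ᵐ x ∂ν₀, 0 < J x := by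
    filter_upwards [hmem] with x hx
    obtain ⟨w, hw, hxw⟩ := hx 0
    exact hJ0 x (hs.subset hw hxw)
  have hDpos : ∀ᵐ x ∂ν₀, ∀ l < ρ (idx x), 0 < D (f^[l] x) := by
    filter_upwards [hprod, hJpos] with x h1 h2 l hl
    refine lt_of_le_of_ne (hD0 _) fun h0 => ?_
    rw [h1, Finset.prod_eq_zero (Finset.mem_range.2 hl) h0.symm] at h2
    exact lt_irrefl _ h2
  have hGsum : ∀ᵐ x ∂ν₀, ∑ l ∈ Finset.range (ρ (idx x)), Real.log (D (f^[l] x)) =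
      Real.log (J x) := by
    filter_upwards [hprod, hDpos] with x h1 h2
    rw [h1, Real.log_prod fun l hl => (h2 l (Finset.mem_range.1 hl)).ne']
  have hΔr : 0 < m.real Δ₀ := ENNReal.toReal_pos hΔ0 hfin
  -- The cylinder estimate for `n = 1`, together with the trivial bound of the measure of an element
  -- by that of `Δ₀`.
  have hlow : ∀ᵐ x ∂ν₀, -K ≤ Real.log (J x) := by
    filter_upwards [hac.ae_le hK, hmem] with x h1 h2
    obtain ⟨w, hw, hxw⟩ := h2 0
    have h3 := h1 (fun _ => w) (fun _ => hw) 1 (by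
      intro i hi
      obtain rfl : i = 0 := by omega
      exact hxw)
    rw [Finset.sum_range_one, Function.iterate_zero, id] at h3
    have h4 := h3.trans (measureReal_mono inter_subset_left hfin)
    have h5 : Real.exp (-K - Real.log (J x)) ≤ 1 := by
      by_contra! h
      nlinarith
    rw [Real.exp_le_one_iff] at h5
    linarith
  have hGm : Measurable fun x => Real.log (J x) := Real.measurable_log.comp hJm
  obtain ⟨hμpos, hGi, hφi, hφeq⟩ := integral_log_of_tower hidx hf hc hμc hDm hGm hDC hDpos hGsum hlow
  refine ⟨hμpos, hφi, le_antisymm ?_ ?_⟩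
  · rw [hφeq]
    have hmprob : IsProbabilityMeasure ((m Δ₀)⁻¹ • m.restrict Δ₀) := by
      constructor
      rw [Measure.smul_apply, Measure.restrict_apply_univ, smul_eq_mul,
        ENNReal.inv_mul_cancel hΔ0 hfin]
    refine measureEntropy_le_of_tower hρ hidx hf (m' := (m Δ₀)⁻¹ • m.restrict Δ₀) hF hFf hμc hGm hGi
      hc (K := K) ?_ ?_
    · filter_upwards [hac.ae_le hK, hmem] with x h1 h2 j
      choose w hw hxw using h2
      have h3 := h1 w hw j fun i _ => hxw i
      have hset : {y | ∀ i < j, idx (F^[i] y) = idx (F^[i] x)} = {y | ∀ i < j, F^[i] y ∈ w i} := by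
        ext y
        exact forall₂_congr fun i _ => hidxw _ (hw i) _ (hxw i) _
      have hm : MeasurableSet {y | ∀ i < j, F^[i] y ∈ w i} := by
        have : {y | ∀ i < j, F^[i] y ∈ w i} = ⋂ i, ⋂ (_ : i < j), F^[i] ⁻¹' w i := by
          ext; simp
        rw [this]
        exact MeasurableSet.iInter fun i => MeasurableSet.iInter fun _ =>
          (hF.measurable.iterate i) (hs.measurableSet (hw i))
      rw [hset, measureReal_ennreal_smul_apply, measureReal_restrict_apply hm, inter_comm,
        ENNReal.toReal_inv, inv_mul_eq_div, ← measureReal_def, le_div_iff₀ hΔr, mul_comm]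
      exact h3
    -- The base measure `ν₀` is carried by `Δ₀`, so `B` may be replaced by `B ∩ Δ₀`. A condition on
    -- the partition element of `F^[i] x` is one on its index, unless the element is empty.
    · intro B hB
      obtain ⟨B', hB', hBB'⟩ := hμ.gibbsMarkov.generating.1 (B ∩ Δ₀) inter_subset_right
        (hB.inter hs.measurableSet_base)
      refine ⟨B', ?_, ?_⟩
      · refine MeasurableSpace.generateFrom_le ?_ B' hB'
        intro A hA
        simp only [mem_iUnion] at hA
        obtain ⟨n, -, w, hw, rfl⟩ := hA
        have : {x | ∀ i < n, F^[i] x ∈ w i} = ⋂ i, ⋂ (_ : i < n), {x | F^[i] x ∈ w i} := by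
          ext; simp
        rw [this]
        refine MeasurableSet.iInter fun i => MeasurableSet.iInter fun _ => ?_
        rcases (w i).eq_empty_or_nonempty with h0 | ⟨x₀, hx₀⟩
        · rw [h0]
          exact @MeasurableSet.empty _ (_)
        · refine MeasurableSpace.measurableSet_generateFrom ⟨i, idx x₀, ?_⟩
          ext y
          exact (hidxw _ (hw i) _ hx₀ _).symm
      · have h1 : (B : Set M) =ᵐ[m.restrict Δ₀] (B ∩ Δ₀ : Set M) := by
          filter_upwards [ae_restrict_mem hs.measurableSet_base] with x hx
          exact propext ⟨fun h => ⟨h, hx⟩, fun h => h.1⟩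
        exact hac.ae_le (h1.trans hBB')
  · refine integral_log_jacobian_le_measureEntropy hμ.isSRB.absolutelyContinuous
      hμ.isSRB.measurePreserving hJD hEU hE hdisj ?_ hinj hpos hφi
    have : ∀ᵐ x ∂μ, x ∈ ⋃ n, E n := by
      filter_upwards [hμpos, hμ.isSRB.absolutelyContinuous.ae_le hcov] with x h1 h2
      exact h2 h1
    exact this

end InducedEntropy

/-! ### From an abstract Jacobian to the Riemannian determinant. -/

theorem corollaryB {d : ℕ} {H : Type*} [TopologicalSpace H]
    (I : ModelWithCorners ℝ (EuclideanSpace ℝ (Fin d)) H)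
    {M : Type*} [TopologicalSpace M] [ChartedSpace H M] [IsManifold I ∞ M]
    [T2Space M] [SecondCountableTopology M] [MeasurableSpace M] [BorelSpace M]
    [RiemannianBundle (fun x : M => TangentSpace I x)]
    [IsContMDiffRiemannianBundle I ∞ (EuclideanSpace ℝ (Fin d)) (fun x : M => TangentSpace I x)]
    (η : ℝ≥0) (hη₀ : 0 < η) (hη₁ : η ≤ 1) (f : M → M) (N : ℕ → Set M)
    (hf : IsPiecewiseC1Holder I η f N)
    (Δ₀ : Set M) (P : Set (Set M)) (R : M → ℕ) (μ : Measure M)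
    (hμ : IsErgodicSRBGivenBy (riemannianVolume I M) f (singularSet N) Δ₀ P R μ)
    (hdet : ∃ C : ℝ, ∀ x ∉ singularSet N, absDetDeriv I f x ≤ C)
    (hR : ∫⁻ x in Δ₀, (R x : ℝ≥0∞) ^ 2 ∂(riemannianVolume I M) < ⊤) :
    (∀ᵐ x ∂μ, 0 < absDetDeriv I f x) ∧
      Integrable (fun x => Real.log (absDetDeriv I f x)) μ ∧
      measureEntropy f μ = ((∫ x, Real.log (absDetDeriv I f x) ∂μ : ℝ) : EReal) ∧
      measureEntropy f μ < ⊤ := by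
  have hfm : Measurable f := hμ.isSRB.measurePreserving.measurable
  have hμp := hμ.isSRB.isProbabilityMeasure
  have : Nonempty M := nonempty_of_isProbabilityMeasure μ
  have hσ := sigmaFinite_riemannianVolume I (M := M)
  obtain ⟨C, hC⟩ := hdet
  set U : Set M := ⋃ i, N i with hUdef
  have hUo : IsOpen U := isOpen_iUnion hf.isOpen
  have hUm : MeasurableSet U := hUo.measurableSet
  have hU : ∀ᵐ x ∂riemannianVolume I M, x ∈ U := hf.singularSet_null
  have hd : ∀ x ∈ U, MDifferentiableAt I I f x := fun x hx =>
    (hf.isC1HolderOn.1.contMDiffAt (hUo.mem_nhds hx)).mdifferentiableAt one_ne_zero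
  have hCU : ∀ x ∈ U, absDetDeriv I f x ≤ C := fun x hx => hC x (notMem_compl_iff.2 hx)
  have hdm := aemeasurable_absDetDeriv I hfm hUm hd
  have hC0 : 0 ≤ C := by
    have hne : riemannianVolume I M ≠ 0 := fun h0 => by
      have h1 := hμ.scheme.base_pos
      rw [h0] at h1
      exact lt_irrefl _ h1
    have := ae_neBot.2 hne
    obtain ⟨x, hx⟩ := hU.exists
    exact (absDetDeriv_nonneg I f x).trans (hCU x hx)
  -- `absDetDeriv` is only known to be almost everywhere measurable on `U`. This measurable version
  -- is clamped to `[0, C]` so that both bounds hold at every point.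
  let D : M → ℝ := fun x => max 0 (min C (hdm.mk _ x))
  have hDm : Measurable D := measurable_const.max (measurable_const.min hdm.measurable_mk)
  have hDae : ∀ᵐ x ∂riemannianVolume I M, absDetDeriv I f x = D x := by
    filter_upwards [(ae_restrict_iff' hUm).1 hdm.ae_eq_mk, hU] with x h1 h2
    simp only [D]
    rw [← h1 h2, min_eq_right (hCU x h2), max_eq_right (absDetDeriv_nonneg I f x)]
  obtain ⟨V, hVsub, hVm, hV0⟩ := exists_measurable_superset_of_null hDae
  have hVeq : ∀ x ∉ V, absDetDeriv I f x = D x := fun x hx => by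
    by_contra h
    exact hx (hVsub h)
  have hJD : IsJacobianOn (riemannianVolume I M) f (fun x => ENNReal.ofReal (D x)) U :=
    { measurableSet_image := fun A hAU hA hinj =>
        (measurableSet_image_and_riemannianVolume_image I hfm hA (fun x hx => hd x (hAU hx)) hinj).1
      measure_image := fun A hAU hA hinj => by
        rw [(measurableSet_image_and_riemannianVolume_image I hfm hA
          (fun x hx => hd x (hAU hx)) hinj).2]
        refine lintegral_congr_ae (ae_restrict_of_ae ?_)
        filter_upwards [hDae] with x hx
        rw [hx]
      aemeasurable := hDm.ennreal_ofReal.aemeasurable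
      ne_top := fun x => ENNReal.ofReal_ne_top }
  -- Removing the null set `V` makes `D` equal to `absDetDeriv` at every point of `A`, as the
  -- pointwise cover by sets of injectivity requires.
  let A : Set M := (U \ V) ∩ {x | 0 < D x}
  have hA : MeasurableSet A := (hUm.diff hVm).inter (measurableSet_lt measurable_const hDm)
  obtain ⟨t, htm, hAt, htinj⟩ := exists_cover_injOn_of_absDetDeriv_pos I hfm hA
    (fun x hx => hd x hx.1.1) fun x hx => by
      rw [hVeq x hx.1.2]
      exact hx.2
  have htA : ∀ n, disjointed t n ⊆ A := fun n => by
    rw [hAt]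
    exact (disjointed_subset t n).trans (subset_iUnion t n)
  obtain ⟨h1, h2, h3⟩ := IsErgodicSRBGivenBy.measureEntropy_eq (U := U) hμ hDm
    (fun x => le_max_left _ _) (C := C) (fun x => max_le hC0 (min_le_left _ _)) hJD
    (E := disjointed t) (fun n x hx => (htA n hx).1.1) (fun n => MeasurableSet.disjointed htm n)
    (disjoint_disjointed t) (fun n => (htinj n).mono (disjointed_subset t n))
    (fun n x hx => (htA n hx).2) (by
      rw [iUnion_disjointed, ← hAt]
      filter_upwards [hU, measure_eq_zero_iff_ae_notMem.1 hV0] with x hxU hxV hxD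
      exact ⟨⟨hxU, hxV⟩, hxD⟩)
  have hDμ : ∀ᵐ x ∂μ, absDetDeriv I f x = D x := hμ.isSRB.absolutelyContinuous.ae_le hDae
  have hlog : (fun x => Real.log (absDetDeriv I f x)) =ᵐ[μ] fun x => Real.log (D x) := by
    filter_upwards [hDμ] with x hx
    rw [hx]
  have hent : measureEntropy f μ = ((∫ x, Real.log (absDetDeriv I f x) ∂μ : ℝ) : EReal) := by
    rw [h3, integral_congr_ae hlog]
  refine ⟨?_, h2.congr hlog.symm, hent, ?_⟩
  · filter_upwards [h1, hDμ] with x hx1 hx2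
    rwa [hx2]
  · rw [hent]
    exact EReal.coe_lt_top _
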